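/- **Setting.** Fix $m\ge 0$ and a sequence $\pi=(\pi_n)$ of finite partitions $0=t^n_0<\dots<t^n_{k_n}$ with $t^n_{k_n}\to\infty$ and mesh tending to $0$ on compact sets (indices $n$ are dropped). Let $D_m$ be the set of càdlàg paths $x:[0,\infty)\to\mathbb R^m$, with $x(0-):=x(0)$ and $\Delta x(t):=x(t)-x(t-)$. Let $x_t$ and $x_{t-}$ be $x$ stopped at $t$ and $t-$: $x_t(s)=x(s\wedge t)$, and $x_{t-}(s)=x(s)$ for $s<t$, $x_{t-}(s)=x(t-)$ for $s\ge t$. Put $x^n:=\sum_{i<k_n} x(t_{i+1})1_{[t_i,t_{i+1})}$ and $t_n':=\max\{t_i\in\pi_n: t_i<t\}$ ($\max\emptyset:=0$). Let $Q^\pi_m$ be the set of $x\in D_m$ for which the step functions $q_n(t)=\sum_{t_i\le t,\, i<k_n}(x(t_{i+1})-x(t_i))(x(t_{i+1})-x(t_i))'$ converge in the Skorokhod $J_1$ topology on $[0,\infty)$. A non-empty set $\Omega\subset D_m$ is *generic* if (i) for all $x\in\Omega$, $T>0$, one has $x^n_T\in\Omega$ for all large $n$; (ii) for all $x\in\Omega$,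 $t\ge0$ there is a convex neighbourhood $\mathcal U$ of $0$ in $\mathbb R^m$ with $-\Delta x(t)\in\mathcal U$ and $x_t+e1_{[t,\infty)}\in\Omega$ for all $e\in\mathcal U$. Put $\Lambda=\{(t,x_t):t\ge0,\ x\in\Omega\}$ and, for a functional $F$ on $\Lambda$, $F_-(t,x):=F(t,x_{t-})$. $F$ is *left-continuous* if for all $x\in\Omega$, $t\ge 0$ and all sequences $t_n\to t$: (a) $F(s,x_{s-})\to F(t,x_{t-})$ as $s\to t$, $s\le t$; (b) $F(s,x_s)\to F(t,x_{t-})$ as $s\to t$, $s<t$; (c) $F(t_n,x^n_{t_n-})\to F(t,x_{t-})$ if $t_n\le t_n'$ for all $n$; (d) $F(t_n,x^n_{t_n})\to F(t,x_{t-})$ if $t_n<t_n'$ for all $n$. It is *right-continuous* if: (a) $F(s,x_s)\to F(t,x_t)$ as $s\to t$, $s\ge t$; (b) $F(s,x_{s-})\to F(t,x_t)$ as $s\to t$, $s>t$; (c) $F(t_n,x^n_{t_n})\to F(t,x_t)$ if $t_n\ge t_n'$ for all $n$; (d) $F(t_n,x^n_{t_n-})\to F(t,x_t)$ if $t_n>t_n'$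 for all $n$. The *$\pi$-topology* on $\Lambda$ is the initial topology generated by all real functionals on $\Lambda$ that are both left- and right-continuous; *continuous* means continuous for it. The horizontal derivative is $\mathcal DF(t,x_t)=\lim_{h\downarrow0}\frac{F(t+h,x_t)-F(t,x_t)}h$; the vertical derivative $\nabla_xF(t,x_t)$ is the gradient at $e=0$ of $e\mapsto F(t,x_t+e1_{[t,\infty)})$, and $\nabla_x^2F=\nabla_x(\nabla_xF)$. $F$ is *locally bounded* if for all $x\in\Omega$, $T\ge0$ there are $n_0,K$ with $|F(t,x^n_t)|\le K$ for all $n\ge n_0$, $t\le T$. $F$ *admits a modulus of vertical continuity* if for all $x\in\Omega$, $T\ge0$, $r>0$ there is an increasing $\omega:\mathbb R_+\to\mathbb R_+$ with $\omega(0+)=0$ such that, for all large $n$ and all $t\le T$, there is a convex neighbourhood $\mathcal U$ of $0$ containing $\Delta x^n(t)$, with $x^n_{t-}+e1_{[t,\infty)}\in\Omega$ for all $e\in\mathcal U$, and $$|F(t,x^n_{t-}+a1_{[t,\infty)})-F(t,x^n_{t-}+b1_{[t,\infty)})|\le\omega(|a-b|)\qquad\text{for all } a,b\in\mathcal U,\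 |a|,|b|\le r.$$ $C^{1,2}(\Lambda)$ is the set of continuous $F:\Lambda\to\mathbb R$ for which $\mathcal DF,\nabla_xF,\nabla_x^2F$ exist on $\Lambda$, $\mathcal DF$ is right-continuous and locally bounded, $(\nabla_xF)_-$ is left-continuous, $(\nabla^2_xF)_-$ is left-continuous and locally bounded, and $\nabla_x^2F$ admits a modulus of vertical continuity. For $\phi:\Lambda\to\mathbb R^m$ with $\phi_-$ left-continuous, $\phi$ is *$\Lambda$-integrable* if for all $x\in\Omega$, $t\ge0$ the limit $$\mathbf I_\phi(t,x_t)=\int_0^t\phi\,dx:=\lim_{n\to\infty}\ \sum_{t_i\le t,\ i<k_n}\phi(t_i,x^n_{t_i-})\cdot(x(t_{i+1})-x(t_i))$$ exists and depends on $(t,x_t)$ only, and $\mathbf I_\phi:\Lambda\to\mathbb R$ is continuous; $\mathbf I_\phi$ is then called the *pathwise integral* of $\phi$. **Proposition.** Let $\Omega\subset Q^\pi_m$ be generic and $F\in C^{1,2}(\Lambda)$. Then the Föllmer integral $J(t,x_t)=\int_0^t\nabla_xF\,dx$ (the above limit with $\phi=\nabla_xF$) exists on $\Lambda$, and $J:\Lambda\to\mathbb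 R$ is continuous in the $\pi$-topology. In particular $\nabla_xF$ is $\Lambda$-integrable and $J=\mathbf I_{\nabla_xF}$ is its pathwise integral. -/

import Mathlib

open Filter Topology Set
open scoped NNReal

noncomputable section

namespace PathCalc

/-- The state space `ℝ^m` with its Euclidean norm. -/
abbrev Vec (m : ℕ) : Type := EuclideanSpace ℝ (Fin m)

/-- Functions of time `[0,∞)` with values in `ℝ^m`. -/
abbrev Traj (m : ℕ) : Type := ℝ≥0 → Vec m

/-- Right-continuous with left limits. At `t = 0` the filter `𝓝[<] t` is trivial, so no left limit
is required there. -/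
def IsCadlag {V : Type*} [TopologicalSpace V] (x : ℝ≥0 → V) : Prop :=
  ∀ t, ContinuousWithinAt x (Ici t) t ∧ ∃ l, Tendsto x (𝓝[<] t) (𝓝 l)

/-- The jump `Δx(t) = x(t) - x(t-)`. Mathlib's `Function.leftLim x 0` is `x 0`, which is the
convention `x(0-) = x(0)`. -/
def jump {m : ℕ} (x : Traj m) (t : ℝ≥0) : Vec m := x t - Function.leftLim x t

/-- The path `x_t`, stopped at `t`. -/
def stopAt {m : ℕ} (x : Traj m) (t : ℝ≥0) : Traj m := fun s => x (min s t)

/-- The path `x_{t-}`, stopped at `t-`. -/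
def stopLeft {m : ℕ} (x : Traj m) (t : ℝ≥0) : Traj m :=
  fun s => if s < t then x s else Function.leftLim x t

/-- The vertical perturbation `x + e 1_{[t,∞)}`. -/
def bump {m : ℕ} (x : Traj m) (t : ℝ≥0) (e : Vec m) : Traj m :=
  fun s => x s + if t ≤ s then e else 0

/-- A sequence of finite partitions `0 = t^n_0 < ... < t^n_{k_n}` with `t^n_{k_n} → ∞` and mesh
vanishing on compacts. The values `pt n i` with `i > k n` play no role. -/
structure PartitionSeq where
  k : ℕ → ℕ
  pt : ℕ → ℕ → ℝ≥0
  pt_zero : ∀ n, pt n 0 = 0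
  pt_strictMono : ∀ n, StrictMonoOn (pt n) (Iic (k n))
  pt_last : Tendsto (fun n => pt n (k n)) atTop atTop
  mesh : ∀ T : ℝ≥0, ∀ ε > (0 : ℝ≥0), ∀ᶠ n in atTop,
    ∀ i < k n, pt n i ≤ T → pt n (i + 1) - pt n i < ε

variable {m : ℕ}

/-- The point `t'_n = max {t_i < t | t_i ∈ π_n}`, with `max ∅ = 0`. -/
def PartitionSeq.prev (P : PartitionSeq) (n : ℕ) (t : ℝ≥0) : ℝ≥0 :=
  sSup {s | s < t ∧ ∃ i ≤ P.k n, s = P.pt n i}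

/-- The approximation `x^n = ∑ x(t_{i+1}) 1_{[t_i, t_{i+1})}`. -/
def PartitionSeq.approx (P : PartitionSeq) (n : ℕ) (x : Traj m) : Traj m :=
  fun s => ∑ i ∈ Finset.range (P.k n),
    if P.pt n i ≤ s ∧ s < P.pt n (i + 1) then x (P.pt n (i + 1)) else 0

/-- The step functions
`q_n(t) = ∑_{t_i ≤ t} (x(t_{i+1}) - x(t_i)) (x(t_{i+1}) - x(t_i))'`. -/
def PartitionSeq.qvSum (P : PartitionSeq) (n : ℕ) (x : Traj m) (t : ℝ≥0) :
    Matrix (Fin m) (Fin m) ℝ :=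
  ∑ i ∈ Finset.range (P.k n),
    if P.pt n i ≤ t then
      Matrix.vecMulVec (fun a => (x (P.pt n (i + 1)) - x (P.pt n i)) a)
        (fun b => (x (P.pt n (i + 1)) - x (P.pt n i)) b)
    else 0

/-- Convergence of a sequence in the Skorokhod J1 topology on the space of càdlàg functions on
`[0,∞)`: there are increasing bijections `lam n` of `[0,∞)`, converging uniformly to the
identity, with `y_n ∘ lam n → y` uniformly on compacts. -/
def SkorokhodTendsto {V : Type*} [UniformSpace V] (y : ℕ → ℝ≥0 → V) (z : ℝ≥0 → V) : Prop :=
  ∃ lam : ℕ → (ℝ≥0 ≃o ℝ≥0),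
    TendstoUniformly (fun n s => lam n s) (fun s => s) atTop ∧
    ∀ T : ℝ≥0, TendstoUniformlyOn (fun n s => y n (lam n s)) z atTop (Iic T)

/-- The set `Q^π_m` of càdlàg paths with finite quadratic variation along the partitions. -/
def PartitionSeq.Q (P : PartitionSeq) (m : ℕ) : Set (Traj m) :=
  {x | IsCadlag x ∧ ∃ q : ℝ≥0 → Matrix (Fin m) (Fin m) ℝ, IsCadlag q ∧
    SkorokhodTendsto (fun n => P.qvSum n x) q}

/-- Generic sets of càdlàg paths. -/
structure IsGeneric (P : PartitionSeq) (Ω : Set (Traj m)) : Prop where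
  nonempty : Ω.Nonempty
  cadlag : ∀ x ∈ Ω, IsCadlag x
  approx_mem : ∀ x ∈ Ω, ∀ T > (0 : ℝ≥0), ∃ N, ∀ n ≥ N, stopAt (P.approx n x) T ∈ Ω
  bump_mem : ∀ x ∈ Ω, ∀ t : ℝ≥0, ∃ U ∈ 𝓝 (0 : Vec m), Convex ℝ U ∧ -jump x t ∈ U ∧
    ∀ e ∈ U, bump (stopAt x t) t e ∈ Ω

/-- The domain `Λ = {(t, x_t) | t ≥ 0, x ∈ Ω}`. -/
def domain (Ω : Set (Traj m)) : Set (ℝ≥0 × Traj m) :=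
  {z | ∃ x ∈ Ω, z.2 = stopAt x z.1}

/-- Functionals `F(t, x)`. They are written as functions of all pairs, but every notion below only
depends on the values on the domain `Λ` of a generic set. -/
abbrev Functional (m : ℕ) (V : Type*) : Type _ := ℝ≥0 → Traj m → V

/-- The functional `F_-(t, x) = F(t, x_{t-})`. -/
def minus {V : Type*} (F : Functional m V) : Functional m V := fun t x => F t (stopLeft x t)

/-- Left-continuous functionals. -/
structure LeftCont {V : Type*} [TopologicalSpace V] (P : PartitionSeq) (Ω : Set (Traj m))
    (F : Functional m V) : Prop where
  a : ∀ x ∈ Ω, ∀ t, Tendsto (fun s => F s (stopLeft x s)) (𝓝[≤] t) (𝓝 (F t (stopLeft x t)))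
  b : ∀ x ∈ Ω, ∀ t, Tendsto (fun s => F s (stopAt x s)) (𝓝[<] t) (𝓝 (F t (stopLeft x t)))
  c : ∀ x ∈ Ω, ∀ t, ∀ u : ℕ → ℝ≥0, Tendsto u atTop (𝓝 t) → (∀ n, u n ≤ P.prev n t) →
    Tendsto (fun n => F (u n) (stopLeft (P.approx n x) (u n))) atTop (𝓝 (F t (stopLeft x t)))
  d : ∀ x ∈ Ω, ∀ t, ∀ u : ℕ → ℝ≥0, Tendsto u atTop (𝓝 t) → (∀ n, u n < P.prev n t) →
    Tendsto (fun n => F (u n) (stopAt (P.approx n x) (u n))) atTop (𝓝 (F t (stopLeft x t)))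

/-- Right-continuous functionals. -/
structure RightCont {V : Type*} [TopologicalSpace V] (P : PartitionSeq) (Ω : Set (Traj m))
    (F : Functional m V) : Prop where
  a : ∀ x ∈ Ω, ∀ t, Tendsto (fun s => F s (stopAt x s)) (𝓝[≥] t) (𝓝 (F t (stopAt x t)))
  b : ∀ x ∈ Ω, ∀ t, Tendsto (fun s => F s (stopLeft x s)) (𝓝[>] t) (𝓝 (F t (stopAt x t)))
  c : ∀ x ∈ Ω, ∀ t, ∀ u : ℕ → ℝ≥0, Tendsto u atTop (𝓝 t) → (∀ n, P.prev n t ≤ u n) →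
    Tendsto (fun n => F (u n) (stopAt (P.approx n x) (u n))) atTop (𝓝 (F t (stopAt x t)))
  d : ∀ x ∈ Ω, ∀ t, ∀ u : ℕ → ℝ≥0, Tendsto u atTop (𝓝 t) → (∀ n, P.prev n t < u n) →
    Tendsto (fun n => F (u n) (stopLeft (P.approx n x) (u n))) atTop (𝓝 (F t (stopAt x t)))

/-- The π-topology on `Λ`: the initial topology generated by the real functionals that are
left-continuous and right-continuous. -/
def piTopology (P : PartitionSeq) (Ω : Set (Traj m)) : TopologicalSpace (domain Ω) :=
  ⨅ G ∈ {G : Functional m ℝ | LeftCont P Ω G ∧ RightCont P Ω G},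
    TopologicalSpace.induced (fun z : domain Ω => G z.1.1 z.1.2) inferInstance

/-- Continuity of a real functional on `Λ` for the π-topology. -/
def PiContinuous (P : PartitionSeq) (Ω : Set (Traj m)) (F : Functional m ℝ) : Prop :=
  Continuous[piTopology P Ω, inferInstance] (fun z : domain Ω => F z.1.1 z.1.2)

/-- Horizontal differentiability on `Λ`. -/
def HorizDiff (Ω : Set (Traj m)) (F : Functional m ℝ) : Prop :=
  ∀ z ∈ domain Ω, ∃ l : ℝ,
    Tendsto (fun h : ℝ≥0 => (F (z.1 + h) z.2 - F z.1 z.2) / (h : ℝ)) (𝓝[>] 0) (𝓝 l)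

/-- The horizontal derivative `𝒟F`. -/
def horizDeriv (F : Functional m ℝ) : Functional m ℝ := fun t x =>
  limUnder (𝓝[>] (0 : ℝ≥0)) (fun h : ℝ≥0 => (F (t + h) x - F t x) / (h : ℝ))

/-- Vertical differentiability on `Λ`. -/
def VertDiff {V : Type*} [NormedAddCommGroup V] [NormedSpace ℝ V] (Ω : Set (Traj m))
    (F : Functional m V) : Prop :=
  ∀ z ∈ domain Ω, DifferentiableAt ℝ (fun e : Vec m => F z.1 (bump z.2 z.1 e)) 0

/-- The vertical derivative `∇ₓF`. -/
def vertGrad (F : Functional m ℝ) : Functional m (Vec m) := fun t x =>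
  gradient (fun e : Vec m => F t (bump x t e)) 0

/-- The second vertical derivative `∇ₓ²F`, the vertical derivative of `∇ₓF`, as a linear map. -/
def vertHess (F : Functional m ℝ) : Functional m (Vec m →L[ℝ] Vec m) := fun t x =>
  fderiv ℝ (fun e : Vec m => vertGrad F t (bump x t e)) 0

/-- Locally bounded functionals. -/
def LocBdd {V : Type*} [Norm V] (P : PartitionSeq) (Ω : Set (Traj m))
    (F : Functional m V) : Prop :=
  ∀ x ∈ Ω, ∀ T : ℝ≥0, ∃ n₀ : ℕ, ∃ K : ℝ, ∀ n ≥ n₀, ∀ t ≤ T, ‖F t (stopAt (P.approx n x) t)‖ ≤ K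

/-- Functionals that admit a modulus of vertical continuity. The set `U` is the convex
neighbourhood of `0`, containing the jump of `x^n` at `t`, of admissible perturbations of
`x^n_{t-}` at time `t`. -/
def VertModulus {V : Type*} [NormedAddCommGroup V] (P : PartitionSeq) (Ω : Set (Traj m))
    (F : Functional m V) : Prop :=
  ∀ x ∈ Ω, ∀ T : ℝ≥0, ∀ r > (0 : ℝ), ∃ ω : ℝ≥0 → ℝ≥0, Monotone ω ∧
    Tendsto ω (𝓝[>] 0) (𝓝 0) ∧
    ∀ᶠ n in atTop, ∀ t ≤ T, ∃ U ∈ 𝓝 (0 : Vec m), Convex ℝ U ∧ jump (P.approx n x) t ∈ U ∧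
      (∀ e ∈ U, bump (stopLeft (P.approx n x) t) t e ∈ Ω) ∧
      ∀ a ∈ U ∩ Metric.closedBall 0 r, ∀ b ∈ U ∩ Metric.closedBall 0 r,
        ‖F t (bump (stopLeft (P.approx n x) t) t a) - F t (bump (stopLeft (P.approx n x) t) t b)‖
          ≤ ω ‖a - b‖₊

/-- The class `C^{1,2}(Λ)`. -/
structure IsC12 (P : PartitionSeq) (Ω : Set (Traj m)) (F : Functional m ℝ) : Prop where
  cont : PiContinuous P Ω F
  horizDiff : HorizDiff Ω F
  vertDiff : VertDiff Ω F
  vertDiff_grad : VertDiff Ω (vertGrad F)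
  horiz_rightCont : RightCont P Ω (horizDeriv F)
  horiz_locBdd : LocBdd P Ω (horizDeriv F)
  grad_leftCont : LeftCont P Ω (minus (vertGrad F))
  hess_leftCont : LeftCont P Ω (minus (vertHess F))
  hess_locBdd : LocBdd P Ω (minus (vertHess F))
  hess_modulus : VertModulus P Ω (vertHess F)

/-- The left Riemann sums `∑_{t_i ≤ t} φ(t_i, x^n_{t_i-}) · (x(t_{i+1}) - x(t_i))`. -/
def riemannSum (P : PartitionSeq) (φ : Functional m (Vec m)) (n : ℕ) (t : ℝ≥0) (x : Traj m) : ℝ :=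
  ∑ i ∈ Finset.range (P.k n),
    if P.pt n i ≤ t then
      inner ℝ (φ (P.pt n i) (stopLeft (P.approx n x) (P.pt n i)))
        (x (P.pt n (i + 1)) - x (P.pt n i))
    else 0

/-- The Föllmer integral `∫_0^t φ dx`, the limit of the left Riemann sums. -/
def follmerIntegral (P : PartitionSeq) (φ : Functional m (Vec m)) : Functional m ℝ := fun t x =>
  limUnder atTop (fun n => riemannSum P φ n t x)

/-- `I` is the pathwise integral of `φ`: the functional `φ_-` is left-continuous, the Riemann sums
converge for all `x ∈ Ω` and `t ≥ 0`, their limit is `I(t, x_t)`, and `I` is continuous on `Λ`. -/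
structure IsPathwiseIntegral (P : PartitionSeq) (Ω : Set (Traj m)) (φ : Functional m (Vec m))
    (I : Functional m ℝ) : Prop where
  leftCont : LeftCont P Ω (minus φ)
  tendsto : ∀ x ∈ Ω, ∀ t, Tendsto (fun n => riemannSum P φ n t x) atTop (𝓝 (I t (stopAt x t)))
  cont : PiContinuous P Ω I

/-- `Λ`-integrable functionals. -/
def IsPathwiseIntegrable (P : PartitionSeq) (Ω : Set (Traj m)) (φ : Functional m (Vec m)) : Prop :=
  ∃ I : Functional m ℝ, IsPathwiseIntegral P Ω φ I

end PathCalc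

end

noncomputable section

namespace PathCalc

/-! Along the step path `x^n` the change of variable formula is elementary. Between partition points
only time moves, so `F(s, x^n_s) - F(0, x^n_0)` is the integral of `𝒟F` plus the vertical increments
of `F` at the positive partition points up to `s` (`approx_change_of_variable`). Each vertical
increment is a term of the Riemann sum plus a first-order remainder. Hence, apart from its vanishing
zeroth term, the Riemann sum is the increment of `F` minus the horizontal integral minus the sum of
remainders (`gradSum_eq`). It suffices that these converge, jointly in `n → ∞` and `s → t`,
separately on the two sides of `t'_n`.

For `F` this is one-sided continuity, and for the horizontal integral it is dominated convergence.
The remainders are compared with squared increments. By a second-order Taylor expansion they are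
dominated by `C |δ|²` near any time (`vertRem_bound`). Strictly before `t'_n`, where increments are
small, they are `½⟨H δ, δ⟩` up to `ε |δ|²`, with `H` the second derivative at `(t, x_{t-})`
(`vertRem_left`). The single remainder at `t'_n` converges because `F` does. A continuity argument
in the lower time bound, controlled by the limit `μ` of the sums of squares, then makes the
remainder sums Cauchy (`cauchySeq_of_oscLE`); their limit is never computed.

Skorokhod convergence of the quadratic sums enters through `stepSum_tendsto_of_skorokhod`: a jump of
the limit at `t` can only come from the increment starting at `t'_n`, so the sums converge on each
side of `t'_n`.

Finally, the Föllmer integral along `x^n_s` is exactly the finite sum `gradSum`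
(`follmerIntegral_approx`), and the limits of `gradSum` on the two sides of `t'_n` are the integrals
along `x_{t-}` and `x_t` (`tendsto_gradSum`). One-sided continuity of the integral is thus a
restatement of the joint convergence, and a functional continuous from both sides is one of the
generators of the `π`-topology. -/

theorem nhdsLT_neBot_of_pos {t : ℝ≥0} (ht : 0 < t) : (𝓝[<] t).NeBot :=
  nhdsLT_neBot_of_exists_lt ⟨0, ht⟩

/-! ### Partition points -/

section Partition

variable (P : PartitionSeq) (n : ℕ)

theorem PartitionSeq.pt_lt_pt {i j : ℕ} (hij : i < j) (hj : j ≤ P.k n) : P.pt n i < P.pt n j :=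
  P.pt_strictMono n (show i ≤ P.k n by omega) hj hij

theorem PartitionSeq.pt_le_pt {i j : ℕ} (hij : i ≤ j) (hj : j ≤ P.k n) : P.pt n i ≤ P.pt n j :=
  (P.pt_strictMono n).monotoneOn (show i ≤ P.k n by omega) hj hij

theorem PartitionSeq.pt_lt_iff {i j : ℕ} (hi : i ≤ P.k n) (hj : j ≤ P.k n) :
    P.pt n i < P.pt n j ↔ i < j :=
  (P.pt_strictMono n).lt_iff_lt hi hj

theorem PartitionSeq.pt_inj {i j : ℕ} (hi : i ≤ P.k n) (hj : j ≤ P.k n)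
    (h : P.pt n i = P.pt n j) : i = j :=
  (P.pt_strictMono n).injOn hi hj h

theorem PartitionSeq.prev_zero : P.prev n 0 = 0 := by
  have : {s : ℝ≥0 | s < 0 ∧ ∃ i ≤ P.k n, s = P.pt n i} = ∅ := by
    ext s; simp
  rw [PartitionSeq.prev, this, csSup_empty]; rfl

theorem PartitionSeq.finite_lt (t : ℝ≥0) : {s | s < t ∧ ∃ i ≤ P.k n, s = P.pt n i}.Finite := by
  refine ((Set.finite_Iic (P.k n)).image (P.pt n)).subset ?_
  rintro s ⟨-, i, hi, rfl⟩
  exact ⟨i, hi, rfl⟩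

variable {n}

theorem PartitionSeq.le_prev {t : ℝ≥0} {i : ℕ} (hi : i ≤ P.k n) (h : P.pt n i < t) :
    P.pt n i ≤ P.prev n t :=
  le_csSup (P.finite_lt n t).bddAbove ⟨h, i, hi, rfl⟩

theorem PartitionSeq.exists_prev {t : ℝ≥0} (ht : 0 < t) :
    ∃ i ≤ P.k n, P.pt n i = P.prev n t ∧ P.pt n i < t := by
  have hne : {s | s < t ∧ ∃ i ≤ P.k n, s = P.pt n i}.Nonempty :=
    ⟨P.pt n 0, by rwa [P.pt_zero], 0, Nat.zero_le _, rfl⟩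
  obtain ⟨h1, i, hi, h2⟩ := hne.csSup_mem (P.finite_lt n t)
  exact ⟨i, hi, h2.symm, h2 ▸ h1⟩

theorem PartitionSeq.prev_lt {t : ℝ≥0} (ht : 0 < t) : P.prev n t < t := by
  obtain ⟨i, -, h, h'⟩ := P.exists_prev (n := n) ht
  exact h ▸ h'

theorem PartitionSeq.prev_le (t : ℝ≥0) : P.prev n t ≤ t := by
  rcases eq_or_lt_of_le (zero_le : (0 : ℝ≥0) ≤ t) with h | h
  · rw [← h, P.prev_zero]
  · exact (P.prev_lt h).le

theorem PartitionSeq.exists_prev_next {t : ℝ≥0} (ht : 0 < t) (hl : t ≤ P.pt n (P.k n)) :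
    ∃ i < P.k n, P.pt n i = P.prev n t ∧ P.pt n i < t ∧ t ≤ P.pt n (i + 1) := by
  obtain ⟨i, hi, h, h'⟩ := P.exists_prev (n := n) ht
  have hik : i < P.k n := by
    rcases hi.lt_or_eq with h1 | h1
    · exact h1
    · subst h1; exact absurd h' (not_lt.mpr hl)
  refine ⟨i, hik, h, h', ?_⟩
  by_contra! hlt
  exact absurd (P.le_prev hik hlt) (not_le.mpr (h ▸ P.pt_lt_pt n (Nat.lt_succ_self i) hik))

theorem PartitionSeq.next_le_prev {t : ℝ≥0} {i : ℕ} (hi : i < P.k n)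
    (h : P.pt n i < P.prev n t) : P.pt n (i + 1) ≤ P.prev n t := by
  rcases eq_or_lt_of_le (zero_le : (0 : ℝ≥0) ≤ t) with h0 | h0
  · rw [← h0, P.prev_zero] at h; exact absurd h (not_lt.mpr zero_le)
  · obtain ⟨j, hj, h1, -⟩ := P.exists_prev (n := n) h0
    rw [← h1] at h ⊢
    exact P.pt_le_pt n ((P.pt_lt_iff n hi.le hj).1 h) hj

theorem PartitionSeq.le_of_prev_lt {t : ℝ≥0} {i : ℕ} (hi : i ≤ P.k n)
    (h : P.prev n t < P.pt n i) : t ≤ P.pt n i := by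
  by_contra! hlt
  exact absurd (P.le_prev hi hlt) (not_le.mpr h)

theorem PartitionSeq.eventually_lt_last (T : ℝ≥0) : ∀ᶠ n in atTop, T < P.pt n (P.k n) :=
  P.pt_last.eventually_gt_atTop T

/-- The filter of pairs `(n, s)` with `n → ∞` and `s → t`. -/
def fullFilter (t : ℝ≥0) : Filter (ℕ × ℝ≥0) := atTop ×ˢ 𝓝 t

/-- Pairs `(n, s)` with `n → ∞` and `s → t` to the left of `t'_n`. -/
def PartitionSeq.leftFilter (t : ℝ≥0) : Filter (ℕ × ℝ≥0) :=
  fullFilter t ⊓ 𝓟 {p | p.2 < P.prev p.1 t}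

/-- Pairs `(n, s)` with `n → ∞` and `s → t` at or to the right of `t'_n`. -/
def PartitionSeq.rightFilter (t : ℝ≥0) : Filter (ℕ × ℝ≥0) :=
  fullFilter t ⊓ 𝓟 {p | P.prev p.1 t ≤ p.2}

instance (t : ℝ≥0) : (fullFilter t).IsCountablyGenerated := by
  unfold fullFilter; infer_instance

theorem eventually_fullFilter {t : ℝ≥0} {p : ℕ × ℝ≥0 → Prop} :
    (∀ᶠ z in fullFilter t, p z) ↔
      ∃ N : ℕ, ∃ η > (0 : ℝ), ∀ n ≥ N, ∀ s, dist s t < η → p (n, s) := by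
  unfold fullFilter
  rw [(atTop_basis.prod Metric.nhds_basis_ball).eventually_iff]
  constructor
  · rintro ⟨⟨N, η⟩, ⟨-, hη⟩, h⟩
    exact ⟨N, η, hη, fun n hn s hs => h (x := (n, s)) ⟨hn, hs⟩⟩
  · rintro ⟨N, η, hη, h⟩
    exact ⟨⟨N, η⟩, ⟨trivial, hη⟩, fun z hz => h z.1 hz.1 z.2 hz.2⟩

theorem tendsto_fullFilter {α : Type*} {l : Filter α} {f : α → ℕ} {g : α → ℝ≥0} {t : ℝ≥0}
    (hf : Tendsto f l atTop) (hg : Tendsto g l (𝓝 t)) :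
    Tendsto (fun a => (f a, g a)) l (fullFilter t) :=
  hf.prodMk hg

theorem PartitionSeq.tendsto_leftFilter {α : Type*} {l : Filter α} {f : α → ℕ} {g : α → ℝ≥0}
    {t : ℝ≥0} (hf : Tendsto f l atTop) (hg : Tendsto g l (𝓝 t))
    (h : ∀ᶠ a in l, g a < P.prev (f a) t) :
    Tendsto (fun a => (f a, g a)) l (P.leftFilter t) :=
  tendsto_inf.2 ⟨tendsto_fullFilter hf hg, tendsto_principal.2 h⟩

theorem PartitionSeq.tendsto_rightFilter {α : Type*} {l : Filter α} {f : α → ℕ} {g : α → ℝ≥0}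
    {t : ℝ≥0} (hf : Tendsto f l atTop) (hg : Tendsto g l (𝓝 t))
    (h : ∀ᶠ a in l, P.prev (f a) t ≤ g a) :
    Tendsto (fun a => (f a, g a)) l (P.rightFilter t) :=
  tendsto_inf.2 ⟨tendsto_fullFilter hf hg, tendsto_principal.2 h⟩

/-- This makes every left-hand statement at time zero vacuous. -/
theorem PartitionSeq.leftFilter_zero : P.leftFilter 0 = ⊥ := by
  have : {p : ℕ × ℝ≥0 | p.2 < P.prev p.1 0} = ∅ := by
    ext p; simp [P.prev_zero]
  rw [PartitionSeq.leftFilter, this, principal_empty, inf_bot_eq]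

theorem PartitionSeq.tendsto_prev (t : ℝ≥0) : Tendsto (fun n => P.prev n t) atTop (𝓝 t) := by
  rcases eq_or_lt_of_le (zero_le : (0 : ℝ≥0) ≤ t) with h0 | h0
  · simp [← h0, P.prev_zero]
  rw [tendsto_order]
  refine ⟨fun a ha => ?_, fun a ha => Eventually.of_forall fun n => (P.prev_le t).trans_lt ha⟩
  filter_upwards [P.mesh t (t - a) (tsub_pos_of_lt ha), P.eventually_lt_last t] with n hn hl
  obtain ⟨i, hi, h1, h2, h3⟩ := P.exists_prev_next h0 hl.le
  have h4 := hn i hi h2.le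
  rw [← h1]
  by_contra! hle
  exact absurd h4 (not_lt.mpr (tsub_le_tsub h3 hle))

/-- The predecessor of `t'_n` is the last partition point that still counts as left of `t`. It
allows the contribution of `t'_n` to be split off from everything before it. -/
theorem PartitionSeq.tendsto_prev_leftFilter {t : ℝ≥0} (ht : 0 < t) :
    Tendsto (fun n => (n, P.prev n (P.prev n t))) atTop (P.leftFilter t) := by
  have h0 : ∀ᶠ n in atTop, 0 < P.prev n t := (P.tendsto_prev t).eventually (lt_mem_nhds ht)
  refine P.tendsto_leftFilter tendsto_id ?_ (h0.mono fun n hn => P.prev_lt hn)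
  rw [tendsto_order]
  refine ⟨fun a ha => ?_, fun a ha => Eventually.of_forall fun n =>
    ((P.prev_le _).trans (P.prev_le t)).trans_lt ha⟩
  -- The last partition point before `b` eventually exceeds `a`. It is also below `t'_n`, because
  -- `t'_n > b` eventually, so it is at most the predecessor of `t'_n`.
  obtain ⟨b, hab, hbt⟩ := exists_between ha
  filter_upwards [(P.tendsto_prev b).eventually (lt_mem_nhds hab),
    (P.tendsto_prev t).eventually (lt_mem_nhds hbt)] with n h1 h2
  obtain ⟨i, hi, h3, h4⟩ := P.exists_prev (n := n) ((zero_le : (0 : ℝ≥0) ≤ a).trans_lt hab)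
  exact (h3 ▸ h1).trans_le (P.le_prev hi (h4.trans h2))

theorem PartitionSeq.eventually_next {t : ℝ≥0} {V : Set ℝ≥0} (hV : V ∈ 𝓝 t) :
    ∀ᶠ p in fullFilter t, ∀ i < P.k p.1, P.pt p.1 i = p.2 → P.pt p.1 (i + 1) ∈ V := by
  obtain ⟨ε, hε, hball⟩ := Metric.mem_nhds_iff.1 hV
  have h1 : ∀ᶠ p : ℕ × ℝ≥0 in fullFilter t, ∀ i < P.k p.1, P.pt p.1 i ≤ t + 1 →
      P.pt p.1 (i + 1) - P.pt p.1 i < (ε / 2).toNNReal :=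
    (tendsto_fst : Tendsto Prod.fst (atTop ×ˢ 𝓝 t) atTop).eventually
      (P.mesh (t + 1) _ (by simpa using hε))
  have h2 : ∀ᶠ p : ℕ × ℝ≥0 in fullFilter t, dist p.2 t < min (ε / 2) 1 :=
    (tendsto_snd : Tendsto Prod.snd (atTop ×ˢ 𝓝 t) (𝓝 t)).eventually
      (Metric.ball_mem_nhds _ (by positivity))
  filter_upwards [h1, h2] with p h1 h2 i hi hpi
  rw [NNReal.dist_eq] at h2
  obtain ⟨h3, h4⟩ := lt_min_iff.1 h2
  have h5 : P.pt p.1 i ≤ t + 1 := by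
    rw [hpi, ← NNReal.coe_le_coe]; push_cast; linarith [(abs_lt.1 h4).2]
  have h6 := h1 i hi h5
  have h7 : P.pt p.1 i ≤ P.pt p.1 (i + 1) := P.pt_le_pt _ (Nat.le_succ _) hi
  apply hball
  rw [Metric.mem_ball, NNReal.dist_eq]
  rw [← NNReal.coe_lt_coe, NNReal.coe_sub h7, Real.coe_toNNReal _ (by positivity)] at h6
  rw [hpi] at h6 h7
  have h8 : (p.2 : ℝ) ≤ P.pt p.1 (i + 1) := h7
  rw [abs_lt] at h3 ⊢
  constructor <;> linarith

end Partition

/-! ### Sums along partitions -/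

section StepSum

variable {E : Type*} [AddCommGroup E] (P : PartitionSeq) (n : ℕ)

/-- The step function `∑_{t_i ≤ s} c_i`. -/
def PartitionSeq.stepSum (c : ℕ → E) (s : ℝ≥0) : E :=
  ∑ i ∈ Finset.range (P.k n), if P.pt n i ≤ s then c i else 0

variable {P n}

theorem stepSum_sub (c : ℕ → E) {r s : ℝ≥0} (hrs : r ≤ s) :
    P.stepSum n c s - P.stepSum n c r =
      ∑ i ∈ Finset.range (P.k n), if r < P.pt n i ∧ P.pt n i ≤ s then c i else 0 := by
  rw [PartitionSeq.stepSum, PartitionSeq.stepSum, ← Finset.sum_sub_distrib]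
  refine Finset.sum_congr rfl fun i _ => ?_
  by_cases h1 : P.pt n i ≤ r
  · simp [h1, h1.trans hrs, not_lt.mpr h1]
  · simp [h1, not_le.mp h1]

theorem stepSum_add (c d : ℕ → E) (s : ℝ≥0) :
    P.stepSum n (fun i => c i + d i) s = P.stepSum n c s + P.stepSum n d s := by
  simp only [PartitionSeq.stepSum, ← Finset.sum_add_distrib]
  refine Finset.sum_congr rfl fun i _ => ?_
  split_ifs <;> simp

theorem stepSum_map {E' : Type*} [AddCommGroup E'] (L : E →+ E') (c : ℕ → E) (s : ℝ≥0) :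
    P.stepSum n (fun i => L (c i)) s = L (P.stepSum n c s) := by
  simp only [PartitionSeq.stepSum, map_sum]
  refine Finset.sum_congr rfl fun i _ => ?_
  split_ifs <;> simp

theorem abs_stepSum_sub_le_of_le {c d : ℕ → ℝ} {r s : ℝ≥0} (hrs : r ≤ s)
    (h : ∀ i < P.k n, r < P.pt n i → P.pt n i ≤ s → |c i| ≤ d i) :
    |P.stepSum n c s - P.stepSum n c r| ≤ P.stepSum n d s - P.stepSum n d r := by
  rw [stepSum_sub c hrs, stepSum_sub d hrs]
  refine (Finset.abs_sum_le_sum_abs _ _).trans (Finset.sum_le_sum fun i hi => ?_)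
  split_ifs with h1
  · exact h i (Finset.mem_range.1 hi) h1.1 h1.2
  · simp

theorem abs_stepSum_sub_le {c d : ℕ → ℝ} {r s : ℝ≥0}
    (h : ∀ i < P.k n, min r s < P.pt n i → P.pt n i ≤ max r s → |c i| ≤ d i) :
    |P.stepSum n c s - P.stepSum n c r| ≤ |P.stepSum n d s - P.stepSum n d r| := by
  rcases le_total r s with hrs | hrs
  · rw [min_eq_left hrs, max_eq_right hrs] at h
    exact (abs_stepSum_sub_le_of_le hrs h).trans (le_abs_self _)
  · rw [min_eq_right hrs, max_eq_left hrs] at h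
    rw [abs_sub_comm, abs_sub_comm (P.stepSum n d s)]
    exact (abs_stepSum_sub_le_of_le hrs h).trans (le_abs_self _)

theorem stepSum_mono {d : ℕ → ℝ} (hd : ∀ i, 0 ≤ d i) : Monotone (P.stepSum n d) := by
  intro r s hrs
  have := abs_stepSum_sub_le_of_le (P := P) (n := n) (c := fun _ => 0) (d := d) hrs
    (fun i _ _ _ => by simpa using hd i)
  exact sub_nonneg.1 ((abs_nonneg _).trans this)

theorem stepSum_eventually_right (c : ℕ → E) (t : ℝ≥0) :
    ∀ᶠ s in 𝓝[≥] t, P.stepSum n c s = P.stepSum n c t := by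
  have : ∀ᶠ s in 𝓝[≥] t, ∀ i ∈ Finset.range (P.k n), (P.pt n i ≤ s ↔ P.pt n i ≤ t) := by
    rw [Finset.eventually_all]
    intro i _
    rcases le_or_gt (P.pt n i) t with h | h
    · filter_upwards [self_mem_nhdsWithin] with s hs
      exact ⟨fun _ => h, fun _ => h.trans hs⟩
    · filter_upwards [mem_nhdsWithin_of_mem_nhds (gt_mem_nhds h)] with s hs
      exact ⟨fun h' => absurd h' (not_le.mpr hs), fun h' => absurd h' (not_le.mpr h)⟩
  filter_upwards [this] with s hs
  exact Finset.sum_congr rfl fun i hi => by simp only [hs i hi]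

theorem stepSum_eventually_left (c : ℕ → E) (t : ℝ≥0) :
    ∀ᶠ s in 𝓝[<] t, P.stepSum n c s =
      ∑ i ∈ Finset.range (P.k n), if P.pt n i < t then c i else 0 := by
  have : ∀ᶠ s in 𝓝[<] t, ∀ i ∈ Finset.range (P.k n), (P.pt n i ≤ s ↔ P.pt n i < t) := by
    rw [Finset.eventually_all]
    intro i _
    rcases le_or_gt t (P.pt n i) with h | h
    · filter_upwards [self_mem_nhdsWithin] with s hs
      exact ⟨fun h' => h'.trans_lt hs, fun h' => absurd h' (not_lt.mpr h)⟩
    · filter_upwards [mem_nhdsWithin_of_mem_nhds (lt_mem_nhds h)] with s hs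
      exact ⟨fun _ => h, fun _ => le_of_lt hs⟩
  filter_upwards [this] with s hs
  exact Finset.sum_congr rfl fun i hi => by simp only [hs i hi]

theorem stepSum_sub_left (c : ℕ → E) (t : ℝ≥0) :
    P.stepSum n c t - (∑ i ∈ Finset.range (P.k n), if P.pt n i < t then c i else 0) =
      ∑ i ∈ Finset.range (P.k n), if P.pt n i = t then c i else 0 := by
  rw [PartitionSeq.stepSum, ← Finset.sum_sub_distrib]
  refine Finset.sum_congr rfl fun i _ => ?_
  rcases lt_trichotomy (P.pt n i) t with h | h | h
  · simp [h, h.le, h.ne]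
  · simp [h]
  · simp [not_le.mpr h, not_lt.mpr h.le, h.ne']

theorem sum_pt_eq (c : ℕ → E) {j : ℕ} (hj : j < P.k n) :
    (∑ i ∈ Finset.range (P.k n), if P.pt n i = P.pt n j then c i else 0) = c j := by
  rw [Finset.sum_eq_single_of_mem j (Finset.mem_range.2 hj)]
  · simp
  · intro i hi hij
    rw [if_neg]
    exact fun h => hij (P.pt_inj n (Finset.mem_range.1 hi).le hj.le h)

theorem stepSum_prev (c : ℕ → E) {j : ℕ} (hj : j < P.k n) (hj0 : 0 < P.pt n j) :
    P.stepSum n c (P.pt n j) = P.stepSum n c (P.prev n (P.pt n j)) + c j := by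
  have h1 := stepSum_sub_left (P := P) (n := n) c (P.pt n j)
  rw [sum_pt_eq c hj, sub_eq_iff_eq_add'] at h1
  rw [h1]
  congr 1
  refine Finset.sum_congr rfl fun i hi => ?_
  have : P.pt n i < P.pt n j ↔ P.pt n i ≤ P.prev n (P.pt n j) :=
    ⟨fun h => P.le_prev (Finset.mem_range.1 hi).le h, fun h => h.trans_lt (P.prev_lt hj0)⟩
  simp only [this]

end StepSum

/-! ### Skorokhod limits of step functions, on either side of `t'_n` -/

section Skorokhod

variable (P : PartitionSeq)

/-- Where the limit jumps, the time changes must send `t` to a point at which the step function has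
a comparable jump. By `hc` all terms near `t` are small except possibly the one at `t'_n`, so `lam n
t = t'_n` eventually, and the sides of `t'_n` correspond to the sides of `t`. -/
theorem stepSum_tendsto_of_skorokhod {c : ℕ → ℕ → ℝ} {g : ℝ≥0 → ℝ}
    (hS : SkorokhodTendsto (fun n s => P.stepSum n (c n) s) g) {t : ℝ≥0} {l : ℝ}
    (hr : ContinuousWithinAt g (Ici t) t) (hl : Tendsto g (𝓝[<] t) (𝓝 l))
    (hc : ∀ ε > (0 : ℝ), ∀ᶠ p in fullFilter t, ∀ i < P.k p.1, P.pt p.1 i = p.2 →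
      p.2 ≠ P.prev p.1 t → |c p.1 i| < ε) :
    Tendsto (fun p : ℕ × ℝ≥0 => P.stepSum p.1 (c p.1) p.2) (P.rightFilter t) (𝓝 (g t)) ∧
    Tendsto (fun p : ℕ × ℝ≥0 => P.stepSum p.1 (c p.1) p.2) (P.leftFilter t) (𝓝 l) := by
  obtain ⟨lam, hlam, hg⟩ := hS
  have hfst : Tendsto (fun p : ℕ × ℝ≥0 => p.1) (fullFilter t) atTop := tendsto_fst
  have hsnd : Tendsto (fun p : ℕ × ℝ≥0 => p.2) (fullFilter t) (𝓝 t) := tendsto_snd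
  -- In the coordinate `v = lam⁻¹(s)`, uniform convergence says that the sums minus `g ∘ v` tend to
  -- zero. Only the side of `t` on which `v` lies remains to be decided.
  set v : ℕ × ℝ≥0 → ℝ≥0 := fun p => (lam p.1).symm p.2 with hv
  set q : ℕ × ℝ≥0 → ℝ := fun p => P.stepSum p.1 (c p.1) p.2 with hq
  have hvt : Tendsto v (fullFilter t) (𝓝 t) := by
    rw [tendsto_iff_dist_tendsto_zero] at hsnd ⊢
    rw [Metric.tendsto_nhds] at hsnd ⊢
    intro ε hε
    filter_upwards [hfst.eventually (Metric.tendstoUniformly_iff.1 hlam (ε / 2) (half_pos hε)),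
      hsnd (ε / 2) (half_pos hε)] with p h1 h2
    have h3 := h1 (v p)
    simp only [hv, OrderIso.apply_symm_apply] at h3
    simp only [dist_zero_right, Real.norm_eq_abs, abs_of_nonneg dist_nonneg] at h2 ⊢
    calc dist (v p) t ≤ dist (v p) p.2 + dist p.2 t := dist_triangle _ _ _
      _ < ε := by linarith
  have hqg : Tendsto (fun p => q p - g (v p)) (fullFilter t) (𝓝 0) := by
    rw [Metric.tendsto_nhds]
    intro ε hε
    filter_upwards [hfst.eventually (Metric.tendstoUniformlyOn_iff.1 (hg (t + 1)) ε hε),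
      hvt.eventually (gt_mem_nhds (show t < t + 1 by simp))] with p h1 h2
    have h3 := h1 (v p) h2.le
    simp only [hv, OrderIso.apply_symm_apply] at h3
    rw [dist_zero_right, ← dist_eq_norm, dist_comm]
    exact h3
  have hR : Tendsto q (fullFilter t ⊓ 𝓟 {p | t ≤ v p}) (𝓝 (g t)) := by
    have h1 : Tendsto v (fullFilter t ⊓ 𝓟 {p | t ≤ v p}) (𝓝[≥] t) :=
      tendsto_nhdsWithin_iff.2 ⟨hvt.mono_left inf_le_left, eventually_inf_principal.2
        (Eventually.of_forall fun p h => h)⟩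
    simpa using (hqg.mono_left inf_le_left).add (hr.tendsto.comp h1)
  have hL : Tendsto q (fullFilter t ⊓ 𝓟 {p | v p < t}) (𝓝 l) := by
    have h1 : Tendsto v (fullFilter t ⊓ 𝓟 {p | v p < t}) (𝓝[<] t) :=
      tendsto_nhdsWithin_iff.2 ⟨hvt.mono_left inf_le_left, eventually_inf_principal.2
        (Eventually.of_forall fun p h => h)⟩
    simpa using (hqg.mono_left inf_le_left).add (hl.comp h1)
  have key : (∀ᶠ n in atTop, lam n t = P.prev n t) →
      Tendsto q (P.rightFilter t) (𝓝 (g t)) ∧ Tendsto q (P.leftFilter t) (𝓝 l) := by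
    intro h
    have h' := hfst.eventually h
    refine ⟨hR.mono_left (le_inf inf_le_left ?_), hL.mono_left (le_inf inf_le_left ?_)⟩
    · refine le_principal_iff.2 (eventually_inf_principal.2 ?_)
      filter_upwards [h'] with p hp hp'
      exact (lam p.1).le_symm_apply.2 (hp.trans_le hp')
    · refine le_principal_iff.2 (eventually_inf_principal.2 ?_)
      filter_upwards [h'] with p hp hp'
      exact (lam p.1).symm_apply_lt.2 (lt_of_lt_of_eq hp' hp.symm)
  rcases eq_or_lt_of_le (zero_le : (0 : ℝ≥0) ≤ t) with h0 | h0
  · refine key (Eventually.of_forall fun n => ?_)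
    rw [← h0, P.prev_zero]
    exact map_bot (lam n)
  -- Without a jump at `t` both sides have the same limit, and the position of `lam n t` is
  -- irrelevant.
  by_cases hgl : g t = l
  · have h1 : Tendsto q (fullFilter t) (𝓝 l) := by
      have h2 : fullFilter t = fullFilter t ⊓ 𝓟 {p | t ≤ v p} ⊔ fullFilter t ⊓ 𝓟 {p | v p < t} := by
        rw [← inf_sup_left, sup_principal]
        have : {p | t ≤ v p} ∪ {p | v p < t} = univ := by
          ext p; simp [le_or_gt]
        rw [this, principal_univ, inf_top_eq]
      rw [h2]
      exact (hgl ▸ hR).sup hL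
    rw [hgl]
    exact ⟨h1.mono_left inf_le_left, h1.mono_left inf_le_left⟩
  apply key
  -- The sum at `lam n t` is within `d/4` of `g t`, and just before `lam n t` it is within `d/4` of
  -- `l`. If `lam n t ≠ t'_n`, the term in between is below `d/2`, which would give `d < d`.
  set d := |g t - l| with hd
  have hd0 : 0 < d := abs_pos.2 (sub_ne_zero.2 hgl)
  have e1 := eventually_inf_principal.1 (Metric.tendsto_nhds.1 hR (d / 4) (by positivity))
  have e2 := eventually_inf_principal.1 (Metric.tendsto_nhds.1 hL (d / 4) (by positivity))
  obtain ⟨N, η, hη, hall⟩ := eventually_fullFilter.1 ((e1.and e2).and (hc (d / 2) (half_pos hd0)))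
  filter_upwards [eventually_ge_atTop N, Metric.tendstoUniformly_iff.1 hlam η hη] with n hn hn'
  have hσ : dist (lam n t) t < η := by rw [dist_comm]; exact hn' t
  have hσ0 : 0 < lam n t := by
    have := (lam n).strictMono h0
    exact lt_of_le_of_lt zero_le this
  have := nhdsLT_neBot_of_pos hσ0
  obtain ⟨s, hs1, hs2, hs3⟩ := ((stepSum_eventually_left (P := P) (n := n) (c n) (lam n t)).and
    ((eventually_mem_set.2 (mem_nhdsWithin_of_mem_nhds (Metric.isOpen_ball.mem_nhds hσ))).and
      (eventually_mem_set.2 self_mem_nhdsWithin))).exists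
  obtain ⟨⟨a1, -⟩, a2⟩ := hall n hn (lam n t) hσ
  obtain ⟨⟨-, b1⟩, -⟩ := hall n hn s hs2
  have a1 := a1 (by simp [hv])
  have b1 := b1 (by simpa [hv] using (lam n).symm_apply_lt.2 hs3)
  have hdiff := stepSum_sub_left (P := P) (n := n) (c n) (lam n t)
  rw [← hs1] at hdiff
  by_contra hne
  have hsmall : |∑ i ∈ Finset.range (P.k n), if P.pt n i = lam n t then c n i else 0| < d / 2 := by
    by_cases hex : ∃ j < P.k n, P.pt n j = lam n t
    · obtain ⟨j, hj, hj'⟩ := hex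
      rw [← hj', sum_pt_eq _ hj]
      exact a2 j hj hj' hne
    · rw [Finset.sum_eq_zero]
      · simpa using hd0
      · intro i hi
        rw [if_neg]
        exact fun h => hex ⟨i, Finset.mem_range.1 hi, h⟩
  rw [← hdiff] at hsmall
  simp only [hq, Real.dist_eq] at a1 b1
  rw [abs_lt] at a1 b1 hsmall
  have : d < d := by
    nth_rewrite 1 [hd]
    rw [abs_lt]
    constructor <;> linarith
  exact lt_irrefl _ this

end Skorokhod

/-! ### Increments of càdlàg paths along partitions -/

section Increments

variable {m : ℕ} (P : PartitionSeq)

/-- The increment `x(t_{i+1}) - x(t_i)`. -/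
def PartitionSeq.incr (n : ℕ) (x : Traj m) (i : ℕ) : Vec m := x (P.pt n (i + 1)) - x (P.pt n i)

theorem IsCadlag.tendsto_leftLim {V : Type*} [TopologicalSpace V] [T2Space V] {x : ℝ≥0 → V}
    (hx : IsCadlag x) (t : ℝ≥0) : Tendsto x (𝓝[<] t) (𝓝 (Function.leftLim x t)) := by
  obtain ⟨l, hl⟩ := (hx t).2
  rcases eq_or_lt_of_le (zero_le : (0 : ℝ≥0) ≤ t) with h0 | h0
  · subst h0
    have : (𝓝[<] (0 : ℝ≥0)) = ⊥ := by simp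
    rw [this]; exact tendsto_bot
  · have := nhdsLT_neBot_of_pos h0
    rwa [leftLim_eq_of_tendsto hl]

theorem tendsto_fst_full (t : ℝ≥0) : Tendsto (fun p : ℕ × ℝ≥0 => p.1) (fullFilter t) atTop :=
  tendsto_fst

theorem tendsto_snd_full (t : ℝ≥0) : Tendsto (fun p : ℕ × ℝ≥0 => p.2) (fullFilter t) (𝓝 t) :=
  tendsto_snd

theorem eventually_nhds_of_sides {p : ℝ≥0 → Prop} {t : ℝ≥0} (h1 : ∀ᶠ s in 𝓝[<] t, p s)
    (h2 : ∀ᶠ s in 𝓝[≥] t, p s) : ∀ᶠ s in 𝓝 t, p s := by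
  rw [← nhdsLT_sup_nhdsGE]
  exact eventually_sup.2 ⟨h1, h2⟩

/-- Only the partition interval starting at `t'_n` can straddle `t`. For every other one both
endpoints lie on the same side of `t`, where `x` is close to its one-sided limit. -/
theorem incr_small {x : Traj m} (hx : IsCadlag x) (t : ℝ≥0) {ε : ℝ} (hε : 0 < ε) :
    ∀ᶠ p in fullFilter t, ∀ i < P.k p.1, P.pt p.1 i = p.2 → p.2 ≠ P.prev p.1 t →
      ‖P.incr p.1 x i‖ < ε := by
  have hl := Metric.tendsto_nhds.1 (hx.tendsto_leftLim t) (ε / 2) (half_pos hε)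
  have hr := Metric.tendsto_nhds.1 (hx t).1.tendsto (ε / 2) (half_pos hε)
  rw [eventually_nhdsWithin_iff] at hl hr
  filter_upwards [P.eventually_next hl, P.eventually_next hr,
    (tendsto_snd_full t).eventually hl, (tendsto_snd_full t).eventually hr]
    with p h1 h2 h3 h4 i hi hpi hne
  rw [PartitionSeq.incr, ← dist_eq_norm, hpi]
  rcases lt_or_gt_of_ne hne with h | h
  · have h5 : P.pt p.1 (i + 1) ≤ P.prev p.1 t := P.next_le_prev hi (hpi ▸ h)
    have h6 : 0 < t := by
      by_contra! h0
      rw [nonpos_iff_eq_zero.1 h0, P.prev_zero] at h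
      exact absurd h (not_lt.mpr zero_le)
    have h7 := P.prev_lt (n := p.1) h6
    have h8 := h1 i hi hpi (h5.trans_lt h7)
    have h9 := h3 (h.trans h7)
    calc _ ≤ _ := dist_triangle_right _ _ (Function.leftLim x t)
      _ < ε := by linarith
  · have h5 : t ≤ P.pt p.1 i := P.le_of_prev_lt hi.le (hpi ▸ h)
    have h6 : P.pt p.1 i ≤ P.pt p.1 (i + 1) := P.pt_le_pt _ (Nat.le_succ _) hi
    have h8 := h2 i hi hpi (h5.trans h6)
    have h9 := h4 (show t ≤ p.2 from hpi ▸ h5)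
    calc _ ≤ _ := dist_triangle_right _ _ (x t)
      _ < ε := by linarith

theorem incr_bdd {x : Traj m} (hx : IsCadlag x) (t : ℝ≥0) :
    ∃ r > (0 : ℝ), ∀ᶠ p in fullFilter t, ∀ i < P.k p.1, P.pt p.1 i = p.2 →
      ‖P.incr p.1 x i‖ ≤ r := by
  have hb : ∀ᶠ s in 𝓝 t, ‖x s‖ ≤ ‖Function.leftLim x t‖ + ‖x t‖ + 1 := by
    refine eventually_nhds_of_sides ?_ ?_
    · filter_upwards [(hx.tendsto_leftLim t).norm.eventually
        (gt_mem_nhds (lt_add_one _))] with s hs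
      have := norm_nonneg (x t)
      linarith
    · filter_upwards [(hx t).1.tendsto.norm.eventually (gt_mem_nhds (lt_add_one _))] with s hs
      have := norm_nonneg (Function.leftLim x t)
      linarith
  refine ⟨2 * (‖Function.leftLim x t‖ + ‖x t‖ + 1), by positivity, ?_⟩
  filter_upwards [P.eventually_next hb, (tendsto_snd_full t).eventually hb] with p h1 h2 i hi hpi
  have h3 : ‖x (P.pt p.1 (i + 1))‖ ≤ _ := h1 i hi hpi
  rw [PartitionSeq.incr, hpi]
  refine (norm_sub_le _ _).trans ?_
  linarith

open Classical in
/-- The index of the partition point `t'_n`. -/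
def PartitionSeq.prevIdx (n : ℕ) (t : ℝ≥0) : ℕ :=
  if h : ∃ i < P.k n, P.pt n i = P.prev n t ∧ P.pt n i < t ∧ t ≤ P.pt n (i + 1) then h.choose else 0

theorem PartitionSeq.prevIdx_spec {n : ℕ} {t : ℝ≥0} (ht : 0 < t) (hl : t ≤ P.pt n (P.k n)) :
    P.prevIdx n t < P.k n ∧ P.pt n (P.prevIdx n t) = P.prev n t ∧ P.pt n (P.prevIdx n t) < t ∧
      t ≤ P.pt n (P.prevIdx n t + 1) := by
  have h := P.exists_prev_next ht hl
  rw [PartitionSeq.prevIdx, dif_pos h]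
  exact h.choose_spec

theorem PartitionSeq.eventually_prevIdx {t : ℝ≥0} (ht : 0 < t) :
    ∀ᶠ n in atTop, 0 < P.prev n t ∧ P.prevIdx n t < P.k n ∧ P.pt n (P.prevIdx n t) = P.prev n t ∧
      P.pt n (P.prevIdx n t) < t ∧ t ≤ P.pt n (P.prevIdx n t + 1) := by
  filter_upwards [P.eventually_lt_last t, (P.tendsto_prev t).eventually (lt_mem_nhds ht)]
    with n h1 h2
  exact ⟨h2, P.prevIdx_spec ht h1.le⟩

theorem PartitionSeq.tendsto_next {t : ℝ≥0} (ht : 0 < t) :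
    Tendsto (fun n => P.pt n (P.prevIdx n t + 1)) atTop (𝓝[≥] t) := by
  rw [tendsto_nhdsWithin_iff]
  refine ⟨fun V hV => ?_, (P.eventually_prevIdx ht).mono fun n hn => hn.2.2.2.2⟩
  have h1 := (tendsto_fullFilter tendsto_id (P.tendsto_prev t)).eventually (P.eventually_next hV)
  show ∀ᶠ n in atTop, _ ∈ V
  filter_upwards [h1, P.eventually_prevIdx ht] with n h2 h3
  exact h2 _ h3.2.1 h3.2.2.1

theorem PartitionSeq.tendsto_prev_lt {t : ℝ≥0} (ht : 0 < t) :
    Tendsto (fun n => P.prev n t) atTop (𝓝[<] t) :=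
  tendsto_nhdsWithin_iff.2 ⟨P.tendsto_prev t, Eventually.of_forall fun _ => P.prev_lt ht⟩

/-- The partition interval starting at `t'_n` has its left end below `t` and its right end at or
above `t`, and both ends tend to `t`. -/
theorem tendsto_incr_prev {x : Traj m} (hx : IsCadlag x) {t : ℝ≥0} (ht : 0 < t) :
    Tendsto (fun n => P.incr n x (P.prevIdx n t)) atTop (𝓝 (jump x t)) := by
  have h1 : Tendsto (fun n => x (P.pt n (P.prevIdx n t + 1))) atTop (𝓝 (x t)) :=
    (hx t).1.tendsto.comp (P.tendsto_next ht)
  have h2 := (hx.tendsto_leftLim t).comp (P.tendsto_prev_lt ht)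
  refine (h1.sub h2).congr' ?_
  filter_upwards [P.eventually_prevIdx ht] with n hn
  simp [PartitionSeq.incr, hn.2.2.1]

theorem tendsto_incr_zero {x : Traj m} (hx : IsCadlag x) :
    Tendsto (fun n => P.incr n x 0) atTop (𝓝 0) := by
  have h1 : Tendsto (fun n => x (P.pt n (0 + 1))) atTop (𝓝 (x 0)) := by
    have h2 : ContinuousAt x 0 := by
      have := (hx 0).1
      rwa [show Ici (0 : ℝ≥0) = univ from Ici_bot, continuousWithinAt_univ] at this
    refine h2.tendsto.comp fun V hV => ?_
    have h3 := (tendsto_fullFilter (tendsto_id (α := ℕ))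
      (tendsto_const_nhds (x := (0 : ℝ≥0)))).eventually (P.eventually_next hV)
    show ∀ᶠ n in atTop, _ ∈ V
    filter_upwards [h3, P.eventually_lt_last 0] with n h4 h5
    refine h4 0 ?_ (P.pt_zero n)
    by_contra h0
    have : P.k n = 0 := by simp only [id] at h0; omega
    rw [this, P.pt_zero] at h5
    exact lt_irrefl _ h5
  have := h1.sub_const (x 0)
  rw [sub_self] at this
  exact this.congr fun n => by rw [PartitionSeq.incr, P.pt_zero]

end Increments

variable {m : ℕ}

/-! ### Stopped and perturbed paths -/

theorem leftLim_congr {V : Type*} [TopologicalSpace V] {f g : ℝ≥0 → V} {t : ℝ≥0}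
    (h : ∀ s < t, f s = g s) (ht : f t = g t) : Function.leftLim f t = Function.leftLim g t := by
  -- `Function.leftLim` is defined through the order topology of the domain, so the filter is
  -- spelled out with that instance.
  have h' : f =ᶠ[@nhdsWithin ℝ≥0 (Preorder.topology ℝ≥0) t (Iio t)] g :=
    @eventually_nhdsWithin_of_forall _ (Preorder.topology ℝ≥0) _ _ _ h
  unfold Function.leftLim
  rw [ht]
  simp only [limUnder, map_congr h']
  congr 1
  simp only [tendsto_congr' h']

theorem stopAt_stopAt (x : Traj m) {s t : ℝ≥0} (h : t ≤ s) :
    stopAt (stopAt x s) t = stopAt x t := by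
  funext u
  simp only [stopAt]
  rw [min_assoc, min_eq_left h]

theorem leftLim_stopAt (x : Traj m) {s t : ℝ≥0} (h : t ≤ s) :
    Function.leftLim (stopAt x s) t = Function.leftLim x t :=
  leftLim_congr (fun u hu => by rw [stopAt, min_eq_left (hu.le.trans h)])
    (by rw [stopAt, min_eq_left h])

theorem stopLeft_stopAt (x : Traj m) {s t : ℝ≥0} (h : t ≤ s) :
    stopLeft (stopAt x s) t = stopLeft x t := by
  funext u
  simp only [stopLeft, leftLim_stopAt x h]
  split_ifs with hu
  · rw [stopAt, min_eq_left (hu.le.trans h)]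
  · rfl

theorem leftLim_stopLeft (x : Traj m) (t : ℝ≥0) :
    Function.leftLim (stopLeft x t) t = Function.leftLim x t := by
  have h' : stopLeft x t =ᶠ[@nhdsWithin ℝ≥0 (Preorder.topology ℝ≥0) t (Iio t)] x :=
    @eventually_nhdsWithin_of_forall _ (Preorder.topology ℝ≥0) _ _ _ fun s hs => if_pos hs
  have h2 : stopLeft x t t = Function.leftLim x t := if_neg (lt_irrefl t)
  -- No regularity of `x` is assumed. If the left limit does not exist, `leftLim` defaults to the
  -- value at `t`, which for `stopLeft x t` is `leftLim x t` by definition.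
  by_cases h : @nhdsWithin ℝ≥0 (Preorder.topology ℝ≥0) t (Iio t) = ⊥ ∨
      ¬∃ y, Tendsto x (@nhdsWithin ℝ≥0 (Preorder.topology ℝ≥0) t (Iio t)) (𝓝 y)
  · rw [← h2]
    conv_lhs => rw [Function.leftLim]
    rw [if_pos]
    simpa only [tendsto_congr' h'] using h
  · unfold Function.leftLim
    rw [if_neg h, if_neg]
    · simp only [limUnder, map_congr h']
    · simpa only [tendsto_congr' h'] using h

theorem stopLeft_stopLeft (x : Traj m) (t : ℝ≥0) :
    stopLeft (stopLeft x t) t = stopLeft x t := by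
  funext u
  conv_lhs => rw [stopLeft, leftLim_stopLeft]
  simp only [stopLeft]
  split_ifs <;> rfl

theorem stopAt_stopLeft (x : Traj m) (t : ℝ≥0) : stopAt (stopLeft x t) t = stopLeft x t := by
  funext u
  simp only [stopAt, stopLeft]
  rcases lt_or_ge u t with h | h
  · rw [min_eq_left h.le]
  · rw [min_eq_right h, if_neg (lt_irrefl t), if_neg (not_lt.mpr h)]

theorem stopLeft_zero (x : Traj m) : stopLeft x 0 = stopAt x 0 := by
  funext u
  simp only [stopAt, stopLeft]
  rw [if_neg (not_lt.mpr zero_le), min_eq_right zero_le]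
  exact leftLim_eq_of_isBot fun _ => zero_le

theorem bump_zero (x : Traj m) (t : ℝ≥0) : bump x t 0 = x := by
  funext u; simp [bump]

theorem bump_bump (x : Traj m) (t : ℝ≥0) (e e' : Vec m) :
    bump (bump x t e) t e' = bump x t (e + e') := by
  funext u
  simp only [bump]
  split_ifs
  · rw [add_assoc]
  · simp

theorem stopAt_bump (x : Traj m) (t : ℝ≥0) (e : Vec m) :
    stopAt (bump x t e) t = bump (stopAt x t) t e := by
  funext u
  simp only [bump, stopAt, le_min_iff, le_refl, and_true]

theorem bump_neg_jump (x : Traj m) (t : ℝ≥0) :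
    bump (stopAt x t) t (-jump x t) = stopLeft x t := by
  funext u
  simp only [bump, stopAt, stopLeft, jump]
  rcases lt_or_ge u t with h | h
  · rw [min_eq_left h.le, if_neg (not_le.mpr h), if_pos h, add_zero]
  · rw [min_eq_right h, if_pos h, if_neg (not_lt.mpr h)]; abel

theorem bump_jump (x : Traj m) (t : ℝ≥0) : bump (stopLeft x t) t (jump x t) = stopAt x t := by
  rw [← bump_neg_jump, bump_bump, neg_add_cancel, bump_zero]

/-! ### Membership in generic sets -/

section Generic

variable {P : PartitionSeq} {Ω : Set (Traj m)} (hΩ : IsGeneric P Ω)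
include hΩ

theorem IsGeneric.stopAt_mem {x : Traj m} (hx : x ∈ Ω) (t : ℝ≥0) : stopAt x t ∈ Ω := by
  obtain ⟨U, hU, -, -, h⟩ := hΩ.bump_mem x hx t
  simpa [bump_zero] using h 0 (mem_of_mem_nhds hU)

/-- Perturbing `x_t` by `-Δx(t)` at time `t` removes the jump and leaves `x_{t-}`. -/
theorem IsGeneric.stopLeft_mem {x : Traj m} (hx : x ∈ Ω) (t : ℝ≥0) : stopLeft x t ∈ Ω := by
  obtain ⟨U, -, -, hj, h⟩ := hΩ.bump_mem x hx t
  simpa [bump_neg_jump] using h _ hj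

theorem IsGeneric.eventually_approx {x : Traj m} (hx : x ∈ Ω) (T : ℝ≥0) :
    ∀ᶠ n in atTop, T + 1 < P.pt n (P.k n) ∧ stopAt (P.approx n x) (T + 1) ∈ Ω := by
  obtain ⟨N, hN⟩ := hΩ.approx_mem x hx (T + 1) (by positivity)
  filter_upwards [P.eventually_lt_last (T + 1), eventually_ge_atTop N] with n h1 h2
  exact ⟨h1, hN n h2⟩

end Generic

theorem mem_domain {Ω : Set (Traj m)} {x : Traj m} (hx : x ∈ Ω) {t : ℝ≥0}
    (h : stopAt x t = x) : (t, x) ∈ domain Ω := ⟨x, hx, h.symm⟩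

theorem stopAt_mem_domain {Ω : Set (Traj m)} {x : Traj m} (hx : x ∈ Ω) (t : ℝ≥0) :
    (t, stopAt x t) ∈ domain Ω := ⟨x, hx, rfl⟩

section GenericDomain

variable {P : PartitionSeq} {Ω : Set (Traj m)} (hΩ : IsGeneric P Ω)
include hΩ

theorem IsGeneric.stopLeft_mem_domain {x : Traj m} (hx : x ∈ Ω) (t : ℝ≥0) :
    (t, stopLeft x t) ∈ domain Ω :=
  mem_domain (hΩ.stopLeft_mem hx t) (stopAt_stopLeft x t)

theorem IsGeneric.eventually_approx_domain {x : Traj m} (hx : x ∈ Ω) (T : ℝ≥0) :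
    ∀ᶠ n in atTop, ∀ t ≤ T, (t, stopAt (P.approx n x) t) ∈ domain Ω ∧
      (t, stopLeft (P.approx n x) t) ∈ domain Ω := by
  filter_upwards [hΩ.eventually_approx hx T] with n hn t ht
  have ht' : t ≤ T + 1 := ht.trans (by simp)
  have h1 := stopAt_mem_domain hn.2 t
  have h2 := hΩ.stopLeft_mem_domain hn.2 t
  rw [stopAt_stopAt _ ht'] at h1
  rw [stopLeft_stopAt _ ht'] at h2
  exact ⟨h1, h2⟩

end GenericDomain

/-! ### The step approximations of a path -/

section Approx

variable (P : PartitionSeq) {n : ℕ}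

theorem PartitionSeq.exists_index {u : ℝ≥0} (hu : u < P.pt n (P.k n)) :
    ∃ i < P.k n, P.pt n i ≤ u ∧ u < P.pt n (i + 1) := by
  by_contra! hcon
  have : ∀ i ≤ P.k n, P.pt n i ≤ u := by
    intro i
    induction i with
    | zero => intro _; rw [P.pt_zero]; exact zero_le
    | succ i ih => intro hi; exact hcon i hi (ih (by omega))
  exact absurd hu (not_lt.mpr (this _ le_rfl))

theorem PartitionSeq.pt_le_iff_of_mem {u : ℝ≥0} {i j : ℕ} (hi : i < P.k n) (hj : j ≤ P.k n)
    (h1 : P.pt n i ≤ u) (h2 : u < P.pt n (i + 1)) : P.pt n j ≤ u ↔ j ≤ i := by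
  constructor
  · intro h
    have := (P.pt_lt_iff n hj hi).1 (h.trans_lt h2)
    omega
  · exact fun h => (P.pt_le_pt n h hi.le).trans h1

theorem approx_eq (x : Traj m) {u : ℝ≥0} {i : ℕ} (hi : i < P.k n) (h1 : P.pt n i ≤ u)
    (h2 : u < P.pt n (i + 1)) : P.approx n x u = x (P.pt n (i + 1)) := by
  rw [PartitionSeq.approx, Finset.sum_eq_single_of_mem i (Finset.mem_range.2 hi), if_pos ⟨h1, h2⟩]
  intro j hj hji
  rw [if_neg]
  rintro ⟨h3, h4⟩
  have hj := Finset.mem_range.1 hj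
  have h5 := (P.pt_le_iff_of_mem hi hj.le h1 h2).1 h3
  have h6 := (P.pt_le_iff_of_mem hj hi.le h3 h4).1 h1
  omega

theorem approx_pt (x : Traj m) {i : ℕ} (hi : i < P.k n) :
    P.approx n x (P.pt n i) = x (P.pt n (i + 1)) :=
  approx_eq P x hi le_rfl (P.pt_lt_pt n (Nat.lt_succ_self i) hi)

theorem leftLim_approx (x : Traj m) {i : ℕ} (hi : i < P.k n) :
    Function.leftLim (P.approx n x) (P.pt n (i + 1)) = x (P.pt n (i + 1)) := by
  have h := P.pt_lt_pt n (Nat.lt_succ_self i) hi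
  have := nhdsLT_neBot_of_exists_lt ⟨_, h⟩
  refine leftLim_eq_of_tendsto (tendsto_const_nhds.congr' ?_)
  filter_upwards [Ico_mem_nhdsLT h] with u hu
  exact (approx_eq P x hi hu.1 hu.2).symm

/-- At `t_0 = 0` the convention `x(0-) = x(0)` gives `x^n` no jump. This is why the zeroth term is
dropped from the sums below. -/
theorem jump_approx (x : Traj m) {i : ℕ} (hi : i < P.k n) (hi0 : i ≠ 0) :
    jump (P.approx n x) (P.pt n i) = P.incr n x i := by
  obtain ⟨j, rfl⟩ := Nat.exists_eq_succ_of_ne_zero hi0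
  rw [jump, approx_pt P x hi, leftLim_approx P x (Nat.lt_of_succ_lt hi)]
  rfl

theorem stepSum_eq_range {E : Type*} [AddCommGroup E] (c : ℕ → E) {u : ℝ≥0} {i : ℕ}
    (hi : i < P.k n) (h1 : P.pt n i ≤ u) (h2 : u < P.pt n (i + 1)) :
    P.stepSum n c u = ∑ j ∈ Finset.range (i + 1), c j := by
  rw [PartitionSeq.stepSum, ← Finset.sum_filter]
  congr 1
  ext j
  simp only [Finset.mem_filter, Finset.mem_range]
  constructor
  · rintro ⟨h3, h4⟩
    have := (P.pt_le_iff_of_mem hi h3.le h1 h2).1 h4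
    omega
  · intro h3
    exact ⟨by omega, (P.pt_le_iff_of_mem hi (by omega) h1 h2).2 (by omega)⟩

/-- A sequence with its zeroth term removed. -/
def dropZero {E : Type*} [Zero E] (c : ℕ → E) (i : ℕ) : E := if i = 0 then 0 else c i

theorem stepSum_dropZero {E : Type*} [AddCommGroup E] (c : ℕ → E) (s : ℝ≥0) (hk : 0 < P.k n) :
    P.stepSum n c s = P.stepSum n (dropZero c) s + c 0 := by
  rw [← sub_eq_iff_eq_add', PartitionSeq.stepSum, PartitionSeq.stepSum, ← Finset.sum_sub_distrib,
    Finset.sum_eq_single_of_mem 0 (Finset.mem_range.2 hk)]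
  · simp [P.pt_zero, dropZero]
  · intro i _ hi0
    simp [dropZero, hi0]

theorem stepSum_dropZero_zero {P : PartitionSeq} {n : ℕ} {E : Type*} [AddCommGroup E]
    (c : ℕ → E) :
    P.stepSum n (dropZero c) 0 = 0 := by
  refine Finset.sum_eq_zero fun i hi => ?_
  rcases eq_or_ne i 0 with rfl | hi0
  · simp [dropZero]
  · rw [if_neg]
    have := P.pt_lt_pt n (Nat.pos_of_ne_zero hi0) (Finset.mem_range.1 hi).le
    rw [P.pt_zero] at this
    exact not_le.mpr this

theorem approx_eq_stepSum (x : Traj m) {u : ℝ≥0} (hu : u < P.pt n (P.k n)) :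
    P.approx n x u = x (P.pt n 1) + P.stepSum n (dropZero (P.incr n x)) u := by
  obtain ⟨i, hi, h1, h2⟩ := P.exists_index hu
  rw [approx_eq P x hi h1 h2, stepSum_eq_range P _ hi h1 h2, Finset.sum_range_succ']
  have : ∑ j ∈ Finset.range i, dropZero (P.incr n x) (j + 1) =
      ∑ j ∈ Finset.range i, (x (P.pt n (j + 1 + 1)) - x (P.pt n (j + 1))) := rfl
  rw [this, Finset.sum_range_sub (fun j => x (P.pt n (j + 1)))]
  simp [dropZero]

/-- The path `x^n_{t_i-}` only sees the values of `x` at `t_1, …, t_i`. The exception is `i = 0`,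
where `x^n_{0-} = x^n_0` takes the value `x(t_1)`. -/
theorem stopLeft_approx_congr {x y : Traj m} {i : ℕ} (hi : i < P.k n)
    (h : ∀ j ≤ i + 1, 0 < j → (j ≤ i ∨ i = 0) → y (P.pt n j) = x (P.pt n j)) :
    stopLeft (P.approx n y) (P.pt n i) = stopLeft (P.approx n x) (P.pt n i) := by
  rcases Nat.eq_zero_or_pos i with rfl | h0
  · rw [P.pt_zero, stopLeft_zero, stopLeft_zero]
    funext u
    have h1 := approx_pt P x hi
    have h2 := approx_pt P y hi
    rw [P.pt_zero] at h1 h2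
    rw [stopAt, stopAt, min_eq_right zero_le, h1, h2]
    exact h 1 le_rfl one_pos (Or.inr rfl)
  · obtain ⟨l, rfl⟩ := Nat.exists_eq_succ_of_ne_zero h0.ne'
    have hl : l < P.k n := Nat.lt_of_succ_lt hi
    funext u
    simp only [stopLeft]
    split_ifs with hu
    · obtain ⟨j, hj, h1, h2⟩ := P.exists_index (hu.trans (P.pt_lt_pt n hi le_rfl))
      rw [approx_eq P x hj h1 h2, approx_eq P y hj h1 h2]
      have := (P.pt_lt_iff n hj.le hi.le).1 (h1.trans_lt hu)
      exact h _ (by omega) (by omega) (Or.inl (by omega))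
    · have h1 := leftLim_approx P x hl
      have h2 := leftLim_approx P y hl
      rw [Nat.succ_eq_add_one, h1, h2]
      exact h _ (by omega) (by omega) (Or.inl le_rfl)

end Approx

/-! ### Continuity in the `π`-topology and one-sided continuity -/

/-- In an initial topology convergence is tested on the generators. Any mode of convergence
respected by all functionals that are both left- and right-continuous, in particular each clause of
the two definitions, is therefore respected by `F`. -/
theorem PiContinuous.tendsto {P : PartitionSeq} {Ω : Set (Traj m)} {F : Functional m ℝ}
    (hF : PiContinuous P Ω F) {α : Type*} {l : Filter α} {f : α → ℝ≥0} {y : α → Traj m}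
    {z : ℝ≥0 × Traj m} (hz : z ∈ domain Ω) (hmem : ∀ᶠ a in l, (f a, y a) ∈ domain Ω)
    (h : ∀ G : Functional m ℝ, LeftCont P Ω G → RightCont P Ω G →
      Tendsto (fun a => G (f a) (y a)) l (𝓝 (G z.1 z.2))) :
    Tendsto (fun a => F (f a) (y a)) l (𝓝 (F z.1 z.2)) := by
  classical
  -- The fallback value `z` only makes `g` total; points outside the domain are eventually absent.
  let g : α → domain Ω := fun a => if h : (f a, y a) ∈ domain Ω then ⟨_, h⟩ else ⟨z, hz⟩
  have hg : ∀ᶠ a in l, (g a).1 = (f a, y a) := by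
    filter_upwards [hmem] with a ha
    simp only [g, dif_pos ha]
  have hlim : Tendsto g l (@nhds _ (piTopology P Ω) ⟨z, hz⟩) := by
    rw [piTopology]
    simp only [nhds_iInf, tendsto_iInf]
    intro G hG
    rw [nhds_induced, tendsto_comap_iff]
    refine (h G hG.1 hG.2).congr' ?_
    filter_upwards [hg] with a ha
    simp [ha]
  have h1 := (@Continuous.tendsto _ _ (piTopology P Ω) _ _ hF ⟨z, hz⟩).comp hlim
  refine h1.congr' ?_
  filter_upwards [hg] with a ha
  simp [ha]

theorem LeftCont.piContinuous {P : PartitionSeq} {Ω : Set (Traj m)} {F : Functional m ℝ}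
    (hl : LeftCont P Ω F) (hr : RightCont P Ω F) : PiContinuous P Ω F := by
  have h : piTopology P Ω ≤
      TopologicalSpace.induced (fun z : domain Ω => F z.1.1 z.1.2) inferInstance :=
    iInf₂_le F ⟨hl, hr⟩
  exact continuous_iff_le_induced.2 h

section

variable {P : PartitionSeq} {Ω : Set (Traj m)} (hΩ : IsGeneric P Ω)
include hΩ

theorem IsGeneric.eventually_approx_domain_seq {x : Traj m} (hx : x ∈ Ω) {t : ℝ≥0} {u : ℕ → ℝ≥0}
    (hu : Tendsto u atTop (𝓝 t)) :
    ∀ᶠ n in atTop, (u n, stopAt (P.approx n x) (u n)) ∈ domain Ω ∧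
      (u n, stopLeft (P.approx n x) (u n)) ∈ domain Ω := by
  filter_upwards [hΩ.eventually_approx_domain hx (t + 1),
    hu.eventually (gt_mem_nhds (show t < t + 1 by simp))] with n h1 h2
  exact h1 _ h2.le

theorem PiContinuous.leftCont {F : Functional m ℝ} (hF : PiContinuous P Ω F) :
    LeftCont P Ω F where
  a x hx t := hF.tendsto (hΩ.stopLeft_mem_domain hx t)
    (Eventually.of_forall fun s => hΩ.stopLeft_mem_domain hx s) fun _ h _ => h.a x hx t
  b x hx t := hF.tendsto (hΩ.stopLeft_mem_domain hx t)
    (Eventually.of_forall fun s => stopAt_mem_domain hx s) fun _ h _ => h.b x hx t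
  c x hx t u hu h' := hF.tendsto (hΩ.stopLeft_mem_domain hx t)
    ((hΩ.eventually_approx_domain_seq hx hu).mono fun _ h => h.2) fun _ h _ => h.c x hx t u hu h'
  d x hx t u hu h' := hF.tendsto (hΩ.stopLeft_mem_domain hx t)
    ((hΩ.eventually_approx_domain_seq hx hu).mono fun _ h => h.1) fun _ h _ => h.d x hx t u hu h'

theorem PiContinuous.rightCont {F : Functional m ℝ} (hF : PiContinuous P Ω F) :
    RightCont P Ω F where
  a x hx t := hF.tendsto (stopAt_mem_domain hx t)
    (Eventually.of_forall fun s => stopAt_mem_domain hx s) fun _ _ h => h.a x hx t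
  b x hx t := hF.tendsto (stopAt_mem_domain hx t)
    (Eventually.of_forall fun s => hΩ.stopLeft_mem_domain hx s) fun _ _ h => h.b x hx t
  c x hx t u hu h' := hF.tendsto (stopAt_mem_domain hx t)
    ((hΩ.eventually_approx_domain_seq hx hu).mono fun _ h => h.1) fun _ _ h => h.c x hx t u hu h'
  d x hx t u hu h' := hF.tendsto (stopAt_mem_domain hx t)
    ((hΩ.eventually_approx_domain_seq hx hu).mono fun _ h => h.2) fun _ _ h => h.d x hx t u hu h'

end

/-- One-sided continuity is tested on sequences `u` with one time per partition index, constrained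
for every `n`. A general sequence of pairs is thinned until its indices increase strictly, and the
missing indices are filled in with the admissible sequence `d`. -/
theorem tendsto_fullFilter_inf_of_seq {E : ℕ → Set ℝ≥0} {t : ℝ≥0} {d : ℕ → ℝ≥0}
    (hd : ∀ n, d n ∈ E n) (hdt : Tendsto d atTop (𝓝 t)) {β : Type*} {f : ℕ → ℝ≥0 → β}
    {l : Filter β}
    (h : ∀ u : ℕ → ℝ≥0, Tendsto u atTop (𝓝 t) → (∀ n, u n ∈ E n) →
      Tendsto (fun n => f n (u n)) atTop l) :
    Tendsto (fun p : ℕ × ℝ≥0 => f p.1 p.2) (fullFilter t ⊓ 𝓟 {p | p.2 ∈ E p.1}) l := by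
  classical
  refine tendsto_of_seq_tendsto fun p hp => ?_
  refine tendsto_of_subseq_tendsto fun ns hns => ?_
  have hp1 : Tendsto (fun k => (p (ns k)).1) atTop atTop :=
    (tendsto_fst_full t).comp ((hp.mono_right inf_le_left).comp hns)
  have hp2 : Tendsto (fun k => (p (ns k)).2) atTop (𝓝 t) :=
    (tendsto_snd_full t).comp ((hp.mono_right inf_le_left).comp hns)
  have hpE : ∀ᶠ k in atTop, (p (ns k)).2 ∈ E (p (ns k)).1 :=
    (hp.comp hns).eventually (eventually_inf_principal.2 (Eventually.of_forall fun _ h => h))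
  obtain ⟨φ, hφ, hφ'⟩ := strictMono_subseq_of_tendsto_atTop hp1
  let a : ℕ → ℕ := fun k => (p (ns (φ k))).1
  have ha : StrictMono a := hφ'
  let u : ℕ → ℝ≥0 := fun n =>
    if hn : ∃ k, a k = n ∧ (p (ns (φ k))).2 ∈ E n then (p (ns (φ hn.choose))).2 else d n
  have hua : ∀ᶠ k in atTop, u (a k) = (p (ns (φ k))).2 := by
    filter_upwards [hφ.tendsto_atTop.eventually hpE] with k hk
    have hn : ∃ j, a j = a k ∧ (p (ns (φ j))).2 ∈ E (a k) := ⟨k, rfl, hk⟩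
    have := ha.injective hn.choose_spec.1
    simp only [u, dif_pos hn, this]
  have huE : ∀ n, u n ∈ E n := by
    intro n
    by_cases hn : ∃ k, a k = n ∧ (p (ns (φ k))).2 ∈ E n
    · simp only [u, dif_pos hn]; exact hn.choose_spec.2
    · simp only [u, dif_neg hn]; exact hd n
  have hut : Tendsto u atTop (𝓝 t) := by
    intro V hV
    show ∀ᶠ n in atTop, u n ∈ V
    obtain ⟨K, hK⟩ := eventually_atTop.1 ((hp2.comp hφ.tendsto_atTop).eventually hV)
    filter_upwards [hdt.eventually hV, eventually_ge_atTop (a K)] with n h1 h2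
    by_cases hn : ∃ k, a k = n ∧ (p (ns (φ k))).2 ∈ E n
    · simp only [u, dif_pos hn]
      exact hK _ (ha.le_iff_le.1 (hn.choose_spec.1.symm ▸ h2))
    · simp only [u, dif_neg hn]; exact h1
  refine ⟨φ, ?_⟩
  refine ((h u hut huE).comp ha.tendsto_atTop).congr' ?_
  filter_upwards [hua] with k hk
  simp only [Function.comp, hk]
  rfl

section Filters

variable {V : Type*} [TopologicalSpace V] {P : PartitionSeq} {Ω : Set (Traj m)}
  {F : Functional m V}

theorem RightCont.tendsto_stopAt (hF : RightCont P Ω F) {x : Traj m} (hx : x ∈ Ω) (t : ℝ≥0) :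
    Tendsto (fun p : ℕ × ℝ≥0 => F p.2 (stopAt (P.approx p.1 x) p.2)) (P.rightFilter t)
      (𝓝 (F t (stopAt x t))) :=
  tendsto_fullFilter_inf_of_seq (E := fun n => {s | P.prev n t ≤ s}) (d := fun n => P.prev n t)
    (f := fun n s => F s (stopAt (P.approx n x) s))
    (fun n => le_refl (P.prev n t)) (P.tendsto_prev t) (hF.c x hx t)

theorem LeftCont.tendsto_stopLeft (hF : LeftCont P Ω F) {x : Traj m} (hx : x ∈ Ω) (t : ℝ≥0) :
    Tendsto (fun p : ℕ × ℝ≥0 => F p.2 (stopLeft (P.approx p.1 x) p.2))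
      (fullFilter t ⊓ 𝓟 {p | p.2 ≤ P.prev p.1 t}) (𝓝 (F t (stopLeft x t))) :=
  tendsto_fullFilter_inf_of_seq (E := fun n => {s | s ≤ P.prev n t}) (d := fun n => P.prev n t)
    (f := fun n s => F s (stopLeft (P.approx n x) s))
    (fun n => le_refl (P.prev n t)) (P.tendsto_prev t) (hF.c x hx t)

/-- The constraint `s < t'_n` may be void for some `n`, so no filler sequence is available for
clause (d). Instead, `F(s, x^n_s)` is the limit of `F(u, x^n_{u-})` as `u ↓ s` with `u < t'_n`, and
those values lie in a closed neighbourhood by clause (c). -/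
theorem LeftCont.tendsto_stopAt [RegularSpace V] (hΩ : IsGeneric P Ω) (hl : LeftCont P Ω F)
    (hr : RightCont P Ω F) {x : Traj m} (hx : x ∈ Ω) (t : ℝ≥0) :
    Tendsto (fun p : ℕ × ℝ≥0 => F p.2 (stopAt (P.approx p.1 x) p.2)) (P.leftFilter t)
      (𝓝 (F t (stopLeft x t))) := by
  rw [(closed_nhds_basis _).tendsto_right_iff]
  rintro W ⟨hW, hWc⟩
  have h1 := eventually_inf_principal.1 ((hl.tendsto_stopLeft hx t).eventually hW)
  obtain ⟨N, η, hη, h2⟩ := eventually_fullFilter.1 h1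
  refine eventually_inf_principal.2 ?_
  filter_upwards [(tendsto_fst_full t).eventually
      ((hΩ.eventually_approx hx t).and (eventually_ge_atTop N)),
    (tendsto_snd_full t).eventually (Metric.ball_mem_nhds t hη)] with p ⟨h3, h4⟩ h5 h6
  have hpt : p.2 < t := lt_of_lt_of_le h6 (P.prev_le t)
  have hp1 : p.2 ≤ t + 1 := hpt.le.trans (by simp)
  have h7 := hr.b _ h3.2 p.2
  rw [stopAt_stopAt _ hp1] at h7
  refine hWc.mem_of_tendsto h7 ?_
  filter_upwards [mem_nhdsWithin_of_mem_nhds (Metric.isOpen_ball.mem_nhds h5),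
    Ioo_mem_nhdsGT h6] with u hu1 hu2
  rw [stopLeft_stopAt _ ((hu2.2.le.trans (P.prev_le t)).trans (by simp))]
  exact h2 p.1 h4 u hu1 hu2.2.le

end Filters

/-! ### The change of variable formula for step paths -/

/-- The function is a pointwise limit of its values on grids of step `1/(n+1)`, each taken at the
first grid point to the right of `t`. -/
theorem measurable_of_continuousWithinAt_Ici {f : ℝ≥0 → ℝ}
    (h : ∀ t, ContinuousWithinAt f (Ici t) t) : Measurable f := by
  refine measurable_of_tendsto_metrizable
    (f := fun (n : ℕ) (t : ℝ≥0) => f ((⌊((n : ℝ≥0) + 1) * t⌋₊ + 1 : ℝ≥0) / ((n : ℝ≥0) + 1))) ?_ ?_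
  · intro n
    exact (measurable_from_nat (f := fun k : ℕ => f (((k : ℝ≥0) + 1) / ((n : ℝ≥0) + 1)))).comp
      (Nat.measurable_floor.comp (measurable_const_mul _))
  · rw [tendsto_pi_nhds]
    intro t
    refine (h t).tendsto.comp (tendsto_nhdsWithin_iff.2 ⟨?_, Eventually.of_forall fun n => ?_⟩)
    · have h1 : Tendsto (fun n : ℕ => t + 1 / ((n : ℝ≥0) + 1)) atTop (𝓝 (t + 0)) :=
        tendsto_const_nhds.add tendsto_one_div_add_atTop_nhds_zero_nat
      rw [add_zero] at h1
      refine tendsto_of_tendsto_of_tendsto_of_le_of_le tendsto_const_nhds h1 (fun n => ?_)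
        (fun n => ?_)
      · show t ≤ _
        rw [le_div_iff₀ (by positivity), mul_comm]
        exact (Nat.lt_floor_add_one _).le
      · show _ / _ ≤ _
        have h2 : (t + 1 / ((n : ℝ≥0) + 1)) * ((n : ℝ≥0) + 1) = ((n : ℝ≥0) + 1) * t + 1 := by
          field_simp
        rw [div_le_iff₀ (by positivity), h2]
        gcongr
        exact Nat.floor_le zero_le
    · show t ≤ _
      rw [le_div_iff₀ (by positivity), mul_comm]
      exact (Nat.lt_floor_add_one _).le

/-- The vertical increment of `F` along `x^n` at the partition point `t_i`. -/
def vertIncr (P : PartitionSeq) (F : Functional m ℝ) (n : ℕ) (x : Traj m) (i : ℕ) : ℝ :=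
  F (P.pt n i) (stopAt (P.approx n x) (P.pt n i)) -
    F (P.pt n i) (stopLeft (P.approx n x) (P.pt n i))

/-- The integral `∫_0^s 𝒟F(u, x_u) du`. -/
def horizIntegral (F : Functional m ℝ) (x : Traj m) (s : ℝ≥0) : ℝ :=
  ∫ u in (0 : ℝ)..s, horizDeriv F u.toNNReal (stopAt x u.toNNReal)

section

variable {P : PartitionSeq} {Ω : Set (Traj m)} {F : Functional m ℝ}

theorem HorizDiff.tendsto (hD : HorizDiff Ω F) {z : ℝ≥0 × Traj m} (hz : z ∈ domain Ω) :
    Tendsto (fun h : ℝ≥0 => (F (z.1 + h) z.2 - F z.1 z.2) / (h : ℝ)) (𝓝[>] 0)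
      (𝓝 (horizDeriv F z.1 z.2)) :=
  tendsto_nhds_limUnder (hD z hz)

theorem RightCont.measurable (hF : RightCont P Ω F) {x : Traj m} (hx : x ∈ Ω) :
    Measurable fun t => F t (stopAt x t) :=
  measurable_of_continuousWithinAt_Ici fun t => hF.a x hx t

theorem RightCont.intervalIntegrable (hF : RightCont P Ω F) {x y : Traj m} (hy : y ∈ Ω) {T : ℝ≥0}
    (hxy : ∀ t ≤ T, stopAt x t = stopAt y t) {K : ℝ} (hK : ∀ t ≤ T, ‖F t (stopAt x t)‖ ≤ K)
    {a b : ℝ} (ha : a ≤ T) (hb : b ≤ T) :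
    IntervalIntegrable (fun u : ℝ => F u.toNNReal (stopAt x u.toNNReal)) MeasureTheory.volume
      a b := by
  have hmem : ∀ u ∈ uIoc a b, u.toNNReal ≤ T := fun u hu => by
    rw [Real.toNNReal_le_iff_le_coe]
    exact hu.2.trans (max_le ha hb)
  refine (intervalIntegrable_const (c := K)).mono_fun ?_ ?_
  · refine (((hF.measurable hy).comp measurable_real_toNNReal).aestronglyMeasurable).congr ?_
    refine (MeasureTheory.ae_restrict_mem measurableSet_uIoc).mono fun u hu => ?_
    simp only [Function.comp, hxy _ (hmem u hu)]
  · refine (MeasureTheory.ae_restrict_mem measurableSet_uIoc).mono fun u hu => ?_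
    exact (hK _ (hmem u hu)).trans (le_abs_self K)

theorem stopLeft_approx_of_ne {n : ℕ} (x : Traj m) {t : ℝ≥0} (ht : t < P.pt n (P.k n))
    (h : ∀ i < P.k n, i ≠ 0 → P.pt n i ≠ t) :
    stopLeft (P.approx n x) t = stopAt (P.approx n x) t := by
  rcases eq_or_lt_of_le (zero_le : (0 : ℝ≥0) ≤ t) with h0 | h0
  · rw [← h0, stopLeft_zero]
  obtain ⟨i, hi, h1, h2⟩ := P.exists_index ht
  have h3 : P.pt n i < t := by
    refine lt_of_le_of_ne h1 ?_
    rcases eq_or_ne i 0 with rfl | hi0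
    · rw [P.pt_zero]; exact h0.ne
    · exact h i hi hi0
  have := nhdsLT_neBot_of_pos h0
  have h4 : Function.leftLim (P.approx n x) t = P.approx n x t := by
    refine leftLim_eq_of_tendsto (tendsto_const_nhds.congr' ?_)
    filter_upwards [Ico_mem_nhdsLT h3] with u hu
    rw [approx_eq P x hi h1 h2, approx_eq P x hi hu.1 (hu.2.trans h2)]
  rw [← bump_jump, jump, h4, sub_self, bump_zero]

theorem sum_vertIncr_eq {n : ℕ} (x : Traj m) {t : ℝ≥0} (ht : t < P.pt n (P.k n)) :
    (∑ i ∈ Finset.range (P.k n), if P.pt n i = t then dropZero (vertIncr P F n x) i else 0) =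
      F t (stopAt (P.approx n x) t) - F t (stopLeft (P.approx n x) t) := by
  by_cases h : ∃ i < P.k n, i ≠ 0 ∧ P.pt n i = t
  · obtain ⟨i, hi, hi0, rfl⟩ := h
    rw [sum_pt_eq _ hi, dropZero, if_neg hi0, vertIncr]
  · push Not at h
    rw [stopLeft_approx_of_ne x ht h, sub_self]
    refine Finset.sum_eq_zero fun i hi => ?_
    rcases eq_or_ne i 0 with rfl | hi0
    · simp [dropZero]
    · rw [if_neg (h i (Finset.mem_range.1 hi) hi0)]

/-- Subtracting the vertical increments from `F(u, x^n_u)` cancels exactly its jumps `F(u, x^n_u) -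
F(u, x^n_{u-})`. What remains is continuous with right derivative `𝒟F`, so the fundamental theorem
of calculus for right derivatives applies. -/
theorem approx_change_of_variable (hl : LeftCont P Ω F) (hr : RightCont P Ω F)
    (hD : HorizDiff Ω F) (hDr : RightCont P Ω (horizDeriv F)) {n : ℕ} {x : Traj m} {T : ℝ≥0}
    (hT : T + 1 < P.pt n (P.k n)) (hy : stopAt (P.approx n x) (T + 1) ∈ Ω) {K : ℝ}
    (hK : ∀ t ≤ T, ‖horizDeriv F t (stopAt (P.approx n x) t)‖ ≤ K) {s : ℝ≥0} (hs : s ≤ T) :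
    F s (stopAt (P.approx n x) s) - F 0 (stopAt (P.approx n x) 0) =
      P.stepSum n (dropZero (vertIncr P F n x)) s + horizIntegral F (P.approx n x) s := by
  set y := P.approx n x with hydef
  have hTT : T < T + 1 := by simp
  set g : ℝ≥0 → ℝ := fun u => F u (stopAt y u) - P.stepSum n (dropZero (vertIncr P F n x)) u
    with hg
  have hcont : ∀ u ≤ T, ContinuousAt g u := by
    intro u hu
    have hu1 : u < T + 1 := hu.trans_lt hTT
    have hev : ∀ᶠ v in 𝓝 u, stopAt (stopAt y (T + 1)) v = stopAt y v :=
      (gt_mem_nhds hu1 : ∀ᶠ v in 𝓝 u, v < T + 1).mono fun v hv => stopAt_stopAt _ hv.le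
    rw [continuousAt_iff_continuous_left'_right']
    constructor
    · have h1 := hl.b _ hy u
      rw [stopLeft_stopAt _ hu1.le] at h1
      have h2 : Tendsto g (𝓝[<] u) (𝓝 (F u (stopLeft y u) -
          ∑ i ∈ Finset.range (P.k n), if P.pt n i < u then dropZero (vertIncr P F n x) i else 0)) := by
        refine (h1.sub_const _).congr' ?_
        filter_upwards [hev.filter_mono nhdsWithin_le_nhds,
          stepSum_eventually_left (P := P) (n := n) (dropZero (vertIncr P F n x)) u] with v h3 h4
        simp only [hg, h3, h4]
      have h3 : g u = F u (stopLeft y u) -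
          ∑ i ∈ Finset.range (P.k n), if P.pt n i < u then dropZero (vertIncr P F n x) i else 0 := by
        have h4 := stepSum_sub_left (P := P) (n := n) (dropZero (vertIncr P F n x)) u
        rw [sum_vertIncr_eq x (hu1.trans hT)] at h4
        simp only [hg]
        linarith
      rw [ContinuousWithinAt, h3]
      exact h2
    · have h1 := (hr.a _ hy u).mono_left (nhdsWithin_mono _ Ioi_subset_Ici_self)
      rw [stopAt_stopAt _ hu1.le] at h1
      refine (h1.sub_const (P.stepSum n (dropZero (vertIncr P F n x)) u)).congr' ?_
      filter_upwards [hev.filter_mono nhdsWithin_le_nhds,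
        (stepSum_eventually_right (P := P) (n := n) (dropZero (vertIncr P F n x)) u).filter_mono
          (nhdsWithin_mono _ Ioi_subset_Ici_self)] with v h3 h4
      simp only [hg, h3, h4]
  have hint : IntervalIntegrable (fun u : ℝ => horizDeriv F u.toNNReal (stopAt y u.toNNReal))
      MeasureTheory.volume 0 s :=
    hDr.intervalIntegrable hy (T := T) (fun t ht => (stopAt_stopAt _ (ht.trans hTT.le)).symm) hK
      T.2 hs
  have hFTC := intervalIntegral.integral_eq_sub_of_hasDeriv_right
    (f := fun u : ℝ => g u.toNNReal) (a := 0) (b := s) ?_ ?_ hint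
  · rw [horizIntegral, hFTC]
    simp only [hg, Real.toNNReal_coe, Real.toNNReal_zero, stepSum_dropZero_zero]
    ring
  · intro u hu
    rw [uIcc_of_le s.coe_nonneg] at hu
    have h1 : u.toNNReal ≤ T := (Real.toNNReal_le_iff_le_coe.2 hu.2).trans hs
    exact ((hcont _ h1).comp continuous_real_toNNReal.continuousAt).continuousWithinAt
  · intro u hu
    rw [min_eq_left s.coe_nonneg, max_eq_right s.coe_nonneg] at hu
    lift u to ℝ≥0 using hu.1.le
    have hus : u < s := hu.2
    have hu1 : u < T + 1 := (hus.trans_le hs).trans hTT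
    rw [hasDerivWithinAt_iff_tendsto_slope' (by simp)]
    have h1 := hD.tendsto (stopAt_mem_domain hy u)
    rw [stopAt_stopAt _ hu1.le] at h1
    have h2 : Tendsto (fun v : ℝ => (v - u).toNNReal) (𝓝[>] (u : ℝ)) (𝓝[>] 0) := by
      rw [tendsto_nhdsWithin_iff]
      constructor
      · have : Tendsto (fun v : ℝ => (v - u).toNNReal) (𝓝 (u : ℝ)) (𝓝 ((u : ℝ) - u).toNNReal) :=
          (continuous_real_toNNReal.comp (continuous_id.sub continuous_const)).tendsto _
        rw [sub_self, Real.toNNReal_zero] at this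
        exact this.mono_left nhdsWithin_le_nhds
      · filter_upwards [self_mem_nhdsWithin] with v hv
        simpa using hv
    rw [Real.toNNReal_coe]
    refine (h1.comp h2).congr' ?_
    have h3 : Tendsto Real.toNNReal (𝓝[>] (u : ℝ)) (𝓝[≥] u) := by
      rw [tendsto_nhdsWithin_iff]
      constructor
      · have := continuous_real_toNNReal.tendsto (u : ℝ)
        rw [Real.toNNReal_coe] at this
        exact this.mono_left nhdsWithin_le_nhds
      · filter_upwards [self_mem_nhdsWithin] with v hv
        exact NNReal.le_toNNReal_of_coe_le (le_of_lt hv)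
    obtain ⟨i, hi, hi1, hi2⟩ := P.exists_index (hu1.trans hT)
    filter_upwards [h3.eventually
      (stepSum_eventually_right (P := P) (n := n) (dropZero (vertIncr P F n x)) u),
      h3.eventually (Ico_mem_nhdsGE hi2), self_mem_nhdsWithin] with v h4 h5 h6
    have h6 : (u : ℝ) < v := h6
    lift v to ℝ≥0 using u.2.trans h6.le
    have h6 : u ≤ v := h6.le
    rw [Real.toNNReal_coe] at h4 h5
    -- The step path is constant on `[u, v]`, so the difference quotient of `F` along it is the
    -- horizontal one.
    have h7 : stopAt y v = stopAt y u := by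
      funext w
      simp only [stopAt]
      rcases le_total w u with hw | hw
      · rw [min_eq_left hw, min_eq_left (hw.trans h6)]
      · rw [min_eq_right hw, hydef, approx_eq P x hi hi1 hi2,
          approx_eq P x hi (hi1.trans (le_min hw h6)) ((min_le_right _ _).trans_lt h5.2)]
    have h8 : ((v : ℝ) - u).toNNReal = v - u := NNReal.sub_def.symm
    rw [slope_def_field]
    simp only [Function.comp, h8, hg, Real.toNNReal_coe, h4, h7, add_tsub_cancel_of_le h6,
      NNReal.coe_sub h6]
    ring

end

/-! ### Joint convergence of the horizontal integrals -/

section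

variable {P : PartitionSeq} {Ω : Set (Traj m)} {F : Functional m ℝ}

/-- At the fixed endpoint `t` this is dominated convergence: constant times satisfy `t'_n ≤ u`, so
the integrands converge pointwise by clause (c). Moving the endpoint to `s` costs at most `K |s -
t|`, uniformly in `n`. -/
theorem exists_tendsto_horizIntegral (hΩ : IsGeneric P Ω) (hDr : RightCont P Ω (horizDeriv F))
    (hDb : LocBdd P Ω (horizDeriv F)) {x : Traj m} (hx : x ∈ Ω) (t : ℝ≥0) :
    ∃ I : ℝ, Tendsto (fun p : ℕ × ℝ≥0 => horizIntegral F (P.approx p.1 x) p.2) (fullFilter t)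
      (𝓝 I) := by
  obtain ⟨n₀, K, hK⟩ := hDb x hx (t + 1)
  have htt : t < t + 1 := by simp
  have hint : ∀ᶠ n in atTop, ∀ a b : ℝ, a ≤ (t + 1 : ℝ≥0) → b ≤ (t + 1 : ℝ≥0) →
      IntervalIntegrable (fun u : ℝ => horizDeriv F u.toNNReal
        (stopAt (P.approx n x) u.toNNReal)) MeasureTheory.volume a b := by
    filter_upwards [eventually_ge_atTop n₀, hΩ.eventually_approx hx (t + 1)] with n h1 h2 a b ha hb
    exact hDr.intervalIntegrable h2.2 (T := t + 1)
      (fun s hs => (stopAt_stopAt _ (hs.trans (by simp))).symm) (hK n h1) ha hb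
  have hlim : Tendsto (fun n => horizIntegral F (P.approx n x) t) atTop
      (𝓝 (horizIntegral F x t)) := by
    have hmem : ∀ u ∈ uIoc (0 : ℝ) t, u.toNNReal ≤ t + 1 := fun u hu => by
      rw [Real.toNNReal_le_iff_le_coe]
      exact (hu.2.trans (max_le t.2 le_rfl)).trans (by exact_mod_cast htt.le)
    refine intervalIntegral.tendsto_integral_filter_of_dominated_convergence (fun _ => K) ?_ ?_
      intervalIntegrable_const ?_
    · filter_upwards [hint] with n hn
      exact (hn 0 t (t + 1).2 (by exact_mod_cast htt.le)).aestronglyMeasurable_restrict_uIoc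
    · filter_upwards [eventually_ge_atTop n₀] with n hn
      exact Eventually.of_forall fun u hu => hK n hn _ (hmem u hu)
    · exact Eventually.of_forall fun u _ =>
        hDr.c x hx u.toNNReal (fun _ => u.toNNReal) tendsto_const_nhds fun n => P.prev_le _
  refine ⟨horizIntegral F x t, ?_⟩
  have h1 : Tendsto (fun p : ℕ × ℝ≥0 => horizIntegral F (P.approx p.1 x) p.2 -
      horizIntegral F (P.approx p.1 x) t) (fullFilter t) (𝓝 0) := by
    have h2 : Tendsto (fun p : ℕ × ℝ≥0 => K * |(p.2 : ℝ) - t|) (fullFilter t) (𝓝 0) := by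
      have : Tendsto (fun p : ℕ × ℝ≥0 => K * |(p.2 : ℝ) - t|) (fullFilter t)
          (𝓝 (K * |(t : ℝ) - t|)) :=
        (((NNReal.continuous_coe.tendsto t).comp (tendsto_snd_full t)).sub_const _).abs.const_mul K
      simpa using this
    refine squeeze_zero_norm' ?_ h2
    filter_upwards [(tendsto_fst_full t).eventually (hint.and (eventually_ge_atTop n₀)),
      (tendsto_snd_full t).eventually (gt_mem_nhds htt)] with p ⟨h3, h5⟩ h4
    have h4' : (p.2 : ℝ) ≤ (t + 1 : ℝ≥0) := by exact_mod_cast h4.le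
    have h0' : (0 : ℝ) ≤ (t + 1 : ℝ≥0) := (t + 1).2
    have ht' : (t : ℝ) ≤ (t + 1 : ℝ≥0) := by exact_mod_cast htt.le
    rw [horizIntegral, horizIntegral,
      intervalIntegral.integral_interval_sub_left (h3 _ _ h0' h4') (h3 _ _ h0' ht')]
    refine intervalIntegral.norm_integral_le_of_norm_le_const fun u hu => ?_
    refine hK p.1 h5 _ ?_
    rw [Real.toNNReal_le_iff_le_coe]
    exact hu.2.trans (max_le ht' h4')
  simpa using h1.add (hlim.comp (tendsto_fst_full t))

end

/-! ### Second-order expansion of the vertical increments -/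

/-- The mean value inequality is used twice along the segment from `0` to `δ`, first for the
gradient and then for the function. The constant is not optimal. -/
theorem abs_taylor_two_le {E : Type*} [NormedAddCommGroup E] [InnerProductSpace ℝ E]
    [CompleteSpace E] {U : Set E} (hU : Convex ℝ U) {δ : E} (h0 : (0 : E) ∈ U) (hδ : δ ∈ U)
    {f : E → ℝ} {g : E → E} {H : E → E →L[ℝ] E} (hf : ∀ e ∈ U, HasGradientAt f (g e) e)
    (hg : ∀ e ∈ U, HasFDerivAt g (H e) e) {w : ℝ}
    (hw : ∀ s ∈ Icc (0 : ℝ) 1, ‖H (s • δ) - H 0‖ ≤ w) :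
    |f δ - f 0 - inner ℝ (g 0) δ - 1 / 2 * inner ℝ (H 0 δ) δ| ≤ w * ‖δ‖ ^ 2 := by
  have hmem : ∀ s ∈ Icc (0 : ℝ) 1, s • δ ∈ U := fun s hs => by
    simpa using hU h0 hδ (sub_nonneg.2 hs.2) hs.1 (by ring)
  have hline : ∀ s : ℝ, HasDerivAt (fun s : ℝ => s • δ) δ s := fun s => by
    simpa using (hasDerivAt_id s).smul_const δ
  have h01 : (0 : ℝ) ∈ Icc (0 : ℝ) 1 := by simp
  have h11 : (1 : ℝ) ∈ Icc (0 : ℝ) 1 := by simp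
  have hw0 : 0 ≤ w := (norm_nonneg _).trans (hw 0 h01)
  have hgs : ∀ s ∈ Icc (0 : ℝ) 1, ‖g (s • δ) - g 0 - s • H 0 δ‖ ≤ w * ‖δ‖ := by
    intro s hs
    have hd : ∀ v ∈ Icc (0 : ℝ) 1, HasDerivWithinAt (fun v : ℝ => g (v • δ) - v • H 0 δ)
        (H (v • δ) δ - H 0 δ) (Icc 0 1) v := by
      intro v hv
      have h1 := ((hg _ (hmem v hv)).comp_hasDerivAt v (hline v)).sub
        ((hasDerivAt_id v).smul_const (H 0 δ))
      exact (h1.congr_deriv (by simp)).hasDerivWithinAt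
    have hb : ∀ v ∈ Icc (0 : ℝ) 1, ‖H (v • δ) δ - H 0 δ‖ ≤ w * ‖δ‖ := fun v hv =>
      ((H (v • δ) - H 0).le_opNorm δ).trans (by gcongr; exact hw v hv)
    have h2 := Convex.norm_image_sub_le_of_norm_hasDerivWithin_le hd hb (convex_Icc 0 1) h01 hs
    simp only [zero_smul, sub_zero] at h2
    rw [sub_right_comm]
    refine h2.trans ?_
    have h3 : ‖s‖ ≤ 1 := by rw [Real.norm_eq_abs, abs_of_nonneg hs.1]; exact hs.2
    exact mul_le_of_le_one_right (by positivity) h3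
  have hd : ∀ v ∈ Icc (0 : ℝ) 1, HasDerivWithinAt
      (fun v : ℝ => f (v • δ) - v * inner ℝ (g 0) δ - v ^ 2 / 2 * inner ℝ (H 0 δ) δ)
      (inner ℝ (g (v • δ) - g 0 - v • H 0 δ) δ) (Icc 0 1) v := by
    intro v hv
    have h1 := (hf _ (hmem v hv)).hasFDerivAt.comp_hasDerivAt v (hline v)
    have h2 := (hasDerivAt_id v).mul_const (inner ℝ (g 0) δ)
    have h3 := (((hasDerivAt_id v).pow 2).div_const 2).mul_const (inner ℝ (H 0 δ) δ)
    refine (((h1.sub h2).sub h3).congr_deriv ?_).hasDerivWithinAt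
    rw [inner_sub_left, inner_sub_left, real_inner_smul_left]
    simp
  have hb : ∀ v ∈ Icc (0 : ℝ) 1, ‖inner ℝ (g (v • δ) - g 0 - v • H 0 δ) δ‖ ≤ w * ‖δ‖ ^ 2 := by
    intro v hv
    calc _ ≤ ‖g (v • δ) - g 0 - v • H 0 δ‖ * ‖δ‖ := norm_inner_le_norm _ _
      _ ≤ w * ‖δ‖ * ‖δ‖ := by gcongr; exact hgs v hv
      _ = _ := by ring
  have h2 := Convex.norm_image_sub_le_of_norm_hasDerivWithin_le hd hb (convex_Icc 0 1) h01 h11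
  simp only [one_smul, zero_smul, Real.norm_eq_abs] at h2
  refine le_trans (le_of_eq ?_) (h2.trans (by simp))
  congr 1
  ring

section

variable {P : PartitionSeq} {Ω : Set (Traj m)} {F : Functional m ℝ}

/-- Bumps at the same time add up, so the derivative at `e` is the derivative at `0` for the path
already perturbed by `e`. -/
theorem VertDiff.hasFDerivAt {V : Type*} [NormedAddCommGroup V] [NormedSpace ℝ V]
    {G : Functional m V} (hG : VertDiff Ω G) {t : ℝ≥0} {z : Traj m} {e : Vec m}
    (hz : (t, bump z t e) ∈ domain Ω) :
    HasFDerivAt (fun e => G t (bump z t e))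
      (fderiv ℝ (fun e' => G t (bump (bump z t e) t e')) 0) e := by
  have h := (hG _ hz).hasFDerivAt
  simp only [bump_bump] at h ⊢
  have h1 := HasFDerivAt.comp e (f := fun e' : Vec m => e' - e)
    (g := fun e' => G t (bump z t (e + e')))
    (g' := fderiv ℝ (fun e' => G t (bump z t (e + e'))) 0) (by simpa using h)
    ((hasFDerivAt_id e).sub_const e)
  simpa [Function.comp_def] using h1

theorem VertDiff.hasGradientAt (hF : VertDiff Ω F) {t : ℝ≥0} {z : Traj m} {e : Vec m}
    (hz : (t, bump z t e) ∈ domain Ω) :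
    HasGradientAt (fun e => F t (bump z t e)) (vertGrad F t (bump z t e)) e := by
  have h := hF.hasFDerivAt hz
  rw [hasGradientAt_iff_hasFDerivAt]
  simpa [vertGrad, gradient] using h

/-- The first-order remainder of the vertical increment at the partition point `t_i`. -/
def vertRem (P : PartitionSeq) (F : Functional m ℝ) (n : ℕ) (x : Traj m) (i : ℕ) : ℝ :=
  vertIncr P F n x i -
    inner ℝ (vertGrad F (P.pt n i) (stopLeft (P.approx n x) (P.pt n i))) (P.incr n x i)

/-- The quadratic form of a linear map. -/
def quadForm (H : Vec m →L[ℝ] Vec m) (δ : Vec m) : ℝ := inner ℝ (H δ) δ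

theorem abs_quadForm_le (H : Vec m →L[ℝ] Vec m) (δ : Vec m) :
    |quadForm H δ| ≤ ‖H‖ * ‖δ‖ ^ 2 := by
  calc |quadForm H δ| ≤ ‖H δ‖ * ‖δ‖ := abs_real_inner_le_norm _ _
    _ ≤ ‖H‖ * ‖δ‖ * ‖δ‖ := by gcongr; exact H.le_opNorm δ
    _ = _ := by ring

theorem quadForm_sub (H H' : Vec m →L[ℝ] Vec m) (δ : Vec m) :
    quadForm (H - H') δ = quadForm H δ - quadForm H' δ := by
  simp [quadForm, inner_sub_left]

/-- The jump of `x^n` at `t_i` is the increment `δ`. The convex set of the modulus hypothesis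
contains `0` and `δ`, hence the segment between them, so Taylor's formula applies there with
oscillation at most `ω(|δ|)`. -/
theorem vertRem_expansion (hv : VertDiff Ω F) (hg : VertDiff Ω (vertGrad F))
    (hm : VertModulus P Ω (vertHess F)) {x : Traj m} (hx : x ∈ Ω) (t : ℝ≥0) {r : ℝ} (hr : 0 < r) :
    ∃ ω : ℝ≥0 → ℝ≥0, Monotone ω ∧ Tendsto ω (𝓝[>] 0) (𝓝 0) ∧
      ∀ᶠ p in fullFilter t, ∀ i < P.k p.1, i ≠ 0 → P.pt p.1 i = p.2 → ‖P.incr p.1 x i‖ ≤ r →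
        |vertRem P F p.1 x i - 1 / 2 * quadForm
          (vertHess F (P.pt p.1 i) (stopLeft (P.approx p.1 x) (P.pt p.1 i))) (P.incr p.1 x i)| ≤
          ω ‖P.incr p.1 x i‖₊ * ‖P.incr p.1 x i‖ ^ 2 := by
  obtain ⟨ω, hω, hω0, h⟩ := hm x hx (t + 1) r hr
  refine ⟨ω, hω, hω0, ?_⟩
  filter_upwards [(tendsto_fst_full t).eventually h,
    (tendsto_snd_full t).eventually (gt_mem_nhds (show t < t + 1 by simp))]
    with p h1 h2 i hi hi0 hpi hδr
  obtain ⟨U, hU, hUc, hjU, hUΩ, hUω⟩ := h1 p.2 h2.le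
  rw [← hpi] at hjU hUΩ hUω
  rw [jump_approx P x hi hi0] at hjU
  set δ := P.incr p.1 x i with hδ
  set z := stopLeft (P.approx p.1 x) (P.pt p.1 i) with hz
  have hdom : ∀ e ∈ U, (P.pt p.1 i, bump z (P.pt p.1 i) e) ∈ domain Ω := fun e he =>
    mem_domain (hUΩ e he) (by rw [stopAt_bump, hz, stopAt_stopLeft])
  have h0U := mem_of_mem_nhds hU
  have key := abs_taylor_two_le hUc h0U hjU (f := fun e => F (P.pt p.1 i) (bump z (P.pt p.1 i) e))
    (g := fun e => vertGrad F (P.pt p.1 i) (bump z (P.pt p.1 i) e))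
    (H := fun e => vertHess F (P.pt p.1 i) (bump z (P.pt p.1 i) e))
    (fun e he => hv.hasGradientAt (hdom e he)) (fun e he => hg.hasFDerivAt (hdom e he))
    (w := ω ‖δ‖₊) ?_
  · have h3 : bump z (P.pt p.1 i) δ = stopAt (P.approx p.1 x) (P.pt p.1 i) := by
      rw [hz, hδ, ← jump_approx P x hi hi0, bump_jump]
    simp only [h3, bump_zero] at key
    rw [vertRem, vertIncr, quadForm]
    exact key
  · intro s hs
    have hnorm : ‖s • δ‖₊ ≤ ‖δ‖₊ := by
      rw [nnnorm_smul]
      refine mul_le_of_le_one_left zero_le ?_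
      rw [← NNReal.coe_le_coe, coe_nnnorm, Real.norm_eq_abs, abs_of_nonneg hs.1]
      exact hs.2
    have hsU : s • δ ∈ U := by
      simpa using hUc h0U hjU (sub_nonneg.2 hs.2) hs.1 (by ring)
    have h4 := hUω (s • δ) ⟨hsU, ?_⟩ 0 ⟨h0U, ?_⟩
    · rw [sub_zero] at h4
      exact h4.trans (by exact_mod_cast hω hnorm)
    · rw [mem_closedBall_zero_iff]
      exact le_trans (by exact_mod_cast hnorm) hδr
    · rw [mem_closedBall_zero_iff, norm_zero]; exact hr.le

theorem vertRem_bound (hΩ : IsGeneric P Ω) (hF : IsC12 P Ω F) {x : Traj m} (hx : x ∈ Ω) (t : ℝ≥0) :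
    ∃ C : ℝ, 0 ≤ C ∧ ∀ᶠ p in fullFilter t, ∀ i < P.k p.1, i ≠ 0 → P.pt p.1 i = p.2 →
      |vertRem P F p.1 x i| ≤ C * ‖P.incr p.1 x i‖ ^ 2 := by
  obtain ⟨r, hr, hb⟩ := incr_bdd P (hΩ.cadlag x hx) t
  obtain ⟨ω, hω, -, hexp⟩ := vertRem_expansion hF.vertDiff hF.vertDiff_grad hF.hess_modulus hx t hr
  obtain ⟨n₀, K, hK⟩ := hF.hess_locBdd x hx (t + 1)
  -- Here `ω(r)` bounds the Taylor error for increments of size at most `r`, and `|K|` bounds the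
  -- Hessian.
  refine ⟨ω r.toNNReal + |K|, by positivity, ?_⟩
  filter_upwards [hb, hexp, (tendsto_fst_full t).eventually (eventually_ge_atTop n₀),
    (tendsto_snd_full t).eventually (gt_mem_nhds (show t < t + 1 by simp))]
    with p h1 h2 h3 h4 i hi hi0 hpi
  have h5 := h1 i hi hpi
  have h6 := h2 i hi hi0 hpi h5
  have h7 : ‖vertHess F (P.pt p.1 i) (stopLeft (P.approx p.1 x) (P.pt p.1 i))‖ ≤ |K| := by
    have := hK p.1 h3 p.2 h4.le
    rw [minus, stopLeft_stopAt _ le_rfl, ← hpi] at this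
    exact this.trans (le_abs_self K)
  have h8 := abs_quadForm_le (vertHess F (P.pt p.1 i)
    (stopLeft (P.approx p.1 x) (P.pt p.1 i))) (P.incr p.1 x i)
  have h9 : (ω ‖P.incr p.1 x i‖₊ : ℝ) ≤ ω r.toNNReal := by
    have : ‖P.incr p.1 x i‖₊ ≤ r.toNNReal := NNReal.le_toNNReal_of_coe_le (by simpa using h5)
    exact_mod_cast hω this
  set Q := quadForm (vertHess F (P.pt p.1 i)
    (stopLeft (P.approx p.1 x) (P.pt p.1 i))) (P.incr p.1 x i)
  set D := ‖P.incr p.1 x i‖ ^ 2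
  have hD : 0 ≤ D := by positivity
  have h10 : |Q| ≤ |K| * D := h8.trans (by gcongr)
  have h11 : |vertRem P F p.1 x i - 1 / 2 * Q| ≤ ω r.toNNReal * D := h6.trans (by gcongr)
  have h12 : 0 ≤ |K| * D := by positivity
  rw [abs_le] at h10 h11 ⊢
  constructor <;> linarith [h10.1, h10.2, h11.1, h11.2]

/-- Strictly before `t'_n` the increments are small, which makes the Taylor error negligible, and
the Hessian along `x^n` is close to its value at `(t, x_{t-})`. Each effect costs `ε/2` or `ε`, the
quadratic form carrying the factor `1/2`. -/
theorem vertRem_left (hΩ : IsGeneric P Ω) (hF : IsC12 P Ω F) {x : Traj m} (hx : x ∈ Ω) (t : ℝ≥0)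
    {ε : ℝ} (hε : 0 < ε) :
    ∀ᶠ p in P.leftFilter t, ∀ i < P.k p.1, i ≠ 0 → P.pt p.1 i = p.2 →
      |vertRem P F p.1 x i - 1 / 2 * quadForm (vertHess F t (stopLeft x t)) (P.incr p.1 x i)| ≤
        ε * ‖P.incr p.1 x i‖ ^ 2 := by
  obtain ⟨ω, hω, hω0, hexp⟩ :=
    vertRem_expansion hF.vertDiff hF.vertDiff_grad hF.hess_modulus hx t one_pos
  have h1 : ∀ᶠ a in 𝓝[>] (0 : ℝ≥0), (ω a : ℝ) < ε / 2 := by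
    have := (NNReal.continuous_coe.tendsto 0).comp hω0
    exact this.eventually (gt_mem_nhds (by simpa using hε))
  obtain ⟨a, ha, haω⟩ := (mem_nhdsGT_iff_exists_Ioo_subset).1 h1
  have hH := hF.hess_leftCont.tendsto_stopLeft hx t
  simp only [minus, stopLeft_stopLeft] at hH
  have hH' := eventually_inf_principal.1 (Metric.tendsto_nhds.1 hH ε hε)
  refine eventually_inf_principal.2 ?_
  filter_upwards [hexp, incr_small P (hΩ.cadlag x hx) t one_pos,
    incr_small P (hΩ.cadlag x hx) t (NNReal.coe_pos.2 ha), hH'] with p h2 h3 h4 h5 h6 i hi hi0 hpi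
  have h7 := h2 i hi hi0 hpi (h3 i hi hpi (ne_of_lt h6)).le
  have h8 := h4 i hi hpi (ne_of_lt h6)
  have h9 := h5 (le_of_lt h6)
  rw [← hpi, dist_eq_norm] at h9
  have h10 : (ω ‖P.incr p.1 x i‖₊ : ℝ) * ‖P.incr p.1 x i‖ ^ 2 ≤
      ε / 2 * ‖P.incr p.1 x i‖ ^ 2 := by
    -- Only `ω(0+) = 0` is known, not `ω(0) = 0`; for a zero increment the square vanishes anyway.
    rcases eq_or_ne (P.incr p.1 x i) 0 with h0 | h0
    · simp [h0]
    · have : (ω ‖P.incr p.1 x i‖₊ : ℝ) < ε / 2 := haω ⟨by simpa using h0, by exact_mod_cast h8⟩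
      gcongr
  have h11 := abs_quadForm_le (vertHess F (P.pt p.1 i)
    (stopLeft (P.approx p.1 x) (P.pt p.1 i)) - vertHess F t (stopLeft x t)) (P.incr p.1 x i)
  rw [quadForm_sub] at h11
  have h12 := h11.trans (mul_le_mul_of_nonneg_right h9.le (sq_nonneg _))
  have h13 := h7.trans h10
  rw [abs_le] at h12 h13 ⊢
  constructor <;> linarith [h12.1, h12.2, h13.1, h13.2]

end

/-! ### Limits of quadratic sums -/

theorem quadForm_eq_sum (H : Vec m →L[ℝ] Vec m) (δ : Vec m) :
    quadForm H δ = ∑ a, ∑ b, H (EuclideanSpace.single b 1) a * (δ a * δ b) := by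
  have h1 : H δ = ∑ b, δ b • H (EuclideanSpace.single b 1) := by
    have h2 := (EuclideanSpace.basisFun (Fin m) ℝ).sum_repr δ
    conv_lhs => rw [← h2]
    simp [map_sum]
  rw [quadForm, h1, PiLp.inner_apply]
  refine Finset.sum_congr rfl fun a _ => ?_
  simp only [WithLp.ofLp_sum, WithLp.ofLp_smul, Finset.sum_apply, Pi.smul_apply, smul_eq_mul,
    RCLike.inner_apply, conj_trivial, Finset.mul_sum]
  exact Finset.sum_congr rfl fun b _ => by ring

theorem quadForm_id (δ : Vec m) : quadForm (ContinuousLinearMap.id ℝ (Vec m)) δ = ‖δ‖ ^ 2 := by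
  simp [quadForm]

theorem stepSum_const_mul {P : PartitionSeq} {n : ℕ} (C : ℝ) (c : ℕ → ℝ) (s : ℝ≥0) :
    P.stepSum n (fun i => C * c i) s = C * P.stepSum n c s :=
  stepSum_map (AddMonoidHom.mulLeft C) c s

theorem stepSum_finset_sum {P : PartitionSeq} {n : ℕ} {ι : Type*} (I : Finset ι)
    (c : ι → ℕ → ℝ) (s : ℝ≥0) :
    P.stepSum n (fun i => ∑ a ∈ I, c a i) s = ∑ a ∈ I, P.stepSum n (c a) s := by
  simp only [PartitionSeq.stepSum]
  rw [Finset.sum_comm]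
  refine Finset.sum_congr rfl fun i _ => ?_
  split_ifs <;> simp

theorem SkorokhodTendsto.entry {y : ℕ → ℝ≥0 → Matrix (Fin m) (Fin m) ℝ}
    {z : ℝ≥0 → Matrix (Fin m) (Fin m) ℝ} (h : SkorokhodTendsto y z) (a b : Fin m) :
    SkorokhodTendsto (fun n s => y n s a b) (fun s => z s a b) := by
  obtain ⟨lam, h1, h2⟩ := h
  refine ⟨lam, h1, fun T => ?_⟩
  have h3 : UniformContinuous fun M : Matrix (Fin m) (Fin m) ℝ => M a b :=
    (Pi.uniformContinuous_proj (fun _ : Fin m => ℝ) b).comp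
      (Pi.uniformContinuous_proj (fun _ : Fin m => Fin m → ℝ) a)
  exact h3.comp_tendstoUniformlyOn (h2 T)

/-- Each entry of the matrix sums is a scalar step sum whose terms are small away from `t'_n`, so
the Skorokhod lemma applies entrywise. The quadratic form of `H` is a fixed linear combination of
entries. -/
theorem exists_quad_limits {P : PartitionSeq} {x : Traj m} (hx : x ∈ P.Q m) :
    ∃ q : (Vec m →L[ℝ] Vec m) → ℝ≥0 → ℝ, ∀ H, IsCadlag (q H) ∧ ∀ t,
      Tendsto (fun p : ℕ × ℝ≥0 => P.stepSum p.1 (fun i => quadForm H (P.incr p.1 x i)) p.2)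
        (P.rightFilter t) (𝓝 (q H t)) ∧
      Tendsto (fun p : ℕ × ℝ≥0 => P.stepSum p.1 (fun i => quadForm H (P.incr p.1 x i)) p.2)
        (P.leftFilter t) (𝓝 (Function.leftLim (q H) t)) := by
  obtain ⟨hxc, q, hq, hS⟩ := hx
  have hcont : ∀ a b : Fin m, Continuous fun M : Matrix (Fin m) (Fin m) ℝ => M a b :=
    fun a b => (continuous_apply b).comp (continuous_apply a)
  have hentry : ∀ a b : Fin m, ∀ t,
      Tendsto (fun p : ℕ × ℝ≥0 => P.stepSum p.1 (fun i => P.incr p.1 x i a * P.incr p.1 x i b) p.2)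
        (P.rightFilter t) (𝓝 (q t a b)) ∧
      Tendsto (fun p : ℕ × ℝ≥0 => P.stepSum p.1 (fun i => P.incr p.1 x i a * P.incr p.1 x i b) p.2)
        (P.leftFilter t) (𝓝 (Function.leftLim q t a b)) := by
    intro a b t
    have h1 := hS.entry a b
    have h2 : (fun n s => P.qvSum n x s a b) =
        fun n s => P.stepSum n (fun i => P.incr n x i a * P.incr n x i b) s := by
      funext n s
      simp only [PartitionSeq.qvSum, PartitionSeq.stepSum, Matrix.sum_apply]
      refine Finset.sum_congr rfl fun i _ => ?_
      split_ifs
      · rfl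
      · rfl
    rw [h2] at h1
    refine stepSum_tendsto_of_skorokhod P h1
      ((hcont a b).continuousAt.tendsto.comp (hq t).1.tendsto)
      (((hcont a b).tendsto _).comp (hq.tendsto_leftLim t)) fun ε hε => ?_
    filter_upwards [incr_small P hxc t (Real.sqrt_pos.2 hε)] with p hp i hi hpi hne
    have h3 := hp i hi hpi hne
    have h4 : |P.incr p.1 x i a| ≤ ‖P.incr p.1 x i‖ := PiLp.norm_apply_le (P.incr p.1 x i) a
    have h5 : |P.incr p.1 x i b| ≤ ‖P.incr p.1 x i‖ := PiLp.norm_apply_le (P.incr p.1 x i) b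
    rw [abs_mul]
    calc _ ≤ ‖P.incr p.1 x i‖ * ‖P.incr p.1 x i‖ := by gcongr
      _ < √ε * √ε := mul_self_lt_mul_self (norm_nonneg _) h3
      _ = ε := Real.mul_self_sqrt hε.le
  refine ⟨fun H t => ∑ a, ∑ b, H (EuclideanSpace.single b 1) a * q t a b, fun H => ?_⟩
  have hL : Continuous fun M : Matrix (Fin m) (Fin m) ℝ =>
      ∑ a, ∑ b, H (EuclideanSpace.single b 1) a * M a b :=
    continuous_finsetSum _ fun a _ => continuous_finsetSum _ fun b _ =>
      (hcont a b).const_mul _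
  have hlim : ∀ t, Tendsto (fun t => ∑ a, ∑ b, H (EuclideanSpace.single b 1) a * q t a b) (𝓝[<] t)
      (𝓝 (∑ a, ∑ b, H (EuclideanSpace.single b 1) a * Function.leftLim q t a b)) := fun t =>
    (hL.tendsto _).comp (hq.tendsto_leftLim t)
  have hsum : ∀ p : ℕ × ℝ≥0, P.stepSum p.1 (fun i => quadForm H (P.incr p.1 x i)) p.2 =
      ∑ a, ∑ b, H (EuclideanSpace.single b 1) a *
        P.stepSum p.1 (fun i => P.incr p.1 x i a * P.incr p.1 x i b) p.2 := by
    intro p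
    simp only [quadForm_eq_sum, stepSum_finset_sum, stepSum_const_mul]
  have hcad : IsCadlag fun t => ∑ a, ∑ b, H (EuclideanSpace.single b 1) a * q t a b := fun t =>
    ⟨hL.continuousAt.tendsto.comp (hq t).1.tendsto, _, hlim t⟩
  refine ⟨hcad, fun t => ?_⟩
  simp only [hsum]
  refine ⟨tendsto_finsetSum _ fun a _ => tendsto_finsetSum _ fun b _ =>
    (hentry a b t).1.const_mul _, ?_⟩
  rcases eq_or_lt_of_le (zero_le : (0 : ℝ≥0) ≤ t) with h0 | h0
  · rw [← h0, P.leftFilter_zero]; exact tendsto_bot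
  have := nhdsLT_neBot_of_pos h0
  rw [leftLim_eq_of_tendsto (hlim t)]
  exact tendsto_finsetSum _ fun a _ => tendsto_finsetSum _ fun b _ =>
    (hentry a b t).2.const_mul _

/-! ### A one-sided Cauchy criterion -/

/-- The increments of `A n` over `[r, s]` oscillate asymptotically by at most `b`. -/
def OscLE (A : ℕ → ℝ≥0 → ℝ) (r s : ℝ≥0) (b : ℝ) : Prop :=
  ∀ γ > (0 : ℝ), ∀ᶠ z : ℕ × ℕ in atTop ×ˢ atTop,
    |(A z.1 s - A z.1 r) - (A z.2 s - A z.2 r)| ≤ b + γ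

theorem OscLE.trans {A : ℕ → ℝ≥0 → ℝ} {r s t : ℝ≥0} {b b' : ℝ} (h : OscLE A r s b)
    (h' : OscLE A s t b') : OscLE A r t (b + b') := by
  intro γ hγ
  filter_upwards [h (γ / 2) (half_pos hγ), h' (γ / 2) (half_pos hγ)] with z h1 h2
  have h3 : (A z.1 t - A z.1 r) - (A z.2 t - A z.2 r) =
      ((A z.1 s - A z.1 r) - (A z.2 s - A z.2 r)) +
        ((A z.1 t - A z.1 s) - (A z.2 t - A z.2 s)) := by ring
  rw [h3]
  refine (abs_add_le _ _).trans ?_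
  linarith

theorem OscLE.mono {A : ℕ → ℝ≥0 → ℝ} {r s : ℝ≥0} {b b' : ℝ} (h : OscLE A r s b) (hb : b ≤ b') :
    OscLE A r s b' := fun γ hγ => (h γ hγ).mono fun _ hz => hz.trans (by linarith)

theorem OscLE.of_forall_add {A : ℕ → ℝ≥0 → ℝ} {r s : ℝ≥0} {b : ℝ}
    (h : ∀ η > (0 : ℝ), OscLE A r s (b + η)) : OscLE A r s b := fun γ hγ =>
  (h (γ / 2) (half_pos hγ) (γ / 2) (half_pos hγ)).mono fun _ hz => hz.trans (by linarith)

/-- Increments that are dominated on the right of every point and have vanishing left derivative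
with respect to a right-continuous increasing function form a Cauchy sequence. -/
theorem cauchySeq_of_oscLE {A : ℕ → ℝ≥0 → ℝ} {μ : ℝ≥0 → ℝ} (hμ : Monotone μ)
    (hμr : ∀ t, ContinuousWithinAt μ (Ici t) t)
    (h1 : ∀ t, ∃ C : ℝ, ∀ᶠ s in 𝓝[≥] t, OscLE A t s (C * (μ s - μ t)))
    (h2 : ∀ t > 0, ∀ ε > (0 : ℝ), ∀ᶠ s in 𝓝[<] t, OscLE A s t (ε * (μ t - μ s))) (T : ℝ≥0) :
    CauchySeq fun n => A n T - A n 0 := by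
  have key : ∀ ε > (0 : ℝ), OscLE A 0 T (ε * (μ T - μ 0)) := by
    intro ε hε
    set S : Set ℝ≥0 := {s | OscLE A s T (ε * (μ T - μ s))} with hS
    have hTS : T ∈ S := by
      intro γ hγ
      simp [hγ.le]
    have hne : S.Nonempty := ⟨T, hTS⟩
    have hbdd : BddBelow S := OrderBot.bddBelow S
    -- Points of `S` approach the infimum from the right, where `h1` bounds the missing piece by `C
    -- (μ s - μ (inf S))`. This tends to zero by right-continuity of `μ`.
    have haS : sInf S ∈ S := by
      obtain ⟨C, hC⟩ := h1 (sInf S)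
      refine OscLE.of_forall_add fun η hη => ?_
      have h3 : Tendsto (fun s => C * (μ s - μ (sInf S))) (𝓝[≥] (sInf S)) (𝓝 0) := by
        have := ((hμr (sInf S)).tendsto.sub_const (μ (sInf S))).const_mul C
        simpa using this
      obtain ⟨s, hsS, hs1, hs2, hs3⟩ := (((isGLB_csInf hne hbdd).frequently_mem hne).and_eventually
        (hC.and ((h3.eventually (gt_mem_nhds hη)).and (eventually_mem_set.2
          self_mem_nhdsWithin)))).exists
      refine (hs1.trans hsS).mono ?_
      have : ε * (μ T - μ s) ≤ ε * (μ T - μ (sInf S)) := by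
        gcongr
        exact hμ hs3
      linarith
    -- At a positive infimum `h2` would extend the estimate strictly further to the left.
    have ha0 : sInf S = 0 := by
      by_contra h0
      have hpos : 0 < sInf S := pos_iff_ne_zero.2 h0
      have := nhdsLT_neBot_of_pos hpos
      obtain ⟨s, hs1, hs2⟩ := ((h2 _ hpos ε hε).and (eventually_mem_set.2
        self_mem_nhdsWithin)).exists
      have : s ∈ S := (hs1.trans haS).mono (le_of_eq (by ring))
      exact absurd (csInf_le hbdd this) (not_le.mpr hs2)
    rw [ha0] at haS
    exact haS
  rw [cauchySeq_iff_tendsto, ← prod_atTop_atTop_eq, Metric.uniformity_eq_comap_nhds_zero,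
    tendsto_comap_iff, Metric.tendsto_nhds]
  intro ε hε
  have hpos : 0 < |μ T - μ 0| + 1 := by positivity
  filter_upwards [key (ε / 3 / (|μ T - μ 0| + 1)) (by positivity) (ε / 3) (by positivity)]
    with z hz
  simp only [Function.comp, Prod.map, dist_zero_right, Real.norm_eq_abs, Real.dist_eq]
  have h3 : ε / 3 / (|μ T - μ 0| + 1) * (μ T - μ 0) ≤ ε / 3 := by
    rw [div_mul_eq_mul_div, div_le_iff₀ hpos]
    gcongr
    linarith [le_abs_self (μ T - μ 0)]
  rw [abs_abs]
  linarith

/-! ### Convergence of the remainder sums -/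

/-- The sum of the squared increments of `x` at the partition points up to `s`. -/
def sqSum (P : PartitionSeq) (x : Traj m) (n : ℕ) (s : ℝ≥0) : ℝ :=
  P.stepSum n (fun i => ‖P.incr n x i‖ ^ 2) s

/-- The sum of the first-order remainders at the positive partition points up to `s`. -/
def remSum (P : PartitionSeq) (F : Functional m ℝ) (x : Traj m) (n : ℕ) (s : ℝ≥0) : ℝ :=
  P.stepSum n (dropZero (vertRem P F n x)) s

/-- The term of the Riemann sum of the vertical gradient at `t_i`. -/
def gradIncr (P : PartitionSeq) (F : Functional m ℝ) (n : ℕ) (x : Traj m) (i : ℕ) : ℝ :=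
  inner ℝ (vertGrad F (P.pt n i) (stopLeft (P.approx n x) (P.pt n i))) (P.incr n x i)

/-- The Riemann sum of the vertical gradient without its term at time zero. -/
def gradSum (P : PartitionSeq) (F : Functional m ℝ) (x : Traj m) (n : ℕ) (s : ℝ≥0) : ℝ :=
  P.stepSum n (dropZero (gradIncr P F n x)) s

theorem dist_lt_of_between {r s u t : ℝ≥0} {η : ℝ} (hr : dist r t < η) (hs : dist s t < η)
    (h1 : min r s ≤ u) (h2 : u ≤ max r s) : dist u t < η := by
  rw [NNReal.dist_eq, abs_lt] at *
  have h1' : min (r : ℝ) s ≤ u := by exact_mod_cast h1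
  have h2' : (u : ℝ) ≤ max (r : ℝ) s := by exact_mod_cast h2
  rcases min_le_iff.1 h1' with h3 | h3 <;> rcases le_max_iff.1 h2' with h4 | h4 <;>
    constructor <;> linarith [hr.1, hr.2, hs.1, hs.2]

theorem PartitionSeq.tendsto_right_const (P : PartitionSeq) (t : ℝ≥0) :
    Tendsto (fun n => (n, t)) atTop (P.rightFilter t) :=
  P.tendsto_rightFilter tendsto_id tendsto_const_nhds (Eventually.of_forall fun _ => P.prev_le t)

theorem PartitionSeq.tendsto_apply_right (P : PartitionSeq) {t : ℝ≥0} {f : ℕ → ℝ≥0 → ℝ}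
    {l : Filter ℝ} (h : Tendsto (fun p : ℕ × ℝ≥0 => f p.1 p.2) (P.rightFilter t) l) :
    Tendsto (fun n => f n t) atTop l :=
  h.comp (P.tendsto_right_const t)

theorem PartitionSeq.tendsto_right_prev (P : PartitionSeq) (t : ℝ≥0) :
    Tendsto (fun n => (n, P.prev n t)) atTop (P.rightFilter t) :=
  P.tendsto_rightFilter tendsto_id (P.tendsto_prev t) (Eventually.of_forall fun _ => le_rfl)

theorem PartitionSeq.tendsto_fst_right (P : PartitionSeq) (t : ℝ≥0) :
    Tendsto (fun p : ℕ × ℝ≥0 => p.1) (P.rightFilter t) atTop :=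
  (tendsto_fst_full t).mono_left inf_le_left

theorem PartitionSeq.tendsto_fst_left (P : PartitionSeq) (t : ℝ≥0) :
    Tendsto (fun p : ℕ × ℝ≥0 => p.1) (P.leftFilter t) atTop :=
  (tendsto_fst_full t).mono_left inf_le_left

section

variable {P : PartitionSeq} {Ω : Set (Traj m)} {F : Functional m ℝ}

theorem abs_remSum_sub_le (hΩ : IsGeneric P Ω) (hF : IsC12 P Ω F) {x : Traj m} (hx : x ∈ Ω)
    (t : ℝ≥0) :
    ∃ C : ℝ, 0 ≤ C ∧ ∃ N : ℕ, ∃ η > (0 : ℝ), ∀ n ≥ N, ∀ r s, dist r t < η → dist s t < η →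
      |remSum P F x n s - remSum P F x n r| ≤ C * |sqSum P x n s - sqSum P x n r| := by
  obtain ⟨C, hC, h⟩ := vertRem_bound hΩ hF hx t
  obtain ⟨N, η, hη, h⟩ := eventually_fullFilter.1 h
  refine ⟨C, hC, N, η, hη, fun n hn r s hr hs => ?_⟩
  have h1 : |remSum P F x n s - remSum P F x n r| ≤
      |P.stepSum n (fun i => C * ‖P.incr n x i‖ ^ 2) s -
        P.stepSum n (fun i => C * ‖P.incr n x i‖ ^ 2) r| := by
    refine abs_stepSum_sub_le fun i hi h1 h2 => ?_
    rcases eq_or_ne i 0 with rfl | hi0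
    · simp only [dropZero, if_pos, abs_zero]; positivity
    · simp only [dropZero, if_neg hi0]
      exact h n hn _ (dist_lt_of_between hr hs h1.le h2) i hi hi0 rfl
  rwa [stepSum_const_mul, stepSum_const_mul, ← mul_sub, abs_mul, abs_of_nonneg hC] at h1

theorem tendsto_remSum_sub (hΩ : IsGeneric P Ω) (hF : IsC12 P Ω F) {x : Traj m} (hx : x ∈ Ω)
    {t : ℝ≥0} {α : Type*} {l : Filter α} {N : α → ℕ} {f g : α → ℝ≥0} (hN : Tendsto N l atTop)
    (hf : Tendsto f l (𝓝 t)) (hg : Tendsto g l (𝓝 t))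
    (hM : Tendsto (fun a => sqSum P x (N a) (f a) - sqSum P x (N a) (g a)) l (𝓝 0)) :
    Tendsto (fun a => remSum P F x (N a) (f a) - remSum P F x (N a) (g a)) l (𝓝 0) := by
  obtain ⟨C, hC, N₀, η, hη, h⟩ := abs_remSum_sub_le hΩ hF hx t
  have h2 : Tendsto (fun a => C * |sqSum P x (N a) (f a) - sqSum P x (N a) (g a)|) l (𝓝 0) := by
    simpa using hM.abs.const_mul C
  refine squeeze_zero_norm' ?_ h2
  filter_upwards [hN.eventually_ge_atTop N₀, hf.eventually (Metric.ball_mem_nhds t hη),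
    hg.eventually (Metric.ball_mem_nhds t hη)] with a h3 h4 h5
  exact h _ h3 _ _ h5 h4

theorem exists_sqSum_limits {x : Traj m} (hx : x ∈ P.Q m) :
    ∃ μ : ℝ≥0 → ℝ, Monotone μ ∧ IsCadlag μ ∧ ∀ t,
      Tendsto (fun p : ℕ × ℝ≥0 => sqSum P x p.1 p.2) (P.rightFilter t) (𝓝 (μ t)) ∧
      Tendsto (fun p : ℕ × ℝ≥0 => sqSum P x p.1 p.2) (P.leftFilter t)
        (𝓝 (Function.leftLim μ t)) := by
  obtain ⟨q, hq⟩ := exists_quad_limits hx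
  obtain ⟨h1, h2⟩ := hq (ContinuousLinearMap.id ℝ (Vec m))
  simp only [quadForm_id] at h2
  refine ⟨_, fun r s hrs => ?_, h1, h2⟩
  refine le_of_tendsto_of_tendsto' ((h2 r).1.comp (P.tendsto_right_const r))
    ((h2 s).1.comp (P.tendsto_right_const s)) fun n => ?_
  exact stepSum_mono (fun i => sq_nonneg _) hrs

theorem gradIncr_prev_tendsto (hF : IsC12 P Ω F) {x : Traj m} (hx : x ∈ Ω) (hxc : IsCadlag x)
    {t : ℝ≥0} (ht : 0 < t) :
    Tendsto (fun n => gradIncr P F n x (P.prevIdx n t)) atTop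
      (𝓝 (inner ℝ (vertGrad F t (stopLeft x t)) (jump x t))) := by
  have h1 := hF.grad_leftCont.c x hx t (fun n => P.prev n t) (P.tendsto_prev t) fun _ => le_rfl
  simp only [minus, stopLeft_stopLeft] at h1
  refine (h1.inner (𝕜 := ℝ) (tendsto_incr_prev P hxc ht)).congr' ?_
  filter_upwards [P.eventually_prevIdx ht] with n hn
  rw [gradIncr, hn.2.2.1]

/-- If `x` jumps at `t`, the increment at `t'_n` is not small and Taylor's formula is of no use. The
term still converges, because `F(t'_n, x^n_{t'_n})`, `F(t'_n, x^n_{t'_n-})` and the gradient term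
all do. -/
theorem vertRem_prev_tendsto (hΩ : IsGeneric P Ω) (hF : IsC12 P Ω F) {x : Traj m} (hx : x ∈ Ω)
    {t : ℝ≥0} (ht : 0 < t) :
    ∃ ρ, Tendsto (fun n => vertRem P F n x (P.prevIdx n t)) atTop (𝓝 ρ) := by
  have h1 := (hF.cont.rightCont hΩ).c x hx t (fun n => P.prev n t) (P.tendsto_prev t)
    fun _ => le_rfl
  have h2 := (hF.cont.leftCont hΩ).c x hx t (fun n => P.prev n t) (P.tendsto_prev t)
    fun _ => le_rfl
  refine ⟨_, ((h1.sub h2).sub (gradIncr_prev_tendsto hF hx (hΩ.cadlag x hx) ht)).congr' ?_⟩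
  filter_upwards [P.eventually_prevIdx ht] with n hn
  rw [vertRem, gradIncr, vertIncr, hn.2.2.1]

theorem stepSum_dropZero_prev {E : Type*} [AddCommGroup E] (c : ℕ → ℕ → E) {t : ℝ≥0} (ht : 0 < t) :
    ∀ᶠ n in atTop, P.stepSum n (dropZero (c n)) (P.prev n t) =
      P.stepSum n (dropZero (c n)) (P.prev n (P.prev n t)) + c n (P.prevIdx n t) := by
  filter_upwards [P.eventually_prevIdx ht] with n ⟨h1, h2, h3, _⟩
  rw [← h3] at h1 ⊢
  rw [stepSum_prev _ h2 h1]
  congr 1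
  rw [dropZero, if_neg]
  intro h0
  rw [h0, P.pt_zero] at h1
  exact lt_irrefl _ h1

theorem remSum_sub_prev (hΩ : IsGeneric P Ω) (hQ : Ω ⊆ P.Q m) (hF : IsC12 P Ω F) {x : Traj m}
    (hx : x ∈ Ω) (t : ℝ≥0) :
    Tendsto (fun p : ℕ × ℝ≥0 => remSum P F x p.1 p.2 - remSum P F x p.1 (P.prev p.1 t))
      (P.rightFilter t) (𝓝 0) := by
  obtain ⟨μ, -, -, hμ⟩ := exists_sqSum_limits (hQ hx)
  refine tendsto_remSum_sub hΩ hF hx (P.tendsto_fst_right t)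
    ((tendsto_snd_full t).mono_left inf_le_left)
    ((P.tendsto_prev t).comp (P.tendsto_fst_right t)) ?_
  simpa using (hμ t).1.sub (((hμ t).1.comp (P.tendsto_right_prev t)).comp (P.tendsto_fst_right t))

theorem remSum_sub_prev_prev (hΩ : IsGeneric P Ω) (hQ : Ω ⊆ P.Q m) (hF : IsC12 P Ω F) {x : Traj m}
    (hx : x ∈ Ω) {t : ℝ≥0} (ht : 0 < t) :
    Tendsto (fun p : ℕ × ℝ≥0 => remSum P F x p.1 p.2 -
      remSum P F x p.1 (P.prev p.1 (P.prev p.1 t))) (P.leftFilter t) (𝓝 0) := by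
  obtain ⟨μ, -, -, hμ⟩ := exists_sqSum_limits (hQ hx)
  have hpp := P.tendsto_prev_leftFilter ht
  refine tendsto_remSum_sub hΩ hF hx (P.tendsto_fst_left t)
    ((tendsto_snd_full t).mono_left inf_le_left)
    (((tendsto_snd_full t).comp (hpp.mono_right inf_le_left)).comp (P.tendsto_fst_left t)) ?_
  simpa using (hμ t).2.sub (((hμ t).2.comp hpp).comp (P.tendsto_fst_left t))

/-- The factor 2 arises because two indices are compared, each within `y` of the limit of `X`. -/
theorem OscLE.of_abs_le {A : ℕ → ℝ≥0 → ℝ} {r s : ℝ≥0} {X Y : ℕ → ℝ} {y : ℝ}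
    (hX : ∃ a, Tendsto X atTop (𝓝 a)) (hY : Tendsto Y atTop (𝓝 y))
    (h : ∀ᶠ n in atTop, |A n s - A n r - X n| ≤ Y n) :
    OscLE A r s (2 * y) := by
  obtain ⟨a, ha⟩ := hX
  intro γ hγ
  have h1 : ∀ᶠ n in atTop, |A n s - A n r - a| ≤ y + γ / 2 := by
    filter_upwards [h, hY.eventually (gt_mem_nhds (show y < y + γ / 4 by linarith)),
      Metric.tendsto_nhds.1 ha (γ / 4) (by positivity)] with n h2 h3 h4
    rw [Real.dist_eq] at h4
    calc |A n s - A n r - a| = |(A n s - A n r - X n) + (X n - a)| := by ring_nf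
      _ ≤ _ := abs_add_le _ _
      _ ≤ _ := by linarith
  filter_upwards [h1.prod_mk h1] with z hz
  calc _ = |(A z.1 s - A z.1 r - a) - (A z.2 s - A z.2 r - a)| := by ring_nf
    _ ≤ _ := abs_sub _ _
    _ ≤ _ := by linarith [hz.1, hz.2]

theorem oscLE_remSum_right (hΩ : IsGeneric P Ω) (hF : IsC12 P Ω F) {x : Traj m}
    (hx : x ∈ Ω) {μ : ℝ≥0 → ℝ} (hμ : Monotone μ)
    (hpt : ∀ s, Tendsto (fun n => sqSum P x n s) atTop (𝓝 (μ s))) (t : ℝ≥0) :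
    ∃ C : ℝ, ∀ᶠ s in 𝓝[≥] t, OscLE (remSum P F x) t s (C * (μ s - μ t)) := by
  obtain ⟨C, hC, N, η, hη, h⟩ := abs_remSum_sub_le hΩ hF hx t
  refine ⟨2 * C, ?_⟩
  filter_upwards [self_mem_nhdsWithin, mem_nhdsWithin_of_mem_nhds (Metric.ball_mem_nhds t hη)]
    with s hs hs'
  have hY : Tendsto (fun n => C * |sqSum P x n s - sqSum P x n t|) atTop
      (𝓝 (C * |μ s - μ t|)) := ((hpt s).sub (hpt t)).abs.const_mul C
  rw [abs_of_nonneg (sub_nonneg.2 (hμ hs))] at hY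
  rw [mul_assoc]
  refine OscLE.of_abs_le (X := fun _ => 0) ⟨0, tendsto_const_nhds⟩ hY ?_
  filter_upwards [eventually_ge_atTop N] with n hn
  rw [sub_zero]
  exact h n hn t s (by simpa using hη) hs'

/-- Just before `t'_n` the remainder sums agree with the quadratic sums of the second derivative
at `t-`, up to a small multiple of the sum of squares. -/
theorem abs_remSum_sub_quad_le (hΩ : IsGeneric P Ω) (hF : IsC12 P Ω F) {x : Traj m}
    (hx : x ∈ Ω) (t : ℝ≥0) {ε : ℝ} (hε : 0 < ε) :
    ∃ N : ℕ, ∃ η > (0 : ℝ), ∀ n ≥ N, ∀ r s, dist r t < η → dist s t < η → r ≤ s →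
      s < P.prev n t →
      |remSum P F x n s - remSum P F x n r - 1 / 2 *
        (P.stepSum n (fun i => quadForm (vertHess F t (stopLeft x t)) (P.incr n x i)) s -
          P.stepSum n (fun i => quadForm (vertHess F t (stopLeft x t)) (P.incr n x i)) r)| ≤
        ε * (sqSum P x n s - sqSum P x n r) := by
  obtain ⟨N, η, hη, hall⟩ := eventually_fullFilter.1
    (eventually_inf_principal.1 (vertRem_left hΩ hF hx t hε))
  refine ⟨N, η, hη, fun n hn r s hr hs hrs hst => ?_⟩
  have h6 := abs_stepSum_sub_le_of_le (P := P) (n := n)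
    (c := fun i => dropZero (vertRem P F n x) i +
      (-(1 / 2)) * quadForm (vertHess F t (stopLeft x t)) (P.incr n x i))
    (d := fun i => ε * ‖P.incr n x i‖ ^ 2) hrs ?_
  · rw [stepSum_add, stepSum_add, stepSum_const_mul, stepSum_const_mul, stepSum_const_mul,
      stepSum_const_mul, ← mul_sub] at h6
    refine le_trans (le_of_eq ?_) h6
    rw [remSum, remSum]
    congr 1
    ring
  · intro i hi h7 h8
    have hi0 : i ≠ 0 := by
      rintro rfl
      rw [P.pt_zero] at h7
      exact absurd h7 (not_lt.mpr zero_le)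
    have h9 := hall n hn (P.pt n i) (dist_lt_of_between hr hs
      (min_le_iff.2 (Or.inl h7.le)) (le_max_iff.2 (Or.inr h8))) (h8.trans_lt hst) i hi hi0 rfl
    simp only [dropZero, if_neg hi0]
    rwa [neg_mul, ← sub_eq_add_neg]

/-- The sum over `(s, t]` splits into a part strictly before `t'_n`, compared with quadratic sums,
the single term at `t'_n`, and a tail that vanishes. -/
theorem oscLE_remSum_left (hΩ : IsGeneric P Ω) (hQ : Ω ⊆ P.Q m) (hF : IsC12 P Ω F) {x : Traj m}
    (hx : x ∈ Ω) {μ : ℝ≥0 → ℝ} (hμm : Monotone μ)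
    (hμ : ∀ t, Tendsto (fun p : ℕ × ℝ≥0 => sqSum P x p.1 p.2) (P.rightFilter t) (𝓝 (μ t)) ∧
      Tendsto (fun p : ℕ × ℝ≥0 => sqSum P x p.1 p.2) (P.leftFilter t) (𝓝 (Function.leftLim μ t)))
    {t : ℝ≥0} (ht : 0 < t) {ε : ℝ} (hε : 0 < ε) :
    ∀ᶠ s in 𝓝[<] t, OscLE (remSum P F x) s t (ε * (μ t - μ s)) := by
  obtain ⟨q, hq⟩ := exists_quad_limits (hQ hx)
  obtain ⟨N, η, hη, hall⟩ := abs_remSum_sub_quad_le hΩ hF hx t (half_pos hε)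
  have hpp := P.tendsto_prev_leftFilter ht
  have hpp' : Tendsto (fun n => P.prev n (P.prev n t)) atTop (𝓝 t) :=
    (tendsto_snd_full t).comp (hpp.mono_right inf_le_left)
  filter_upwards [self_mem_nhdsWithin, mem_nhdsWithin_of_mem_nhds (Metric.ball_mem_nhds t hη)]
    with s (hs : s < t) hs'
  obtain ⟨-, hqH⟩ := hq (vertHess F t (stopLeft x t))
  generalize vertHess F t (stopLeft x t) = H at hall hqH
  have hY : Tendsto (fun n => ε / 2 * (sqSum P x n (P.prev n (P.prev n t)) - sqSum P x n s)) atTop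
      (𝓝 (ε / 2 * (Function.leftLim μ t - μ s))) :=
    (((hμ t).2.comp hpp).sub ((hμ s).1.comp (P.tendsto_right_const s))).const_mul _
  obtain ⟨ρ, hρ⟩ := vertRem_prev_tendsto hΩ hF hx ht
  -- Every piece of the comparison sequence converges: the tail after `t'_n`, the remainder at
  -- `t'_n`, and the quadratic sums of the Hessian frozen at `(t, x_{t-})`.
  have hX : ∃ a, Tendsto (fun n => (remSum P F x n t - remSum P F x n (P.prev n t)) +
      vertRem P F n x (P.prevIdx n t) +
      1 / 2 * (P.stepSum n (fun i => quadForm H (P.incr n x i)) (P.prev n (P.prev n t)) -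
        P.stepSum n (fun i => quadForm H (P.incr n x i)) s)) atTop (𝓝 a) :=
    ⟨_, (((remSum_sub_prev hΩ hQ hF hx t).comp (P.tendsto_right_const t)).add hρ).add
      ((((hqH t).2.comp hpp).sub ((hqH s).1.comp (P.tendsto_right_const s))).const_mul
        (1 / 2))⟩
  refine (OscLE.of_abs_le hX hY ?_).mono ?_
  · filter_upwards [stepSum_dropZero_prev (P := P) (fun n => vertRem P F n x) ht,
      hpp'.eventually (lt_mem_nhds hs), hpp'.eventually (Metric.ball_mem_nhds t hη),
      eventually_ge_atTop N, P.eventually_prevIdx ht] with n h1 h2 h3 h4 h5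
    refine le_trans (le_of_eq ?_) (hall n h4 s _ hs' h3 h2.le (P.prev_lt h5.1))
    change remSum P F x n (P.prev n t) = remSum P F x n (P.prev n (P.prev n t)) + _ at h1
    rw [h1]
    congr 1
    ring
  · have h6 : Function.leftLim μ t ≤ μ t := hμm.leftLim_le le_rfl
    have : ε * (Function.leftLim μ t - μ s) ≤ ε * (μ t - μ s) := by gcongr
    linarith

theorem exists_tendsto_remSum (hΩ : IsGeneric P Ω) (hQ : Ω ⊆ P.Q m) (hF : IsC12 P Ω F) {x : Traj m}
    (hx : x ∈ Ω) (T : ℝ≥0) :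
    ∃ a, Tendsto (fun n => remSum P F x n T) atTop (𝓝 a) := by
  obtain ⟨μ, hμm, hμc, hμ⟩ := exists_sqSum_limits (hQ hx)
  have hpt : ∀ s, Tendsto (fun n => sqSum P x n s) atTop (𝓝 (μ s)) := fun s =>
    P.tendsto_apply_right (f := sqSum P x) (hμ s).1
  have hr := oscLE_remSum_right hΩ hF hx hμm hpt
  have hl : ∀ t > 0, ∀ ε > (0 : ℝ), ∀ᶠ s in 𝓝[<] t,
      OscLE (remSum P F x) s t (ε * (μ t - μ s)) :=
    fun t ht ε hε => oscLE_remSum_left hΩ hQ hF hx hμm hμ ht hε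
  have h := cauchySeq_of_oscLE hμm (fun t => (hμc t).1) hr hl T
  have h0 : ∀ n, remSum P F x n 0 = 0 := fun n => stepSum_dropZero_zero _
  have h' : CauchySeq fun n => remSum P F x n T := by
    simpa only [h0, sub_zero] using h
  exact cauchySeq_tendsto_of_complete h'

/-! ### Limits of the Riemann sums -/

theorem gradSum_eq (hΩ : IsGeneric P Ω) (hF : IsC12 P Ω F) {x : Traj m} (hx : x ∈ Ω) (T : ℝ≥0) :
    ∀ᶠ n in atTop, ∀ s ≤ T, gradSum P F x n s =
      F s (stopAt (P.approx n x) s) - F 0 (stopAt (P.approx n x) 0) -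
        horizIntegral F (P.approx n x) s - remSum P F x n s := by
  obtain ⟨n₀, K, hK⟩ := hF.horiz_locBdd x hx T
  filter_upwards [hΩ.eventually_approx hx T, eventually_ge_atTop n₀] with n h1 h2 s hs
  have h3 := approx_change_of_variable (hF.cont.leftCont hΩ) (hF.cont.rightCont hΩ) hF.horizDiff
    hF.horiz_rightCont h1.1 h1.2 (hK n h2) hs
  have h4 : P.stepSum n (dropZero (vertIncr P F n x)) s =
      gradSum P F x n s + remSum P F x n s := by
    rw [gradSum, remSum, ← stepSum_add]
    congr 1
    funext i
    simp only [dropZero]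
    split_ifs
    · simp
    · rw [vertRem, gradIncr]; ring
  linarith

theorem exists_tendsto_gradSum_right (hΩ : IsGeneric P Ω) (hQ : Ω ⊆ P.Q m) (hF : IsC12 P Ω F)
    {x : Traj m} (hx : x ∈ Ω) (t : ℝ≥0) :
    ∃ j, Tendsto (fun p : ℕ × ℝ≥0 => gradSum P F x p.1 p.2) (P.rightFilter t) (𝓝 j) := by
  obtain ⟨a, ha⟩ := exists_tendsto_remSum hΩ hQ hF hx t
  obtain ⟨I, hI⟩ := exists_tendsto_horizIntegral hΩ hF.horiz_rightCont hF.horiz_locBdd hx t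
  have h0 := (hF.cont.rightCont hΩ).c x hx 0 (fun _ => 0) tendsto_const_nhds fun n => P.prev_le 0
  have hfst := P.tendsto_fst_right t
  have h1 := remSum_sub_prev hΩ hQ hF hx t
  have h2 : Tendsto (fun n => remSum P F x n (P.prev n t)) atTop (𝓝 a) := by
    simpa using ha.sub (h1.comp (P.tendsto_right_const t))
  have h3 : Tendsto (fun p : ℕ × ℝ≥0 => remSum P F x p.1 p.2) (P.rightFilter t) (𝓝 a) := by
    simpa using h1.add (h2.comp hfst)
  refine ⟨_, (((((hF.cont.rightCont hΩ).tendsto_stopAt hx t).sub (h0.comp hfst)).sub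
    (hI.mono_left inf_le_left)).sub h3).congr' ?_⟩
  filter_upwards [hfst.eventually (gradSum_eq hΩ hF hx (t + 1)),
    ((tendsto_snd_full t).mono_left inf_le_left).eventually
      (gt_mem_nhds (show t < t + 1 by simp))] with p h4 h5
  exact (h4 p.2 h5.le).symm

theorem exists_tendsto_gradSum_left (hΩ : IsGeneric P Ω) (hQ : Ω ⊆ P.Q m) (hF : IsC12 P Ω F)
    {x : Traj m} (hx : x ∈ Ω) {t : ℝ≥0} (ht : 0 < t) :
    ∃ j, Tendsto (fun p : ℕ × ℝ≥0 => gradSum P F x p.1 p.2) (P.leftFilter t) (𝓝 j) := by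
  obtain ⟨a, ha⟩ := exists_tendsto_remSum hΩ hQ hF hx t
  obtain ⟨I, hI⟩ := exists_tendsto_horizIntegral hΩ hF.horiz_rightCont hF.horiz_locBdd hx t
  obtain ⟨ρ, hρ⟩ := vertRem_prev_tendsto hΩ hF hx ht
  have h0 := (hF.cont.rightCont hΩ).c x hx 0 (fun _ => 0) tendsto_const_nhds fun n => P.prev_le 0
  have hfst := P.tendsto_fst_left t
  have h1 := remSum_sub_prev hΩ hQ hF hx t
  have h2 : Tendsto (fun n => remSum P F x n (P.prev n t)) atTop (𝓝 a) := by
    simpa using ha.sub (h1.comp (P.tendsto_right_const t))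
  have h2' : Tendsto (fun n => remSum P F x n (P.prev n (P.prev n t))) atTop (𝓝 (a - ρ)) := by
    refine (h2.sub hρ).congr' ?_
    filter_upwards [stepSum_dropZero_prev (P := P) (fun n => vertRem P F n x) ht] with n hn
    simp only [remSum]
    rw [hn]; ring
  have h3 : Tendsto (fun p : ℕ × ℝ≥0 => remSum P F x p.1 p.2) (P.leftFilter t) (𝓝 (a - ρ)) := by
    simpa using (remSum_sub_prev_prev hΩ hQ hF hx ht).add (h2'.comp hfst)
  refine ⟨_, ((((LeftCont.tendsto_stopAt hΩ (hF.cont.leftCont hΩ) (hF.cont.rightCont hΩ) hx t).sub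
    (h0.comp hfst)).sub (hI.mono_left inf_le_left)).sub h3).congr' ?_⟩
  filter_upwards [hfst.eventually (gradSum_eq hΩ hF hx (t + 1)),
    ((tendsto_snd_full t).mono_left inf_le_left).eventually
      (gt_mem_nhds (show t < t + 1 by simp))] with p h4 h5
  exact (h4 p.2 h5.le).symm

end

section

variable {P : PartitionSeq} {Ω : Set (Traj m)} {F : Functional m ℝ}

/-! ### The Föllmer integral as a limit of Riemann sums -/

theorem riemannSum_eq_stepSum (n : ℕ) (s : ℝ≥0) (x : Traj m) :
    riemannSum P (vertGrad F) n s x = P.stepSum n (gradIncr P F n x) s := rfl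

theorem gradIncr_zero_tendsto (hF : IsC12 P Ω F) {x : Traj m} (hx : x ∈ Ω) (hxc : IsCadlag x) :
    Tendsto (fun n => gradIncr P F n x 0) atTop (𝓝 0) := by
  have h1 := hF.grad_leftCont.c x hx 0 (fun _ => 0) tendsto_const_nhds fun _ => zero_le
  simp only [minus, stopLeft_stopLeft] at h1
  have h2 := h1.inner (𝕜 := ℝ) (tendsto_incr_zero P hxc)
  rw [inner_zero_right] at h2
  refine h2.congr fun n => ?_
  rw [gradIncr, P.pt_zero]

theorem PartitionSeq.eventually_k_pos (P : PartitionSeq) : ∀ᶠ n in atTop, 0 < P.k n := by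
  filter_upwards [P.eventually_lt_last 0] with n hn
  by_contra h0
  rw [Nat.eq_zero_of_not_pos h0, P.pt_zero] at hn
  exact lt_irrefl _ hn

theorem PartitionSeq.tendsto_apply_prev (P : PartitionSeq) {t : ℝ≥0} {f : ℕ → ℝ≥0 → ℝ}
    {l : Filter ℝ} (h : Tendsto (fun p : ℕ × ℝ≥0 => f p.1 p.2) (P.rightFilter t) l) :
    Tendsto (fun n => f n (P.prev n t)) atTop l :=
  h.comp (P.tendsto_right_prev t)

theorem PartitionSeq.tendsto_apply_prev_prev (P : PartitionSeq) {t : ℝ≥0} (ht : 0 < t)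
    {f : ℕ → ℝ≥0 → ℝ} {l : Filter ℝ}
    (h : Tendsto (fun p : ℕ × ℝ≥0 => f p.1 p.2) (P.leftFilter t) l) :
    Tendsto (fun n => f n (P.prev n (P.prev n t))) atTop l :=
  h.comp (P.tendsto_prev_leftFilter ht)

/-- The two one-sided limits differ by the limit of the single term at `t'_n`. -/
theorem exists_gradSum_limits (hΩ : IsGeneric P Ω) (hQ : Ω ⊆ P.Q m) (hF : IsC12 P Ω F)
    {x : Traj m} (hx : x ∈ Ω) {t : ℝ≥0} (ht : 0 < t) :
    ∃ j, Tendsto (fun p : ℕ × ℝ≥0 => gradSum P F x p.1 p.2) (P.leftFilter t) (𝓝 j) ∧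
      Tendsto (fun p : ℕ × ℝ≥0 => gradSum P F x p.1 p.2) (P.rightFilter t)
        (𝓝 (j + inner ℝ (vertGrad F t (stopLeft x t)) (jump x t))) := by
  obtain ⟨j, hj⟩ := exists_tendsto_gradSum_left hΩ hQ hF hx ht
  obtain ⟨j', hj'⟩ := exists_tendsto_gradSum_right hΩ hQ hF hx t
  refine ⟨j, hj, ?_⟩
  have h1 := (P.tendsto_apply_prev_prev (f := gradSum P F x) ht hj).add
    (gradIncr_prev_tendsto hF hx (hΩ.cadlag x hx) ht)
  have h2 := P.tendsto_apply_prev (f := gradSum P F x) hj'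
  rw [← tendsto_nhds_unique (h1.congr' ?_) h2] at hj'
  · exact hj'
  · filter_upwards [stepSum_dropZero_prev (P := P) (fun n => gradIncr P F n x) ht] with n hn
    exact hn.symm

/-- This serves `y = x_t` and `y = x_{t-}` at once: the Riemann sums differ only in the increment
over the interval starting at `t'_n`, which runs from `x(t'_n)` to `y(t)`. -/
theorem riemannSum_eq_prev {x y : Traj m} {t : ℝ≥0} (ht : 0 < t) (hxy : ∀ u < t, y u = x u)
    (hy : ∀ u ≥ t, y u = y t) :
    ∀ᶠ n in atTop, riemannSum P (vertGrad F) n t y =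
      P.stepSum n (gradIncr P F n x) (P.prev n (P.prev n t)) +
        inner ℝ (vertGrad F (P.prev n t) (stopLeft (P.approx n x) (P.prev n t)))
          (y t - x (P.prev n t)) := by
  filter_upwards [P.eventually_prevIdx ht] with n ⟨h1, h2, h3, h4, h5⟩
  set j := P.prevIdx n t with hj
  rw [riemannSum_eq_stepSum]
  have hj0 : j ≠ 0 := by
    intro h0
    rw [← h3, h0, P.pt_zero] at h1
    exact lt_irrefl _ h1
  -- Partition points after `t'_n` are at or beyond `t`, where `y` is constant and has no
  -- increments.
  have e1 : P.stepSum n (gradIncr P F n y) t = P.stepSum n (gradIncr P F n y) (P.prev n t) := by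
    rw [← sub_eq_zero, stepSum_sub _ (P.prev_le t)]
    refine Finset.sum_eq_zero fun i hi => ?_
    split_ifs with h
    · have hi := Finset.mem_range.1 hi
      have h6 := P.le_of_prev_lt hi.le h.1
      rw [gradIncr, PartitionSeq.incr, hy _ h6,
        hy _ (h6.trans (P.pt_le_pt n (Nat.le_succ i) hi)), sub_self, inner_zero_right]
    · rfl
  have hlt : ∀ l ≤ j, P.pt n l < t := fun l hl => (P.pt_le_pt n hl h2.le).trans_lt h4
  rw [e1, ← h3, stepSum_prev _ h2 (h3 ▸ h1)]
  congr 1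
  · refine Finset.sum_congr rfl fun i hi => ?_
    have hi := Finset.mem_range.1 hi
    split_ifs with h
    · have h6 : i < j := by
        rw [← P.pt_lt_iff n hi.le h2.le]
        exact h.trans_lt (P.prev_lt (h3 ▸ h1))
      rw [gradIncr, gradIncr, stopLeft_approx_congr P (x := x) hi
        fun l hl _ _ => hxy _ (hlt l (by omega)), PartitionSeq.incr, PartitionSeq.incr,
        hxy _ (hlt i h6.le), hxy _ (hlt (i + 1) h6)]
    · rfl
  · rw [gradIncr, stopLeft_approx_congr P (x := x) h2
      fun l _ _ h => hxy _ (hlt l (h.resolve_right hj0)), PartitionSeq.incr, hy _ h5,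
      hxy _ (hlt j le_rfl)]

theorem tendsto_riemannSum_of_eq (hΩ : IsGeneric P Ω) (hF : IsC12 P Ω F) {x : Traj m}
    (hx : x ∈ Ω) {t : ℝ≥0} (ht : 0 < t) {j : ℝ}
    (hj : Tendsto (fun p : ℕ × ℝ≥0 => gradSum P F x p.1 p.2) (P.leftFilter t) (𝓝 j))
    {y : Traj m} (hxy : ∀ u < t, y u = x u) (hy : ∀ u ≥ t, y u = y t) :
    Tendsto (fun n => riemannSum P (vertGrad F) n t y) atTop
      (𝓝 (j + inner ℝ (vertGrad F t (stopLeft x t)) (y t - Function.leftLim x t))) := by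
  have hxc := hΩ.cadlag x hx
  have h1 := hF.grad_leftCont.c x hx t (fun n => P.prev n t) (P.tendsto_prev t) fun _ => le_rfl
  simp only [minus, stopLeft_stopLeft] at h1
  have h2 := h1.inner (𝕜 := ℝ) (((hxc.tendsto_leftLim t).comp (P.tendsto_prev_lt ht)).const_sub
    (y t))
  have h3 : Tendsto (fun n => P.stepSum n (gradIncr P F n x) (P.prev n (P.prev n t))) atTop
      (𝓝 j) := by
    have h4 := (hj.comp (P.tendsto_prev_leftFilter ht)).add (gradIncr_zero_tendsto hF hx hxc)
    rw [add_zero] at h4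
    refine h4.congr' ?_
    filter_upwards [P.eventually_k_pos] with n hn
    exact (stepSum_dropZero P _ _ hn).symm
  refine (h3.add h2).congr' ?_
  filter_upwards [riemannSum_eq_prev (P := P) (F := F) ht hxy hy] with n hn
  exact hn.symm

theorem gradSum_zero (x : Traj m) (n : ℕ) : gradSum P F x n 0 = 0 := stepSum_dropZero_zero _

theorem follmerIntegral_zero (x : Traj m) :
    follmerIntegral P (vertGrad F) 0 (stopAt x 0) = 0 := by
  have h : ∀ n, riemannSum P (vertGrad F) n 0 (stopAt x 0) = 0 := fun n => by
    refine Finset.sum_eq_zero fun i _ => ?_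
    simp [stopAt]
  simp only [follmerIntegral, h]
  exact tendsto_const_nhds.limUnder_eq

/-- The integrals along `x_{t-}` and `x_t` share everything before `t'_n` and add the limiting
gradient paired with `0` and with `Δx(t)` respectively. -/
theorem tendsto_gradSum (hΩ : IsGeneric P Ω) (hQ : Ω ⊆ P.Q m) (hF : IsC12 P Ω F)
    {x : Traj m} (hx : x ∈ Ω) (t : ℝ≥0) :
    Tendsto (fun p : ℕ × ℝ≥0 => gradSum P F x p.1 p.2) (P.leftFilter t)
        (𝓝 (follmerIntegral P (vertGrad F) t (stopLeft x t))) ∧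
      Tendsto (fun p : ℕ × ℝ≥0 => gradSum P F x p.1 p.2) (P.rightFilter t)
        (𝓝 (follmerIntegral P (vertGrad F) t (stopAt x t))) := by
  rcases eq_or_lt_of_le (zero_le : (0 : ℝ≥0) ≤ t) with rfl | ht
  · rw [P.leftFilter_zero, follmerIntegral_zero]
    refine ⟨tendsto_bot, ?_⟩
    obtain ⟨j, hj⟩ := exists_tendsto_gradSum_right hΩ hQ hF hx 0
    have h1 := P.tendsto_apply_right (f := gradSum P F x) hj
    simp only [gradSum_zero] at h1
    rwa [tendsto_nhds_unique tendsto_const_nhds h1]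
  · obtain ⟨j, hj, hj'⟩ := exists_gradSum_limits hΩ hQ hF hx ht
    have h1 := tendsto_riemannSum_of_eq hΩ hF hx ht hj (y := stopLeft x t)
      (fun u hu => if_pos hu) fun u hu => by
        simp only [stopLeft, if_neg (not_lt.mpr hu), if_neg (lt_irrefl t)]
    have h2 := tendsto_riemannSum_of_eq hΩ hF hx ht hj (y := stopAt x t)
      (fun u hu => by rw [stopAt, min_eq_left hu.le]) fun u hu => by
        simp only [stopAt, min_eq_right hu, min_self]
    have e1 : stopLeft x t t = Function.leftLim x t := if_neg (lt_irrefl t)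
    have e2 : stopAt x t t = x t := by rw [stopAt, min_self]
    rw [e1, sub_self, inner_zero_right, add_zero] at h1
    rw [e2] at h2
    rw [follmerIntegral, follmerIntegral, h1.limUnder_eq, h2.limUnder_eq]
    exact ⟨hj, hj'⟩

theorem tendsto_riemannSum (hΩ : IsGeneric P Ω) (hQ : Ω ⊆ P.Q m) (hF : IsC12 P Ω F)
    {x : Traj m} (hx : x ∈ Ω) (t : ℝ≥0) :
    Tendsto (fun n => riemannSum P (vertGrad F) n t x) atTop
      (𝓝 (follmerIntegral P (vertGrad F) t (stopAt x t))) := by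
  have h1 := (P.tendsto_apply_right (f := gradSum P F x) (tendsto_gradSum hΩ hQ hF hx t).2).add
    (gradIncr_zero_tendsto hF hx (hΩ.cadlag x hx))
  rw [add_zero] at h1
  refine h1.congr' ?_
  filter_upwards [P.eventually_k_pos] with n hn
  exact (stepSum_dropZero P _ _ hn).symm

/-! ### The Föllmer integral along step paths -/

theorem stopAt_approx_sub (x : Traj m) {n : ℕ} {s : ℝ≥0} (hs : s < P.pt n (P.k n)) {a b : ℝ≥0}
    (hab : a ≤ b) :
    stopAt (P.approx n x) s b - stopAt (P.approx n x) s a =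
      ∑ j ∈ Finset.range (P.k n), if P.pt n j ≤ s ∧ a < P.pt n j ∧ P.pt n j ≤ b then
        dropZero (P.incr n x) j else 0 := by
  rw [stopAt, stopAt, approx_eq_stepSum P x ((min_le_right _ _).trans_lt hs),
    approx_eq_stepSum P x ((min_le_right _ _).trans_lt hs), add_sub_add_left_eq_sub,
    stepSum_sub _ (min_le_min_right s hab)]
  refine Finset.sum_congr rfl fun j _ => ?_
  congr 1
  simp only [min_lt_iff, le_min_iff, eq_iff_iff]
  constructor
  · rintro ⟨h1, h2, h3⟩
    exact ⟨h3, h1.resolve_right (not_lt.mpr h3), h2⟩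
  · rintro ⟨h1, h2, h3⟩
    exact ⟨Or.inl h2, h3, h1⟩

theorem PartitionSeq.eq_prevIdx {P : PartitionSeq} {N i : ℕ} {τ : ℝ≥0} (hτ : 0 < τ)
    (hl : τ ≤ P.pt N (P.k N)) (hi : i < P.k N) (h1 : P.pt N i < τ) (h2 : τ ≤ P.pt N (i + 1)) :
    i = P.prevIdx N τ := by
  obtain ⟨h3, -, h4, h5⟩ := P.prevIdx_spec hτ hl
  have h6 := (P.pt_lt_iff N hi.le h3).1 (h1.trans_le h5)
  have h7 := (P.pt_lt_iff N h3.le hi).1 (h4.trans_le h2)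
  omega

/-- Integrating along a step path means refining the partition `π_N` around its finitely many jumps.
Each jump falls in one interval of `π_N`, starting at the predecessor of the jump time, and
left-continuity of the gradient gives its limit. Allowing `r < s` also covers `x^n_{s-}`, which
equals `x^n_r` for `r` slightly below `s`. -/
theorem follmerIntegral_approx (hF : IsC12 P Ω F) {x : Traj m} {n : ℕ} {s r : ℝ≥0}
    (hw : stopAt (P.approx n x) r ∈ Ω) (hr : r < P.pt n (P.k n)) (hrs : r ≤ s) :
    follmerIntegral P (vertGrad F) s (stopAt (P.approx n x) r) = gradSum P F x n r := by
  set w := stopAt (P.approx n x) r with hwdef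
  let φ : ℕ → ℕ → Vec m := fun N i => vertGrad F (P.pt N i) (stopLeft (P.approx N w) (P.pt N i))
  -- Each increment of the step path over an interval of `π_N` is written as the sum of the jumps in
  -- it, so that the sum over the fixed jumps can be taken outside.
  have hsum : ∀ N, riemannSum P (vertGrad F) N s w = ∑ j ∈ Finset.range (P.k n),
      ∑ i ∈ Finset.range (P.k N), if P.pt N i ≤ s ∧ P.pt n j ≤ r ∧ P.pt N i < P.pt n j ∧
        P.pt n j ≤ P.pt N (i + 1) then inner ℝ (φ N i) (dropZero (P.incr n x) j) else 0 := by
    intro N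
    rw [Finset.sum_comm, riemannSum]
    refine Finset.sum_congr rfl fun i hi => ?_
    split_ifs with h
    · rw [hwdef, stopAt_approx_sub x hr (P.pt_le_pt N (Nat.le_succ i) (Finset.mem_range.1 hi)),
        inner_sum]
      refine Finset.sum_congr rfl fun j _ => ?_
      simp only [h, true_and]
      split_ifs
      · rfl
      · rw [inner_zero_right]
    · simp [h]
  have hlim : Tendsto (fun N => riemannSum P (vertGrad F) N s w) atTop
      (𝓝 (gradSum P F x n r)) := by
    simp only [hsum]
    refine tendsto_finsetSum _ fun j hj => ?_
    have hj := Finset.mem_range.1 hj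
    by_cases hjr : P.pt n j ≤ r
    swap
    · simp [hjr]
    rcases eq_or_ne j 0 with rfl | hj0
    · simp [dropZero]
    have hpos : 0 < P.pt n j := by
      have := P.pt_lt_pt n (Nat.pos_of_ne_zero hj0) hj.le
      rwa [P.pt_zero] at this
    have h1 := hF.grad_leftCont.c w hw (P.pt n j) (fun N => P.prev N (P.pt n j))
      (P.tendsto_prev _) fun _ => le_rfl
    simp only [minus, stopLeft_stopLeft] at h1
    rw [hwdef, stopLeft_stopAt _ hjr, ← hwdef] at h1
    have h2 := h1.inner (𝕜 := ℝ) (tendsto_const_nhds (x := P.incr n x j))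
    simp only [hjr, if_true, dropZero, if_neg hj0]
    refine h2.congr' ?_
    filter_upwards [P.eventually_prevIdx hpos, P.eventually_lt_last (P.pt n j)]
      with N ⟨_, h3, h4, h5, h6⟩ h7
    rw [Finset.sum_eq_single_of_mem (P.prevIdx N (P.pt n j)) (Finset.mem_range.2 h3), if_pos]
    · simp only [φ, h4]
    · exact ⟨h5.le.trans (hjr.trans hrs), trivial, h5, h6⟩
    · intro i hi hne
      rw [if_neg]
      rintro ⟨-, -, h8, h9⟩
      exact hne (PartitionSeq.eq_prevIdx hpos h7.le (Finset.mem_range.1 hi) h8 h9)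
  exact hlim.limUnder_eq

theorem stopLeft_approx_eventually (x : Traj m) {n : ℕ} {s : ℝ≥0} (hs0 : 0 < s)
    (hs : s < P.pt n (P.k n)) :
    ∀ᶠ r in 𝓝[<] s, stopLeft (P.approx n x) s = stopAt (P.approx n x) r := by
  obtain ⟨i, hi, -, h1, h2⟩ := P.exists_prev_next hs0 hs.le
  have := nhdsLT_neBot_of_pos hs0
  have hc : ∀ u, P.pt n i ≤ u → u < s → P.approx n x u = x (P.pt n (i + 1)) :=
    fun u hu hus => approx_eq P x hi hu (hus.trans_le h2)
  have hl : Function.leftLim (P.approx n x) s = x (P.pt n (i + 1)) := by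
    refine leftLim_eq_of_tendsto (tendsto_const_nhds.congr' ?_)
    filter_upwards [Ico_mem_nhdsLT h1] with u hu
    exact (hc u hu.1 hu.2).symm
  filter_upwards [Ico_mem_nhdsLT h1] with r hr
  funext u
  simp only [stopLeft, stopAt]
  rcases le_total u r with hur | hur
  · rw [min_eq_left hur, if_pos (hur.trans_lt hr.2)]
  · rw [min_eq_right hur, hc r hr.1 hr.2]
    split_ifs with hus
    · exact hc u (hr.1.trans hur) hus
    · exact hl

theorem eventually_follmerIntegral_approx (hΩ : IsGeneric P Ω) (hF : IsC12 P Ω F) {x : Traj m}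
    (hx : x ∈ Ω) (T : ℝ≥0) :
    ∀ᶠ n in atTop, ∀ s ≤ T,
      follmerIntegral P (vertGrad F) s (stopAt (P.approx n x) s) = gradSum P F x n s ∧
      ∀ᶠ r in 𝓝[<] s,
        follmerIntegral P (vertGrad F) s (stopLeft (P.approx n x) s) = gradSum P F x n r := by
  filter_upwards [hΩ.eventually_approx hx T] with n hn s hs
  have hTT : T < T + 1 := by simp
  have hmem : ∀ r ≤ T, stopAt (P.approx n x) r ∈ Ω := fun r hr => by
    have := hΩ.stopAt_mem hn.2 r
    rwa [stopAt_stopAt _ (hr.trans hTT.le)] at this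
  refine ⟨follmerIntegral_approx hF (hmem s hs) ((hs.trans_lt hTT).trans hn.1) le_rfl, ?_⟩
  rcases eq_or_lt_of_le (zero_le : (0 : ℝ≥0) ≤ s) with rfl | hs0
  · simp
  filter_upwards [stopLeft_approx_eventually x hs0 ((hs.trans_lt hTT).trans hn.1),
    self_mem_nhdsWithin] with r h1 (h2 : r < s)
  rw [h1]
  exact follmerIntegral_approx hF (hmem r (h2.le.trans hs))
    (((h2.le.trans hs).trans_lt hTT).trans hn.1) h2.le

/-! ### Continuity of the Föllmer integral -/

/-- For `s < t` the points `t'_n` eventually exceed a neighbourhood of `s`. A joint limit on the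
left of `t` thus controls all limits at nearby earlier times, on both of their sides. -/
theorem eventually_nhdsLT_of_leftFilter {t : ℝ≥0} {p : ℕ × ℝ≥0 → Prop}
    (h : ∀ᶠ z in P.leftFilter t, p z) : ∀ᶠ s in 𝓝[<] t, ∀ᶠ z in fullFilter s, p z := by
  obtain ⟨N, η, hη, h⟩ := eventually_fullFilter.1 (eventually_inf_principal.1 h)
  filter_upwards [self_mem_nhdsWithin, mem_nhdsWithin_of_mem_nhds (Metric.ball_mem_nhds t hη)]
    with s (hs : s < t) hs'
  obtain ⟨b, hsb, hbt⟩ := exists_between hs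
  filter_upwards [(tendsto_fst_full s).eventually ((eventually_ge_atTop N).and
    ((P.tendsto_prev t).eventually (lt_mem_nhds hbt))),
    (tendsto_snd_full s).eventually (gt_mem_nhds hsb),
    (tendsto_snd_full s).eventually (Metric.isOpen_ball.mem_nhds hs')] with z h1 h2 h3
  exact h z.1 h1.1 z.2 h3 (h2.trans h1.2)

theorem eventually_nhdsGT_of_rightFilter {t : ℝ≥0} {p : ℕ × ℝ≥0 → Prop}
    (h : ∀ᶠ z in P.rightFilter t, p z) : ∀ᶠ s in 𝓝[>] t, ∀ᶠ z in fullFilter s, p z := by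
  obtain ⟨N, η, hη, h⟩ := eventually_fullFilter.1 (eventually_inf_principal.1 h)
  filter_upwards [self_mem_nhdsWithin, mem_nhdsWithin_of_mem_nhds (Metric.ball_mem_nhds t hη)]
    with s (hs : t < s) hs'
  filter_upwards [(tendsto_fst_full s).eventually (eventually_ge_atTop N),
    (tendsto_snd_full s).eventually (lt_mem_nhds hs),
    (tendsto_snd_full s).eventually (Metric.isOpen_ball.mem_nhds hs')] with z h1 h2 h3
  exact h z.1 h1 z.2 h3 ((P.prev_le t).trans h2.le)

theorem follmerIntegral_mem_of_eventually (hΩ : IsGeneric P Ω) (hQ : Ω ⊆ P.Q m) (hF : IsC12 P Ω F)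
    {x : Traj m} (hx : x ∈ Ω) {s : ℝ≥0} {W : Set ℝ} (hW : IsClosed W)
    (h : ∀ᶠ z in fullFilter s, gradSum P F x z.1 z.2 ∈ W) :
    follmerIntegral P (vertGrad F) s (stopAt x s) ∈ W ∧
      follmerIntegral P (vertGrad F) s (stopLeft x s) ∈ W := by
  obtain ⟨hl, hr⟩ := tendsto_gradSum hΩ hQ hF hx s
  have h1 : follmerIntegral P (vertGrad F) s (stopAt x s) ∈ W :=
    hW.mem_of_tendsto (hr.comp (P.tendsto_right_const s))
      ((P.tendsto_right_const s).eventually (h.filter_mono inf_le_left))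
  refine ⟨h1, ?_⟩
  rcases eq_or_lt_of_le (zero_le : (0 : ℝ≥0) ≤ s) with rfl | hs0
  · rwa [stopLeft_zero]
  · exact hW.mem_of_tendsto (hl.comp (P.tendsto_prev_leftFilter hs0))
      ((P.tendsto_prev_leftFilter hs0).eventually (h.filter_mono inf_le_left))

theorem follmerIntegral_tendsto_left (hΩ : IsGeneric P Ω) (hQ : Ω ⊆ P.Q m) (hF : IsC12 P Ω F)
    {x : Traj m} (hx : x ∈ Ω) (t : ℝ≥0) :
    Tendsto (fun s => follmerIntegral P (vertGrad F) s (stopAt x s)) (𝓝[<] t)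
        (𝓝 (follmerIntegral P (vertGrad F) t (stopLeft x t))) ∧
      Tendsto (fun s => follmerIntegral P (vertGrad F) s (stopLeft x s)) (𝓝[<] t)
        (𝓝 (follmerIntegral P (vertGrad F) t (stopLeft x t))) := by
  have key : ∀ W ∈ 𝓝 (follmerIntegral P (vertGrad F) t (stopLeft x t)), IsClosed W →
      ∀ᶠ s in 𝓝[<] t, follmerIntegral P (vertGrad F) s (stopAt x s) ∈ W ∧
        follmerIntegral P (vertGrad F) s (stopLeft x s) ∈ W := fun W hW hWc =>
    (eventually_nhdsLT_of_leftFilter ((tendsto_gradSum hΩ hQ hF hx t).1.eventually hW)).mono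
      fun s hs => follmerIntegral_mem_of_eventually hΩ hQ hF hx hWc hs
  simp only [(closed_nhds_basis _).tendsto_right_iff]
  exact ⟨fun W hW => (key W hW.1 hW.2).mono fun _ h => h.1,
    fun W hW => (key W hW.1 hW.2).mono fun _ h => h.2⟩

theorem follmerIntegral_tendsto_right (hΩ : IsGeneric P Ω) (hQ : Ω ⊆ P.Q m) (hF : IsC12 P Ω F)
    {x : Traj m} (hx : x ∈ Ω) (t : ℝ≥0) :
    Tendsto (fun s => follmerIntegral P (vertGrad F) s (stopAt x s)) (𝓝[>] t)
        (𝓝 (follmerIntegral P (vertGrad F) t (stopAt x t))) ∧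
      Tendsto (fun s => follmerIntegral P (vertGrad F) s (stopLeft x s)) (𝓝[>] t)
        (𝓝 (follmerIntegral P (vertGrad F) t (stopAt x t))) := by
  have key : ∀ W ∈ 𝓝 (follmerIntegral P (vertGrad F) t (stopAt x t)), IsClosed W →
      ∀ᶠ s in 𝓝[>] t, follmerIntegral P (vertGrad F) s (stopAt x s) ∈ W ∧
        follmerIntegral P (vertGrad F) s (stopLeft x s) ∈ W := fun W hW hWc =>
    (eventually_nhdsGT_of_rightFilter ((tendsto_gradSum hΩ hQ hF hx t).2.eventually hW)).mono
      fun s hs => follmerIntegral_mem_of_eventually hΩ hQ hF hx hWc hs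
  simp only [(closed_nhds_basis _).tendsto_right_iff]
  exact ⟨fun W hW => (key W hW.1 hW.2).mono fun _ h => h.1,
    fun W hW => (key W hW.1 hW.2).mono fun _ h => h.2⟩

theorem eventually_follmerIntegral_approx_seq (hΩ : IsGeneric P Ω) (hF : IsC12 P Ω F) {x : Traj m}
    (hx : x ∈ Ω) {t : ℝ≥0} {u : ℕ → ℝ≥0} (hu : Tendsto u atTop (𝓝 t)) :
    ∀ᶠ n in atTop,
      follmerIntegral P (vertGrad F) (u n) (stopAt (P.approx n x) (u n)) = gradSum P F x n (u n) ∧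
      ∀ᶠ r in 𝓝[<] (u n), follmerIntegral P (vertGrad F) (u n) (stopLeft (P.approx n x) (u n)) =
        gradSum P F x n r := by
  filter_upwards [eventually_follmerIntegral_approx hΩ hF hx (t + 1),
    hu.eventually (gt_mem_nhds (show t < t + 1 by simp))] with n h1 h2
  exact h1 _ h2.le

/-- Left limits along step paths are values of the Riemann sums at nearby earlier times. -/
theorem exists_gradSum_eq_stopLeft (hΩ : IsGeneric P Ω) (hF : IsC12 P Ω F) {x : Traj m}
    (hx : x ∈ Ω) {t : ℝ≥0} {u c : ℕ → ℝ≥0} (hu : Tendsto u atTop (𝓝 t)) (hc : ∀ n, c n < u n) :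
    ∃ v : ℕ → ℝ≥0, Tendsto v atTop (𝓝 t) ∧ (∀ n, c n < v n ∧ v n < u n) ∧
      ∀ᶠ n in atTop, follmerIntegral P (vertGrad F) (u n) (stopLeft (P.approx n x) (u n)) =
        gradSum P F x n (v n) := by
  have hex : ∀ n, ∃ v : ℝ≥0, (c n < v ∧ v < u n) ∧ dist v (u n) < 1 / ((n : ℝ) + 1) ∧
      ((∀ᶠ r in 𝓝[<] (u n), follmerIntegral P (vertGrad F) (u n)
        (stopLeft (P.approx n x) (u n)) = gradSum P F x n r) →
        follmerIntegral P (vertGrad F) (u n) (stopLeft (P.approx n x) (u n)) =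
          gradSum P F x n v) := by
    intro n
    have := nhdsLT_neBot_of_exists_lt ⟨_, hc n⟩
    have h1 : ∀ᶠ v in 𝓝[<] (u n), dist v (u n) < 1 / ((n : ℝ) + 1) :=
      mem_nhdsWithin_of_mem_nhds (Metric.ball_mem_nhds _ (by positivity))
    have h2 : ∀ᶠ v in 𝓝[<] (u n), c n < v ∧ v < u n := Ioo_mem_nhdsLT (hc n)
    -- The identity is available only for large `n`; for the others any admissible point close to `u
    -- n` will do.
    by_cases h : ∀ᶠ r in 𝓝[<] (u n), follmerIntegral P (vertGrad F) (u n)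
        (stopLeft (P.approx n x) (u n)) = gradSum P F x n r
    · obtain ⟨v, h3, h4, h5⟩ := (h2.and (h1.and h)).exists
      exact ⟨v, h3, h4, fun _ => h5⟩
    · obtain ⟨v, h3, h4⟩ := (h2.and h1).exists
      exact ⟨v, h3, h4, fun h' => absurd h' h⟩
  choose v h1 h2 h3 using hex
  refine ⟨v, ?_, h1, ?_⟩
  · have h4 : Tendsto (fun n => dist (u n) (v n)) atTop (𝓝 0) :=
      squeeze_zero (fun _ => dist_nonneg) (fun n => (dist_comm _ _).trans_le (h2 n).le)
        tendsto_one_div_add_atTop_nhds_zero_nat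
    exact (tendsto_iff_of_dist h4).1 hu
  · exact (eventually_follmerIntegral_approx_seq hΩ hF hx hu).mono fun n hn => h3 n hn.2

theorem follmerIntegral_leftCont (hΩ : IsGeneric P Ω) (hQ : Ω ⊆ P.Q m) (hF : IsC12 P Ω F) :
    LeftCont P Ω (follmerIntegral P (vertGrad F)) where
  a x hx t := by
    rw [← Iio_insert, nhdsWithin_insert]
    exact (tendsto_pure_nhds _ _).sup (follmerIntegral_tendsto_left hΩ hQ hF hx t).2
  b x hx t := (follmerIntegral_tendsto_left hΩ hQ hF hx t).1
  c x hx t u hu hup := by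
    rcases eq_or_lt_of_le (zero_le : (0 : ℝ≥0) ≤ t) with rfl | ht
    · have hu0 : ∀ n, u n = 0 := fun n => by
        have := hup n
        rw [P.prev_zero] at this
        exact nonpos_iff_eq_zero.1 this
      simp only [hu0, stopLeft_zero, follmerIntegral_zero]
      exact tendsto_const_nhds
    · have hpos := hu.eventually (lt_mem_nhds ht)
      -- The finitely many vanishing times are replaced by `t`, so that there is room strictly
      -- between `0` and every time.
      have hu' : Tendsto (fun n => if 0 < u n then u n else t) atTop (𝓝 t) :=
        hu.congr' (hpos.mono fun n hn => (if_pos hn).symm)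
      obtain ⟨v, hv, hvu, hve⟩ := exists_gradSum_eq_stopLeft hΩ hF hx hu' (c := fun _ => 0)
        fun n => by
          show 0 < if 0 < u n then u n else t
          split_ifs with h
          · exact h
          · exact ht
      have h1 : Tendsto (fun n => (n, v n)) atTop (P.leftFilter t) := by
        refine P.tendsto_leftFilter tendsto_id hv ?_
        filter_upwards [hpos] with n hn
        have := (hvu n).2
        rw [if_pos hn] at this
        exact this.trans_le (hup n)
      refine ((tendsto_gradSum hΩ hQ hF hx t).1.comp h1).congr' ?_
      filter_upwards [hve, hpos] with n h2 h3
      rw [if_pos h3] at h2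
      exact h2.symm
  d x hx t u hu hup := by
    refine ((tendsto_gradSum hΩ hQ hF hx t).1.comp
      (P.tendsto_leftFilter tendsto_id hu (Eventually.of_forall hup))).congr' ?_
    filter_upwards [eventually_follmerIntegral_approx_seq hΩ hF hx hu] with n hn
    exact hn.1.symm

theorem follmerIntegral_rightCont (hΩ : IsGeneric P Ω) (hQ : Ω ⊆ P.Q m) (hF : IsC12 P Ω F) :
    RightCont P Ω (follmerIntegral P (vertGrad F)) where
  a x hx t := by
    rw [← Ioi_insert, nhdsWithin_insert]
    exact (tendsto_pure_nhds _ _).sup (follmerIntegral_tendsto_right hΩ hQ hF hx t).1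
  b x hx t := (follmerIntegral_tendsto_right hΩ hQ hF hx t).2
  c x hx t u hu hup := by
    refine ((tendsto_gradSum hΩ hQ hF hx t).2.comp
      (P.tendsto_rightFilter tendsto_id hu (Eventually.of_forall hup))).congr' ?_
    filter_upwards [eventually_follmerIntegral_approx_seq hΩ hF hx hu] with n hn
    exact hn.1.symm
  d x hx t u hu hup := by
    -- With lower bound `t'_n < u n`, the earlier times stay strictly to the right of `t'_n`.
    obtain ⟨v, hv, hvu, hve⟩ := exists_gradSum_eq_stopLeft hΩ hF hx hu hup
    refine ((tendsto_gradSum hΩ hQ hF hx t).2.comp (P.tendsto_rightFilter tendsto_id hv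
      (Eventually.of_forall fun n => (hvu n).1.le))).congr' ?_
    filter_upwards [hve] with n hn
    exact hn.symm

theorem follmerIntegral_isPathwiseIntegral (hΩ : IsGeneric P Ω) (hQ : Ω ⊆ P.Q m)
    (hF : IsC12 P Ω F) :
    IsPathwiseIntegral P Ω (vertGrad F) (follmerIntegral P (vertGrad F)) where
  leftCont := hF.grad_leftCont
  tendsto _ hx t := tendsto_riemannSum hΩ hQ hF hx t
  cont := (follmerIntegral_leftCont hΩ hQ hF).piContinuous (follmerIntegral_rightCont hΩ hQ hF)

end

end PathCalc

end

theorem mainTheorem6 (m : ℕ) (P : PathCalc.PartitionSeq) (Ω : Set (PathCalc.Traj m))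
    (hΩ : PathCalc.IsGeneric P Ω) (hQ : Ω ⊆ P.Q m)
    (F : PathCalc.Functional m ℝ) (hF : PathCalc.IsC12 P Ω F) :
    PathCalc.PiContinuous P Ω (PathCalc.follmerIntegral P (PathCalc.vertGrad F)) ∧
    PathCalc.IsPathwiseIntegrable P Ω (PathCalc.vertGrad F) ∧
    PathCalc.IsPathwiseIntegral P Ω (PathCalc.vertGrad F)
      (PathCalc.follmerIntegral P (PathCalc.vertGrad F)) :=
  have h := PathCalc.follmerIntegral_isPathwiseIntegral hΩ hQ hF
  ⟨h.cont, ⟨_, h⟩, h⟩
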